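/- Let $X$ be one of the 23 Niemeier root systems $$A_1^{24},A_2^{12},A_3^{8},A_4^6,A_5^4D_4,A_6^4,A_7^2D_5^2,A_8^3,A_9^2D_6,A_{11}D_7E_6,A_{12}^2,A_{15}D_9,A_{17}E_7,A_{24},$$ $$D_4^6,D_6^4,D_8^3,D_{10}E_7^2,D_{12}^2,D_{16}E_8,D_{24},\qquad E_6^4,E_8^3.$$ All irreducible components of $X$ have the same Coxeter number $m$. Let $d^X$ be the number of irreducible components of $X$. *Frame shapes.* A Frame shape is a formal product $\pi=\prod_n n^{k_n}$ over positive integers $n$, with $k_n\in\mathbb Z$ almost all $0$; it is a shorthand for the rational function $\prod_n(x^n-1)^{k_n}$. Each irreducible component $Y$ of $X$ has a unique Frame shape $\pi^Y$ whose rational function is the characteristic polynomial of the Coxeter elements of $Y$ (products of the reflections in all simple roots, each taken once, in any order). The Coxeter Frame shape $\pi^X$ is the product of the $\pi^Y$ over the irreducible components $Y$ of $X$. For $\pi=\prod_n n^{k_n}$ put $\eta_\pi(\tau)=\prod_n\eta(n\tau)^{k_n}$, where $\eta$ is the Dedekind eta function. *Groups.* For a positive integer $n$ and a subgroup $S$ of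 the group of exact divisors of $n$ (with operation $e*f=ef/\gcd(e,f)^2$) let $$\Gamma_0(n)+S=\left\{\tfrac1{\sqrt e}\begin{pmatrix}ae&b\\cn&de\end{pmatrix} : a,b,c,d\in\mathbb Z,\ e\in S,\ ade-bcn/e=1\right\}\subset SL_2(\mathbb R).$$ Write $\Gamma_0(n)+e,f,\dots$ for $S=\{1,e,f,\dots\}$ and $\Gamma_0(n)$ for $S=\{1\}$. Let $\Gamma^X=\Gamma_0(m)$ if $X$ has a component of type $A$; $\Gamma^X=\Gamma_0(m)+\frac m2$ if $X$ has a component of type $D$ but none of type $A$; $\Gamma^X=\Gamma_0(12)+4$ if $X=E_6^4$; and $\Gamma^X=\Gamma_0(30)+6,10,15$ if $X=E_8^3$. *Principal moduli.* A modular function for $\Gamma^X$ is a $\Gamma^X$-invariant meromorphic function on the upper half-plane that is meromorphic at all cusps. A principal modulus for $\Gamma^X$ is a modular function for $\Gamma^X$ that is holomorphic on the upper half-plane and generates the field of modular functions for $\Gamma^X$ over $\mathbb C$. **Proposition.** The function $$T^X=\frac1{\eta_{\pi^X}}$$ is a principal modulus for $\Gamma^X$ with $T^X(\tau)=q^{-1}-d^X+O(q)$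 as $\tau\to i\infty$, where $q=e^{2\pi i\tau}$, and it is the only principal modulus for $\Gamma^X$ with such an expansion. -/

import Mathlib

noncomputable section

/-! ### Simply-laced root systems, Coxeter elements and Frame shapes -/

/-- The types of irreducible simply-laced root systems. -/
inductive ADEType where
  | A (n : ℕ) (hn : 1 ≤ n)
  | D (n : ℕ) (hn : 4 ≤ n)
  | E6
  | E7
  | E8

namespace ADEType

/-- The rank. -/
def rank : ADEType → ℕ
  | A n _ => n
  | D n _ => n
  | E6 => 6
  | E7 => 7
  | E8 => 8

/-- The Cartan matrix. -/
def cartan : (t : ADEType) → Matrix (Fin t.rank) (Fin t.rank) ℤ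
  | A n _ => CartanMatrix.A n
  | D n _ => CartanMatrix.D n
  | E6 => CartanMatrix.E₆
  | E7 => CartanMatrix.E₇
  | E8 => CartanMatrix.E₈

end ADEType

section RootSystems

variable {ι M N : Type*} [AddCommGroup M] [Module ℝ M] [AddCommGroup N] [Module ℝ N]
  {P : RootPairing ι ℝ M N}

/-- `b` is a set of simple roots of a root system of type `t`: up to a labelling of the simple
roots, the Cartan matrix is the one of type `t`. -/
def HasADEType [P.IsCrystallographic] (b : P.Base) (t : ADEType) : Prop :=
  ∃ e : b.support ≃ Fin t.rank, ∀ i j, b.cartanMatrix i j = t.cartan (e i) (e j)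

/-- `w` is a Coxeter element with respect to the simple roots `b`: the product, in some order, of
the reflections in all simple roots, each taken exactly once. -/
def IsCoxeterElement (b : P.Base) (w : M ≃ₗ[ℝ] M) : Prop :=
  ∃ l : List b.support, l.Nodup ∧ (∀ i, i ∈ l) ∧ w = (l.map fun i => P.reflection i).prod

/-- A Frame shape is a formal product `∏ n ^ k n` over positive integers `n`, with integers `k n`,
all but finitely many equal to `0`. Formal products are multiplied by adding the exponents. -/
abbrev FrameShape := ℕ+ →₀ ℤ

/-- The rational function `∏ (x ^ n - 1) ^ k n` for which a Frame shape is a shorthand. -/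
def FrameShape.toRatFunc (π : FrameShape) : RatFunc ℝ :=
  π.prod fun n k => (RatFunc.X ^ (n : ℕ) - 1) ^ k

/-- `π` is the Coxeter Frame shape of the root system `P` with simple roots `b`: the associated
rational function is the characteristic polynomial of the Coxeter elements. -/
def IsCoxeterFrameShape [FiniteDimensional ℝ M] (b : P.Base) (π : FrameShape) : Prop :=
  ∀ w : M ≃ₗ[ℝ] M, IsCoxeterElement b w →
    π.toRatFunc = algebraMap (Polynomial ℝ) (RatFunc ℝ) (w : M →ₗ[ℝ] M).charpoly

end RootSystems

/-! ### The groups `Γ₀(n) + S` -/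

/-- A subgroup of the group of exact divisors of `n`, whose operation is
`e * f = e f / (e, f) ^ 2`. -/
structure ExactDivisorGroup (n : ℕ) where
  /-- The underlying set. -/
  carrier : Finset ℕ
  exact_dvd : ∀ e ∈ carrier, e ∣ n ∧ Nat.Coprime e (n / e)
  one_mem : 1 ∈ carrier
  mul_mem : ∀ e ∈ carrier, ∀ f ∈ carrier, e * f / Nat.gcd e f ^ 2 ∈ carrier

/-- The Atkin--Lehner coset `W_n(e)`: all matrices `(1/√e) (ae, b; cn, de)` in `SL₂(ℝ)` with
integers `a, b, c, d` such that `a d e - b c n / e = 1`. -/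
def atkinLehnerCoset (n e : ℕ) : Set (Matrix.SpecialLinearGroup (Fin 2) ℝ) :=
  {g | ∃ a b c d : ℤ, a * d * e - b * c * (n / e : ℕ) = 1 ∧
    (g : Matrix (Fin 2) (Fin 2) ℝ) =
      (1 / Real.sqrt e) • !![(a * e : ℝ), (b : ℝ); (c * n : ℝ), (d * e : ℝ)]}

lemma atkinLehnerCoset_mul {n e f : ℕ} (hn : n ≠ 0) (he : e ∣ n) (hf : f ∣ n)
    {x y : Matrix.SpecialLinearGroup (Fin 2) ℝ}
    (hx : x ∈ atkinLehnerCoset n e) (hy : y ∈ atkinLehnerCoset n f) :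
    x * y ∈ atkinLehnerCoset n (e * f / Nat.gcd e f ^ 2) := by
  obtain ⟨a, b, c, d, h1, hx⟩ := hx
  obtain ⟨a', b', c', d', h2, hy⟩ := hy
  have he0 : 0 < e := Nat.pos_of_ne_zero (by rintro rfl; exact hn (zero_dvd_iff.mp he))
  have hf0 : 0 < f := Nat.pos_of_ne_zero (by rintro rfl; exact hn (zero_dvd_iff.mp hf))
  obtain ⟨g, e1, f1, hg, hco, rfl, rfl⟩ := Nat.exists_coprime' (Nat.gcd_pos_of_pos_left f he0)
  have hgcd : Nat.gcd (e1 * g) (f1 * g) = g := by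
    rw [Nat.gcd_mul_right, Nat.Coprime.gcd_eq_one hco, one_mul]
  have he1 : 0 < e1 := Nat.pos_of_mul_pos_right he0
  have hf1 : 0 < f1 := Nat.pos_of_mul_pos_right hf0
  have hh : e1 * g * (f1 * g) / Nat.gcd (e1 * g) (f1 * g) ^ 2 = e1 * f1 := by
    rw [hgcd]
    exact Nat.div_eq_of_eq_mul_left (by positivity) (by ring)
  have hl : e1 * f1 * g ∣ n := by
    have := Nat.lcm_dvd he hf
    rwa [Nat.lcm_mul_right, Nat.Coprime.lcm_eq_mul hco] at this
  obtain ⟨n1, rfl⟩ := hl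
  rw [hh]
  have d1 : e1 * f1 * g * n1 / (e1 * g) = f1 * n1 :=
    Nat.div_eq_of_eq_mul_left he0 (by ring)
  have d2 : e1 * f1 * g * n1 / (f1 * g) = e1 * n1 :=
    Nat.div_eq_of_eq_mul_left hf0 (by ring)
  have d3 : e1 * f1 * g * n1 / (e1 * f1) = g * n1 :=
    Nat.div_eq_of_eq_mul_left (by positivity) (by ring)
  rw [d1] at h1
  rw [d2] at h2
  refine ⟨a * a' * g + b * c' * n1, a * e1 * b' + b * d' * f1, c * a' * f1 + d * e1 * c',
    c * b' * n1 + d * d' * g, ?_, ?_⟩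
  · rw [d3]
    push_cast at h1 h2 ⊢
    linear_combination (a' * d' * (f1 * g) - b' * c' * (e1 * n1)) * h1 + h2
  · have hs : (1 / Real.sqrt ((e1 * g : ℕ) : ℝ)) * (1 / Real.sqrt ((f1 * g : ℕ) : ℝ)) =
        (1 / Real.sqrt ((e1 * f1 : ℕ) : ℝ)) * (1 / (g : ℝ)) := by
      have hg' : (0 : ℝ) ≤ g := Nat.cast_nonneg g
      push_cast
      rw [Real.sqrt_mul (by positivity), Real.sqrt_mul (by positivity),
        Real.sqrt_mul (by positivity)]
      conv_rhs => rw [← Real.mul_self_sqrt hg']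
      ring
    have hgR : (g : ℝ) ≠ 0 := by positivity
    rw [Matrix.SpecialLinearGroup.coe_mul, hx, hy, Matrix.smul_mul, Matrix.mul_smul, smul_smul, hs,
      mul_smul]
    congr 1
    ext i j
    fin_cases i <;> fin_cases j <;> simp [Matrix.mul_apply] <;> field_simp

lemma atkinLehnerCoset_inv {n e : ℕ} {x : Matrix.SpecialLinearGroup (Fin 2) ℝ}
    (hx : x ∈ atkinLehnerCoset n e) : x⁻¹ ∈ atkinLehnerCoset n e := by
  obtain ⟨a, b, c, d, h, hx⟩ := hx
  refine ⟨d, -b, -c, a, by linear_combination h, ?_⟩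
  rw [Matrix.SpecialLinearGroup.coe_inv, hx, Matrix.adjugate_smul]
  ext i j
  fin_cases i <;> fin_cases j <;> simp [Matrix.adjugate_fin_two]

/-- The group `Γ₀(n) + S`, the union of the Atkin--Lehner cosets `W_n(e)` over `e ∈ S`. -/
def Gamma0Plus (n : ℕ) [NeZero n] (S : ExactDivisorGroup n) :
    Subgroup (Matrix.SpecialLinearGroup (Fin 2) ℝ) where
  carrier := {g | ∃ e ∈ S.carrier, g ∈ atkinLehnerCoset n e}
  one_mem' := ⟨1, S.one_mem, 1, 0, 0, 1, by simp, by
    ext i j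
    fin_cases i <;> fin_cases j <;> simp⟩
  mul_mem' := by
    rintro x y ⟨e, he, hx⟩ ⟨f, hf, hy⟩
    exact ⟨_, S.mul_mem e he f hf,
      atkinLehnerCoset_mul (NeZero.ne n) (S.exact_dvd e he).1 (S.exact_dvd f hf).1 hx hy⟩
  inv_mem' := by
    rintro x ⟨e, he, hx⟩
    exact ⟨e, he, atkinLehnerCoset_inv hx⟩

/-- The group `{1}` of exact divisors of `n`; `Γ₀(n) + {1}` is the Hecke group `Γ₀(n)`. -/
def ExactDivisorGroup.trivial (n : ℕ) : ExactDivisorGroup n where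
  carrier := {1}
  exact_dvd := by simp
  one_mem := by simp
  mul_mem := by simp

/-! ### Principal moduli -/

open UpperHalfPlane in
/-- Modular functions for `Γ`, a group commensurable with `SL₂(ℤ)`: the `Γ`-invariant meromorphic
functions on the upper half-plane that are meromorphic at all cusps. As a point of the boundary
`ℚ ∪ {∞}` is `g ∞` with `g ∈ SL₂(ℤ)`, the latter is the condition of at most exponential growth of
`f (g τ)` as `im τ → ∞`. -/
structure IsModularFunction (Γ : Subgroup (Matrix.SpecialLinearGroup (Fin 2) ℝ))
    (f : ℍ → ℂ) : Prop where
  meromorphic : ∀ τ : ℍ, MeromorphicAt (f ∘ ofComplex) τ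
  invariant : ∀ γ ∈ Γ, ∀ τ : ℍ, f (γ • τ) = f τ
  cusps : ∀ g : Matrix.SpecialLinearGroup (Fin 2) ℤ, ∃ C : ℝ,
    (fun τ : ℍ => f (g • τ)) =O[atImInfty] fun τ : ℍ => Real.exp (C * τ.im)

open UpperHalfPlane in
/-- A principal modulus (Hauptmodul) for `Γ`: a modular function `T` for `Γ`, holomorphic on the
upper half-plane, that generates the field of modular functions for `Γ`. So every modular function
`f` is a rational function `p(T) / q(T)` of `T`, with `q(T)` not identically zero; the resulting
identity `q(T) f = p(T)` is stated at the points where `f` is holomorphic, because the value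
of `f` at one of its singularities carries no information. -/
structure IsPrincipalModulus (Γ : Subgroup (Matrix.SpecialLinearGroup (Fin 2) ℝ))
    (T : ℍ → ℂ) : Prop where
  isModularFunction : IsModularFunction Γ T
  holomorphic : ∀ τ : ℍ, AnalyticAt ℂ (T ∘ ofComplex) τ
  generates : ∀ f : ℍ → ℂ, IsModularFunction Γ f →
    ∃ p q : Polynomial ℂ, (∃ τ : ℍ, q.eval (T τ) ≠ 0) ∧
      ∀ τ : ℍ, AnalyticAt ℂ (f ∘ ofComplex) τ → q.eval (T τ) * f τ = p.eval (T τ)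

/-! ### Eta products -/

/-- The eta product `η_π(τ) = ∏ η(n τ) ^ k n` of a Frame shape. -/
def etaProduct (π : FrameShape) (τ : UpperHalfPlane) : ℂ :=
  π.prod fun n k => ModularForm.eta ((n : ℕ) * (τ : ℂ)) ^ k

open UpperHalfPlane in
/-- `T = q⁻¹ - d + O(q)` as `τ → i∞`, where `q = exp (2 π i τ)`. -/
def HasLeadingExpansion (T : ℍ → ℂ) (d : ℕ) : Prop :=
  (fun τ : ℍ => T τ - ((Function.Periodic.qParam 1 (τ : ℂ))⁻¹ - d)) =O[atImInfty]
    fun τ : ℍ => Function.Periodic.qParam 1 (τ : ℂ)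

/-! ### The Niemeier root systems and their groups -/

/-- The 23 Niemeier root systems; the constructor names list the types and multiplicities of the
irreducible components. -/
inductive NiemeierType where
  | A1_24 | A2_12 | A3_8 | A4_6 | A5_4_D4 | A6_4 | A7_2_D5_2 | A8_3 | A9_2_D6 | A11_D7_E6
  | A12_2 | A15_D9 | A17_E7 | A24
  | D4_6 | D6_4 | D8_3 | D10_E7_2 | D12_2 | D16_E8 | D24
  | E6_4 | E8_3

namespace NiemeierType

open ADEType

/-- The types of the irreducible components, with multiplicity. -/
def components : NiemeierType → List ADEType
  | A1_24 => List.replicate 24 (A 1 (by norm_num))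
  | A2_12 => List.replicate 12 (A 2 (by norm_num))
  | A3_8 => List.replicate 8 (A 3 (by norm_num))
  | A4_6 => List.replicate 6 (A 4 (by norm_num))
  | A5_4_D4 => List.replicate 4 (A 5 (by norm_num)) ++ [D 4 (by norm_num)]
  | A6_4 => List.replicate 4 (A 6 (by norm_num))
  | A7_2_D5_2 => List.replicate 2 (A 7 (by norm_num)) ++ List.replicate 2 (D 5 (by norm_num))
  | A8_3 => List.replicate 3 (A 8 (by norm_num))
  | A9_2_D6 => List.replicate 2 (A 9 (by norm_num)) ++ [D 6 (by norm_num)]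
  | A11_D7_E6 => [A 11 (by norm_num), D 7 (by norm_num), E6]
  | A12_2 => List.replicate 2 (A 12 (by norm_num))
  | A15_D9 => [A 15 (by norm_num), D 9 (by norm_num)]
  | A17_E7 => [A 17 (by norm_num), E7]
  | A24 => [A 24 (by norm_num)]
  | D4_6 => List.replicate 6 (D 4 (by norm_num))
  | D6_4 => List.replicate 4 (D 6 (by norm_num))
  | D8_3 => List.replicate 3 (D 8 (by norm_num))
  | D10_E7_2 => [D 10 (by norm_num), E7, E7]
  | D12_2 => List.replicate 2 (D 12 (by norm_num))
  | D16_E8 => [D 16 (by norm_num), E8]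
  | D24 => [D 24 (by norm_num)]
  | E6_4 => List.replicate 4 E6
  | E8_3 => List.replicate 3 E8

/-- The number `d^X` of irreducible components. -/
def numComponents (X : NiemeierType) : ℕ := X.components.length

/-- The group `Γ^X`: it is `Γ₀(m)` if `X` has a component of type `A` and Coxeter number `m`,
`Γ₀(2n) + n` if `X` has a component of type `D` but none of type `A`, and Coxeter number `2n`;
the two remaining cases are `Γ₀(12) + 4` and `Γ₀(30) + 6,10,15`. -/
def group : NiemeierType → Subgroup (Matrix.SpecialLinearGroup (Fin 2) ℝ)
  | A1_24 => Gamma0Plus 2 (.trivial 2)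
  | A2_12 => Gamma0Plus 3 (.trivial 3)
  | A3_8 => Gamma0Plus 4 (.trivial 4)
  | A4_6 => Gamma0Plus 5 (.trivial 5)
  | A5_4_D4 => Gamma0Plus 6 (.trivial 6)
  | A6_4 => Gamma0Plus 7 (.trivial 7)
  | A7_2_D5_2 => Gamma0Plus 8 (.trivial 8)
  | A8_3 => Gamma0Plus 9 (.trivial 9)
  | A9_2_D6 => Gamma0Plus 10 (.trivial 10)
  | A11_D7_E6 => Gamma0Plus 12 (.trivial 12)
  | A12_2 => Gamma0Plus 13 (.trivial 13)
  | A15_D9 => Gamma0Plus 16 (.trivial 16)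
  | A17_E7 => Gamma0Plus 18 (.trivial 18)
  | A24 => Gamma0Plus 25 (.trivial 25)
  | D4_6 => Gamma0Plus 6 ⟨{1, 3}, by decide, by decide, by decide⟩
  | D6_4 => Gamma0Plus 10 ⟨{1, 5}, by decide, by decide, by decide⟩
  | D8_3 => Gamma0Plus 14 ⟨{1, 7}, by decide, by decide, by decide⟩
  | D10_E7_2 => Gamma0Plus 18 ⟨{1, 9}, by decide, by decide, by decide⟩
  | D12_2 => Gamma0Plus 22 ⟨{1, 11}, by decide, by decide, by decide⟩
  | D16_E8 => Gamma0Plus 30 ⟨{1, 15}, by decide, by decide, by decide⟩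
  | D24 => Gamma0Plus 46 ⟨{1, 23}, by decide, by decide, by decide⟩
  | E6_4 => Gamma0Plus 12 ⟨{1, 4}, by decide, by decide, by decide⟩
  | E8_3 => Gamma0Plus 30 ⟨{1, 6, 10, 15}, by decide, by decide, by decide⟩

end NiemeierType

end

/-!
The Coxeter Frame shape of `X` only has factors `n` dividing the level `N` of `Γ^X`, so `T^X` is the
inverse of an eta quotient of level `N`, and the theorem is the combination of three facts.

*The Frame shapes.* In the basis of simple roots a Coxeter element is determined by the splitting
of the Cartan matrix into unitriangular matrices `U + L` (`charpoly_prod_reflection`): its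
characteristic polynomial is `det (x U + L)`. As the Dynkin diagram is a tree, elimination from the
leaves evaluates this determinant, with a result that does not depend on the order of the
reflections (`IsCoxeterElement.charpoly_eq_prod`). A Frame shape is determined by its rational
function, as the largest `n` with nonzero exponent is visible at a primitive `n`-th root of unity.
Together this is `isCoxeterFrameShape_iff`.

*A criterion for principal moduli.* Let `T` be holomorphic and invariant under `Γ`, with a simple
pole at `i∞` and bounded at all cusps that are not equivalent to `i∞`
(`HasSimplePoleAtInfty`). Multiplying a modular function `f` by a polynomial in `T` removes its
poles in the upper half-plane and at the cusps where `T` is bounded; subtracting a polynomial in `T`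
then removes the pole at `i∞`, and what remains is constant because modular forms of weight zero
are. So `T` is a principal modulus (`HasSimplePoleAtInfty.isPrincipalModulus`). If `T'` is another
one and `T' - T` vanishes at `i∞`, then `T` is a rational function of `T'` of larger degree in the
numerator than in the denominator, so `T'` has poles at most where `T` has, `T' - T` has none, and
`T' = T` (`HasSimplePoleAtInfty.eq_of_isPrincipalModulus`).

*Eta quotients.* The transformation law of `η`, in terms of Jacobi symbols and 24th roots of unity,
is proved by the Euclidean algorithm and quadratic reciprocity (`etaLaw`). It gives the invariance
of eta quotients under `Γ₀(N)` (`etaQuot_moebius`). An Atkin--Lehner element multiplies the eta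
quotient by a constant, which is `1` if the element has trace zero, as one sees at its fixed point
(`exists_mem_atkinLehnerCoset_of_elliptic`); the group `Γ₀(12) + 4` has no such element outside
`Γ₀(12)` and needs the transformation law again (`exists_mem_atkinLehnerCoset_twelve`). The order of
the eta quotient at a cusp `a / c` only depends on `(c, N)` (`isBoundedAtImInfty_inv_etaQuot`), and
the leading terms of its expansion at `i∞` can be read off from the exponents
(`hasLeadingExpansion_inv_etaQuot`).

So the criterion reduces to finitely many conditions on the exponents for each `X`
(`isPrincipalModulus_inv_etaProduct`), which are checked by evaluation.
-/

noncomputable section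

/-! ### The characteristic polynomial of a Coxeter element -/

open Polynomial in
/-- The determinant of a matrix supported on a tree. Each index `i` is joined to at most one larger
index, so eliminating the indices in increasing order creates no new entries, and the pivots `s i`
obey the recursion `hs`. -/
lemma det_eq_prod_of_tree {κ K : Type*} [Fintype κ] [LinearOrder κ] [Field K]
    (B : Matrix κ κ K) (R : κ → κ → Prop) [DecidableRel R]
    (hR : ∀ i j k, R i j → R i k → j = k) (hlt : ∀ i j, R i j → i < j)
    (hB : ∀ i j, i < j → ¬ R i j → B i j = 0 ∧ B j i = 0)
    (s : κ → K) (hs0 : ∀ i, s i ≠ 0)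
    (hs : ∀ i, s i = B i i - ∑ j with R j i, B i j * B j i / s j) :
    B.det = ∏ i, s i := by
  let L : Matrix κ κ K := fun i j => if i = j then 1 else if j < i then B i j / s j else 0
  let V : Matrix κ κ K := fun i j => if i = j then s i else if i < j then B i j else 0
  have hLV : B = L * V := by
    ext i k
    rw [Matrix.mul_apply]
    have hrest : ∀ j, j < i → j < k → i ≠ k → L i j * V j k = 0 := by
      intro j hji hjk hik
      simp only [L, V, if_neg hji.ne', if_pos hji, if_neg hjk.ne, if_pos hjk]
      by_cases h1 : R j i
      · have h2 : ¬ R j k := fun h => hik (hR _ _ _ h1 h)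
        rw [(hB j k hjk h2).1, mul_zero]
      · rw [(hB j i hji h1).2, zero_div, zero_mul]
    rcases lt_trichotomy i k with hik | rfl | hik
    · rw [Finset.sum_eq_single i]
      · simp [L, V, hik.ne, hik]
      · intro j _ hj
        rcases lt_or_gt_of_ne hj with h | h
        · exact hrest j h (h.trans hik) hik.ne
        · simp [L, h.ne, h.not_gt]
      · simp
    · rw [← Finset.add_sum_erase _ _ (Finset.mem_univ i)]
      have : ∑ j ∈ Finset.univ.erase i, L i j * V j i = ∑ j with R j i, B i j * B j i / s j := by
        symm
        apply Finset.sum_subset_zero_on_sdiff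
        · intro j hj
          simp only [Finset.mem_filter, Finset.mem_univ, true_and] at hj
          simp [(hlt _ _ hj).ne]
        · intro j hj
          simp only [Finset.mem_sdiff, Finset.mem_erase, Finset.mem_univ, Finset.mem_filter,
            true_and, and_true] at hj
          rcases lt_or_gt_of_ne hj.1 with h | h
          · simp [V, (hB j i h hj.2).1, h.ne, h]
          · simp [L, h.ne, h.not_gt]
        · intro j hj
          simp only [Finset.mem_filter, Finset.mem_univ, true_and] at hj
          have h := hlt _ _ hj
          simp only [L, V, if_neg h.ne', if_pos h, if_neg h.ne]
          ring
      rw [this]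
      simp only [L, V, if_true, one_mul]
      rw [hs i]
      ring
    · rw [Finset.sum_eq_single k]
      · simp [L, V, hik.ne', hik, hs0 k]
      · intro j _ hj
        rcases lt_or_gt_of_ne hj with h | h
        · exact hrest j (h.trans hik) h hik.ne'
        · simp [V, h.ne', h.not_gt]
      · simp
  have h1 : L.det = 1 := by
    rw [Matrix.det_of_isLowerTriangular]
    · simp [L]
    · intro i j hij
      have : i < j := hij
      simp [L, this.ne, this.not_gt]
  have h2 : V.det = ∏ i, s i := by
    rw [Matrix.det_of_isUpperTriangular]
    · simp [V]
    · intro i j hij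
      have : j < i := hij
      simp [V, this.ne', this.not_gt]
  rw [hLV, Matrix.det_mul, h1, h2, one_mul]

section Coxeter

variable {ι M N : Type*} [AddCommGroup M] [Module ℝ M] [AddCommGroup N] [Module ℝ N]
  {P : RootPairing ι ℝ M N} [DecidableEq ι]

/-- A product of distinct simple reflections moves `v` by a combination of simple roots whose
coefficients `c i v` solve a triangular system. -/
lemma exists_coeff_prod_reflection (b : P.Base) (l : List b.support) (hl : l.Nodup) :
    ∃ c : b.support → M → ℝ, (∀ i, i ∉ l → c i = 0) ∧
      (∀ v, (l.map fun i : b.support => P.reflection i).prod v = v - ∑ i, c i v • P.root i) ∧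
      ∀ i ∈ l, ∀ v, c i v + ∑ j : b.support,
        (if l.idxOf i < l.idxOf j then P.pairing j i * c j v else 0) = P.coroot' i v := by
  induction l with
  | nil => exact ⟨0, by simp, by simp, by simp⟩
  | cons i₀ l ih =>
    obtain ⟨hi₀, hl⟩ := List.nodup_cons.mp hl
    obtain ⟨c, hc0, hc1, hc2⟩ := ih hl
    have hupd : ∀ v, ∀ j, j ≠ i₀ →
        Function.update c i₀ (fun v => P.coroot' i₀
          ((l.map fun i : b.support => P.reflection i).prod v)) j v = c j v := by
      intro v j hj
      rw [Function.update_of_ne hj]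
    refine ⟨Function.update c i₀ (fun v => P.coroot' i₀
      ((l.map fun i : b.support => P.reflection i).prod v)), ?_, ?_, ?_⟩
    · intro i hi
      rw [List.mem_cons, not_or] at hi
      rw [Function.update_of_ne hi.1, hc0 i hi.2]
    · intro v
      rw [List.map_cons, List.prod_cons, LinearEquiv.mul_apply, RootPairing.reflection_apply,
        ← Finset.add_sum_erase _ _ (Finset.mem_univ i₀), Function.update_self]
      have : ∑ j ∈ Finset.univ.erase i₀, Function.update c i₀ (fun v => P.coroot' i₀
          ((l.map fun i : b.support => P.reflection i).prod v)) j v • P.root j =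
          ∑ j, c j v • P.root j := by
        rw [← Finset.add_sum_erase _ _ (Finset.mem_univ i₀), hc0 i₀ hi₀, Pi.zero_apply, zero_smul,
          zero_add]
        exact Finset.sum_congr rfl fun j hj => by rw [hupd v j (Finset.ne_of_mem_erase hj)]
      rw [this]
      nth_rewrite 1 [hc1 v]
      abel
    · intro i hi v
      rcases eq_or_ne i i₀ with rfl | hne
      · rw [Function.update_self, hc1 v, map_sub, map_sum]
        have : ∀ j : b.support, (if (i :: l).idxOf i < (i :: l).idxOf j then P.pairing j i *
            Function.update c i (fun v => P.coroot' i
              ((l.map fun i : b.support => P.reflection i).prod v)) j v else 0) =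
            P.coroot' i (c j v • P.root j) := by
          intro j
          rcases eq_or_ne j i with rfl | hj
          · simp [hc0 j hi₀]
          · rw [hupd v j hj, List.idxOf_cons_self, List.idxOf_cons_ne _ hj.symm,
              if_pos (Nat.succ_pos _), map_smul, P.root_coroot'_eq_pairing, smul_eq_mul, mul_comm]
        rw [Finset.sum_congr rfl fun j _ => this j]
        abel
      · have hil : i ∈ l := (List.mem_cons.mp hi).resolve_left hne
        rw [hupd v i hne, ← hc2 i hil v]
        congr 1
        refine Finset.sum_congr rfl fun j _ => ?_
        rw [List.idxOf_cons_ne _ hne.symm]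
        rcases eq_or_ne j i₀ with rfl | hj
        · simp [hc0 j hi₀]
        · rw [hupd v j hj, List.idxOf_cons_ne _ hj.symm]
          simp

open Polynomial in
/-- The characteristic polynomial of a Coxeter element is the determinant of `X U + L`, where
`U + L` is the splitting of the Cartan matrix into unitriangular matrices with respect to the order
of the reflections. -/
lemma charpoly_prod_reflection [FiniteDimensional ℝ M] [P.IsRootSystem] (b : P.Base)
    (l : List b.support) (hl : l.Nodup) (hmem : ∀ i, i ∈ l) :
    ((l.map fun i : b.support => P.reflection i).prod : M →ₗ[ℝ] M).charpoly =
      (Matrix.of fun i j : b.support => if i = j then X + 1 else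
        if l.idxOf i < l.idxOf j then X * C (P.pairing j i) else C (P.pairing j i)).det := by
  obtain ⟨c, -, hc1, hc2⟩ := exists_coeff_prod_reflection b l hl
  set w := (l.map fun i : b.support => P.reflection i).prod with hw
  let W := LinearMap.toMatrix b.toWeightBasis b.toWeightBasis (w : M →ₗ[ℝ] M)
  have hW : ∀ i j, W i j = (if i = j then 1 else 0) - c i (P.root j) := by
    intro i j
    simp only [W, LinearMap.toMatrix_apply, RootPairing.Base.toWeightBasis_apply,
      LinearEquiv.coe_coe, hc1, map_sub, map_sum, map_smul]
    have h : ∀ k : b.support, b.toWeightBasis.repr (P.root k) = Finsupp.single k 1 := fun k => by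
      simp
    simp only [h]
    rw [Finsupp.sub_apply, Finsupp.finsetSum_apply]
    simp [Finsupp.single_apply, eq_comm]
  have hcp : (w : M →ₗ[ℝ] M).charpoly = W.charpoly :=
    (LinearMap.charpoly_toMatrix _ _).symm
  have hinj : ∀ i j : b.support, l.idxOf i = l.idxOf j → i = j := fun i j h =>
    List.idxOf_inj (hmem i) |>.mp h
  let U : Matrix b.support b.support ℝ[X] := fun i j =>
    if i = j then 1 else if l.idxOf i < l.idxOf j then C (P.pairing j i) else 0
  have hU : U.det = 1 := by
    let : LinearOrder b.support := LinearOrder.lift' (fun i => l.idxOf i) fun i j h => hinj i j h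
    rw [Matrix.det_of_isUpperTriangular]
    · simp [U]
    · intro i j hij
      have h : l.idxOf j < l.idxOf i := hij
      have hne : i ≠ j := by rintro rfl; exact lt_irrefl _ h
      simp [U, hne, h.not_gt]
  have hmul : W.charmatrix.det = (U * W.charmatrix).det := by rw [Matrix.det_mul, hU, one_mul]
  rw [hcp, Matrix.charpoly, hmul]
  congr 1
  ext1 i j
  rw [Matrix.mul_apply, Matrix.of_apply]
  have hsum : ∑ k, U i k * C (c k (P.root j)) = C (P.pairing j i) := by
    have := hc2 i (hmem i) (P.root j)
    rw [P.root_coroot'_eq_pairing] at this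
    rw [← this, C_add, map_sum, ← Finset.add_sum_erase _ _ (Finset.mem_univ i)]
    congr 1
    · simp [U]
    · symm
      rw [← Finset.add_sum_erase _ _ (Finset.mem_univ i)]
      simp only [lt_irrefl, if_false, C_0, zero_add]
      refine Finset.sum_congr rfl fun k hk => ?_
      have hk := Finset.ne_of_mem_erase hk
      simp only [U, if_neg hk.symm]
      split_ifs <;> simp
  have hterm : ∀ k, U i k * W.charmatrix k j =
      (if k = j then U i k * (X - 1) else 0) + U i k * C (c k (P.root j)) := by
    intro k
    rw [Matrix.charmatrix_apply, hW, Matrix.diagonal_apply]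
    split_ifs <;> simp <;> ring
  rw [Finset.sum_congr rfl fun k _ => hterm k, Finset.sum_add_distrib, hsum]
  simp only [Finset.sum_ite_eq', Finset.mem_univ, if_true]
  rcases eq_or_ne i j with rfl | hij
  · simp only [U, if_true, RootPairing.pairing_same]
    rw [show (C (2 : ℝ) : ℝ[X]) = 2 from rfl]
    ring
  · simp only [U, if_neg hij]
    split_ifs
    · ring
    · ring

end Coxeter

section CoxeterTree
variable {ι M N : Type*} [AddCommGroup M] [Module ℝ M] [AddCommGroup N] [Module ℝ N]
  {P : RootPairing ι ℝ M N}

/-- The characteristic polynomial of a Coxeter element of a simply-laced root system whose Dynkin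
diagram is a tree: `par i` is the unique larger neighbour of the node `i`, and the `s i` are the
pivots of the elimination from the leaves. In particular it does not depend on the order of the
reflections. -/
lemma IsCoxeterElement.charpoly_eq_prod [FiniteDimensional ℝ M] [P.IsRootSystem]
    [P.IsCrystallographic] {b : P.Base} {w : M ≃ₗ[ℝ] M} (hw : IsCoxeterElement b w) {n : ℕ}
    (A : Matrix (Fin n) (Fin n) ℤ) (e : b.support ≃ Fin n)
    (he : ∀ i j, b.cartanMatrix i j = A (e i) (e j)) (par : ℕ → ℕ) (hpar : ∀ i, i < par i)
    (hA : ∀ i j : Fin n, i < j → A i j = (if (j : ℕ) = par i then -1 else 0) ∧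
      A j i = (if (j : ℕ) = par i then -1 else 0))
    (s : ℕ → RatFunc ℝ) (hs0 : ∀ i < n, s i ≠ 0)
    (hs : ∀ i < n, s i = RatFunc.X + 1 - ∑ j ∈ Finset.range i with par j = i, RatFunc.X / s j) :
    algebraMap (Polynomial ℝ) (RatFunc ℝ) (w : M →ₗ[ℝ] M).charpoly = ∏ i ∈ Finset.range n, s i := by
  classical
  obtain ⟨l, hl, hmem, hwl⟩ := hw
  have hwl' : w = (l.map fun i : b.support => P.reflection i).prod := by
    rw [hwl]
    congr 1
    simp
  have hpair : ∀ i j, P.pairing (e.symm i) (e.symm j) = (A i j : ℝ) := by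
    intro i j
    have := he (e.symm i) (e.symm j)
    rw [Equiv.apply_symm_apply, Equiv.apply_symm_apply] at this
    rw [← this]
    exact (b.algebraMap_cartanMatrixIn_apply ℤ _ _).symm
  rw [hwl', charpoly_prod_reflection b l hl hmem, RingHom.map_det,
    ← Matrix.det_submatrix_equiv_self e.symm, Finset.prod_range]
  have hidx : ∀ i j : Fin n, i ≠ j → l.idxOf (e.symm i) ≠ l.idxOf (e.symm j) := fun i j hij h =>
    hij (e.symm.injective (List.idxOf_inj (hmem _) |>.mp h))
  apply det_eq_prod_of_tree _ (fun i j : Fin n => (j : ℕ) = par i)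
  · intro i j k hj hk
    exact Fin.ext (hj.trans hk.symm)
  · intro i j hij
    exact Fin.lt_def.mpr (hij ▸ hpar i)
  · intro i j hij hR
    have h := hA i j hij
    rw [if_neg hR] at h
    constructor
    · simp [hij.ne, hpair, h.2]
    · simp [hij.ne', hpair, h.1]
  · exact fun i => hs0 i i.2
  · intro i
    rw [hs i i.2]
    congr 1
    · simp
    · refine Finset.sum_bij' (fun j hj => ⟨j, ?_⟩) (fun j _ => (j : ℕ)) ?_ ?_ ?_ ?_ ?_
      · exact (Finset.mem_range.mp (Finset.mem_filter.mp hj).1).trans i.2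
      · intro j hj
        simpa [eq_comm] using (Finset.mem_filter.mp hj).2
      · intro j hj
        have := (Finset.mem_filter.mp hj).2
        simp only [Finset.mem_filter, Finset.mem_range]
        exact ⟨this ▸ hpar j, this.symm⟩
      · intros; rfl
      · intros; rfl
      · intro j hj
        simp only [Finset.mem_filter, Finset.mem_range] at hj
        have hlt : (⟨j, hj.1.trans i.2⟩ : Fin n) < i := hj.1
        have h := hA _ _ hlt
        rw [if_pos hj.2.symm] at h
        have h3 := hidx _ _ hlt.ne
        rcases lt_or_gt_of_ne h3 with h4 | h4
        · simp [hlt.ne, hlt.ne', hpair, h.1, h.2, h4, h4.not_gt]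
        · simp [hlt.ne, hlt.ne', hpair, h.1, h.2, h4, h4.not_gt]

lemma exists_isCoxeterElement (b : P.Base) : ∃ w, IsCoxeterElement b w :=
  ⟨_, Finset.univ.toList, Finset.nodup_toList _, by simp, rfl⟩

end CoxeterTree

/-! ### Frame shapes -/

namespace FrameShape

open Polynomial in
lemma ratFunc_X_pow_sub_one_ne_zero {n : ℕ} (hn : n ≠ 0) : (RatFunc.X ^ n - 1 : RatFunc ℝ) ≠ 0 := by
  have : (RatFunc.X ^ n - 1 : RatFunc ℝ) = algebraMap ℝ[X] (RatFunc ℝ) (X ^ n - 1) := by simp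
  rw [this]
  exact RatFunc.algebraMap_ne_zero (X_pow_sub_C_ne_zero (Nat.pos_of_ne_zero hn) 1)

lemma toRatFunc_add (π π' : FrameShape) :
    (π + π').toRatFunc = π.toRatFunc * π'.toRatFunc :=
  Finsupp.prod_add_index' (fun _ => zpow_zero _)
    fun n => zpow_add₀ (ratFunc_X_pow_sub_one_ne_zero n.ne_zero)

lemma toRatFunc_single (n : ℕ+) (k : ℤ) :
    toRatFunc (Finsupp.single n k) = (RatFunc.X ^ (n : ℕ) - 1) ^ k :=
  Finsupp.prod_single_index (zpow_zero _)

open Polynomial in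
/-- The largest `n` with nonzero exponent is visible at a primitive `n`-th root of unity. -/
lemma eq_zero_of_toRatFunc_eq_one {π : FrameShape} (h : π.toRatFunc = 1) : π = 0 := by
  by_contra hπ
  have hne : π.support.Nonempty := Finsupp.support_nonempty_iff.mpr hπ
  set m := π.support.max' hne with hm
  have hmmem : m ∈ π.support := Finset.max'_mem _ _
  have hmax : ∀ n ∈ π.support, n ≤ m := fun n hn => Finset.le_max' _ n hn
  let f : ℕ+ → ℝ[X] := fun n => X ^ (n : ℕ) - 1
  have hf : ∀ n : ℕ+, algebraMap ℝ[X] (RatFunc ℝ) (f n) = RatFunc.X ^ (n : ℕ) - 1 := by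
    intro n; simp [f]
  have key : ∏ n ∈ π.support, f n ^ (π n).toNat = ∏ n ∈ π.support, f n ^ (-π n).toNat := by
    apply RatFunc.algebraMap_injective ℝ
    rw [map_prod, map_prod]
    rw [toRatFunc, Finsupp.prod] at h
    have : ∏ n ∈ π.support, algebraMap ℝ[X] (RatFunc ℝ) (f n ^ (π n).toNat) =
        (∏ n ∈ π.support, (RatFunc.X ^ (n : ℕ) - 1 : RatFunc ℝ) ^ (π n)) *
          ∏ n ∈ π.support, algebraMap ℝ[X] (RatFunc ℝ) (f n ^ (-π n).toNat) := by
      rw [← Finset.prod_mul_distrib]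
      refine Finset.prod_congr rfl fun n _ => ?_
      rw [map_pow, map_pow, hf, ← zpow_natCast _ (π n).toNat, ← zpow_natCast _ (-π n).toNat,
        ← zpow_add₀ (ratFunc_X_pow_sub_one_ne_zero n.ne_zero)]
      congr 1
      omega
    rw [this, h, one_mul]
  set z : ℂ := Complex.exp (2 * Real.pi * Complex.I / (m : ℕ)) with hz
  have hprim : IsPrimitiveRoot z m := Complex.isPrimitiveRoot_exp _ m.ne_zero
  have hval : ∀ n : ℕ+, aeval z (f n) = z ^ (n : ℕ) - 1 := by intro n; simp [f]
  have h0 : aeval z (f m) = 0 := by rw [hval, hprim.pow_eq_one, sub_self]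
  have h1 : ∀ n ∈ π.support, n ≠ m → aeval z (f n) ≠ 0 := by
    intro n hn hnm
    rw [hval, sub_ne_zero]
    exact hprim.pow_ne_one_of_pos_of_lt n.ne_zero
      (show n < m from lt_of_le_of_ne (hmax n hn) hnm)
  have key' := congrArg (aeval z) key
  rw [map_prod, map_prod, ← Finset.mul_prod_erase _ _ hmmem, ← Finset.mul_prod_erase _ _ hmmem]
    at key'
  have hr : ∀ g : ℕ+ → ℕ, ∏ n ∈ π.support.erase m, aeval z (f n ^ g n) ≠ 0 := by
    intro g
    refine Finset.prod_ne_zero_iff.mpr fun n hn => ?_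
    rw [map_pow]
    exact pow_ne_zero _ (h1 n (Finset.mem_of_mem_erase hn) (Finset.ne_of_mem_erase hn))
  have hmk : π m ≠ 0 := Finsupp.mem_support_iff.mp hmmem
  rw [map_pow, map_pow, h0] at key'
  rcases lt_or_gt_of_ne hmk with hlt | hgt
  · rw [zero_pow (by omega : (-π m).toNat ≠ 0), zero_mul,
      show (π m).toNat = 0 by omega, pow_zero, one_mul] at key'
    exact hr _ key'
  · rw [zero_pow (by omega : (π m).toNat ≠ 0), zero_mul,
      show (-π m).toNat = 0 by omega, pow_zero, one_mul] at key'
    exact hr _ key'.symm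

lemma toRatFunc_injective : Function.Injective toRatFunc := by
  intro π π' h
  have h1 : π'.toRatFunc * (π - π').toRatFunc = π'.toRatFunc := by
    rw [← toRatFunc_add, add_sub_cancel, h]
  have h0 : π'.toRatFunc ≠ 0 :=
    Finset.prod_ne_zero_iff.mpr fun n _ => zpow_ne_zero _ (ratFunc_X_pow_sub_one_ne_zero n.ne_zero)
  exact sub_eq_zero.mp (eq_zero_of_toRatFunc_eq_one (mul_eq_left₀ h0 |>.mp h1))

end FrameShape

namespace ADEType

/-- The Frame shape of the Coxeter elements of an irreducible root system. -/
def frame : ADEType → FrameShape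
  | A n _ => .single n.succPNat 1 + .single 1 (-1)
  | D n _ => .single (2 * n - 3).succPNat 1 + .single 2 1 + .single (n - 2).succPNat (-1) +
      .single 1 (-1)
  | E6 => .single 2 1 + .single 3 1 + .single 12 1 + .single 1 (-1) + .single 4 (-1) +
      .single 6 (-1)
  | E7 => .single 2 1 + .single 3 1 + .single 18 1 + .single 1 (-1) + .single 6 (-1) +
      .single 9 (-1)
  | E8 => .single 2 1 + .single 3 1 + .single 5 1 + .single 30 1 + .single 1 (-1) + .single 6 (-1) +
      .single 10 (-1) + .single 15 (-1)

section Pivots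

open Polynomial

lemma ratFunc_ne_zero_of_eval {f : RatFunc ℝ} (p : ℝ[X]) (hf : f = algebraMap ℝ[X] (RatFunc ℝ) p)
    (h : p.eval 1 ≠ 0) : f ≠ 0 :=
  hf ▸ RatFunc.algebraMap_ne_zero (by rintro rfl; simp at h)

lemma ratFunc_X_pow_add_one_ne_zero (n : ℕ) : (RatFunc.X ^ n + 1 : RatFunc ℝ) ≠ 0 :=
  ratFunc_ne_zero_of_eval (X ^ n + 1) (by simp) (by norm_num)

lemma sum_filter_chain (f : ℕ → RatFunc ℝ) (i : ℕ) :
    ∑ j ∈ Finset.range (i + 1) with j + 1 = i + 1, f j = f i := by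
  rw [show (Finset.range (i + 1)).filter (fun j => j + 1 = i + 1) = {i} by
    ext j; simp only [Finset.mem_filter, Finset.mem_range, Finset.mem_singleton]; omega]
  simp

lemma prod_range_div_telescope {K : Type*} [Field K] {f : ℕ → K} (hf : ∀ i, f i ≠ 0) (n : ℕ) :
    ∏ i ∈ Finset.range n, f (i + 1) / f i = f n / f 0 := by
  induction n with
  | zero => simp [hf 0]
  | succ n ih =>
    rw [Finset.prod_range_succ, ih]
    have := hf n
    field_simp

end Pivots

end ADEType

/-! ### Coxeter elements of irreducible simply-laced root systems -/

section CoxeterADE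
variable {ι M N : Type*} [AddCommGroup M] [Module ℝ M] [AddCommGroup N] [Module ℝ N]
  {P : RootPairing ι ℝ M N} [FiniteDimensional ℝ M] [P.IsRootSystem]
    [P.IsCrystallographic] {b : P.Base} {w : M ≃ₗ[ℝ] M}

open FrameShape ADEType

local notation "x" => (RatFunc.X : RatFunc ℝ)

lemma IsCoxeterElement.charpoly_A (hw : IsCoxeterElement b w) {n : ℕ} (hn : 1 ≤ n)
    (h : HasADEType b (.A n hn)) :
    algebraMap (Polynomial ℝ) (RatFunc ℝ) (w : M →ₗ[ℝ] M).charpoly =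
      (x ^ (n + 1) - 1) / (x - 1) := by
  obtain ⟨e, he⟩ := h
  have hne : ∀ k : ℕ, (x ^ (k + 1) - 1) ≠ 0 := fun k => ratFunc_X_pow_sub_one_ne_zero k.succ_ne_zero
  rw [hw.charpoly_eq_prod (CartanMatrix.A n) e he (· + 1) Nat.lt_succ_self ?_
    (fun i => (x ^ (i + 2) - 1) / (x ^ (i + 1) - 1)) ?_ ?_]
  · rw [prod_range_div_telescope (f := fun i => x ^ (i + 1) - 1) hne]
    simp
  · intro i j hij
    have hij : (i : ℕ) < j := hij
    have h1 : i ≠ j := by rintro rfl; omega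
    simp only [CartanMatrix.A, Matrix.of_apply, if_neg h1, if_neg h1.symm]
    constructor <;> congr 1 <;> simp only [eq_iff_iff] <;> omega
  · exact fun i _ => div_ne_zero (hne (i + 1)) (hne i)
  · intro i _
    rcases i with _ | i
    · have := hne 0
      simp only [zero_add, pow_one, Finset.range_zero, Finset.filter_empty, Finset.sum_empty] at *
      field_simp
      ring
    · rw [sum_filter_chain]
      have h1 := hne i
      have h2 := hne (i + 1)
      field_simp
      ring

lemma IsCoxeterElement.charpoly_D (hw : IsCoxeterElement b w) {n : ℕ} (hn : 4 ≤ n)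
    (h : HasADEType b (.D n hn)) :
    algebraMap (Polynomial ℝ) (RatFunc ℝ) (w : M →ₗ[ℝ] M).charpoly =
      (x ^ (n - 1) + 1) * (x + 1) := by
  obtain ⟨e, he⟩ := h
  obtain ⟨m, rfl⟩ := Nat.exists_eq_add_of_le' (show 2 ≤ n by omega)
  have hne : ∀ k : ℕ, (x ^ k + 1) ≠ 0 := ratFunc_X_pow_add_one_ne_zero
  have hne1 : x + 1 ≠ 0 := by simpa using hne 1
  let e' : b.support ≃ Fin (m + 2) := e
  have he' : ∀ i j, b.cartanMatrix i j = CartanMatrix.D (m + 2) (e' i) (e' j) := he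
  -- Numbered backwards, the nodes `0` and `1` are the two short legs of the diagram.
  rw [hw.charpoly_eq_prod (fun i j => CartanMatrix.D (m + 2) i.rev j.rev) (e'.trans Fin.revPerm)
    (fun i j => by
      simp [he']) (fun i => if i = 0 then 2 else i + 1)
    (fun i => by split_ifs <;> omega) ?_
    (fun i => if i < 2 then x + 1 else (x ^ i + 1) / (x ^ (i - 1) + 1)) ?_ ?_]
  · have : ∀ i ∈ Finset.range m, (if i + 1 + 1 < 2 then x + 1 else
        (x ^ (i + 1 + 1) + 1) / (x ^ (i + 1 + 1 - 1) + 1)) =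
        (x ^ (i + 1 + 1) + 1) / (x ^ (i + 1) + 1) := by
      intro i _
      rw [if_neg (by omega), Nat.add_sub_cancel]
    rw [Finset.prod_range_succ', Finset.prod_range_succ', Finset.prod_congr rfl this,
      prod_range_div_telescope (f := fun i => x ^ (i + 1) + 1) fun i => hne (i + 1)]
    simp only [zero_add, pow_one, show (0 : ℕ) < 2 by omega, show 1 < 2 by omega, if_true,
      show m + 2 - 1 = m + 1 by omega]
    field_simp
  · intro i j hij
    have hij : (i : ℕ) < j := hij
    have h1 : i.rev ≠ j.rev := by rw [Ne, Fin.rev_inj]; rintro rfl; omega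
    have hi := i.2
    have hj := j.2
    simp only [CartanMatrix.D, Matrix.of_apply, if_neg h1, if_neg h1.symm, Fin.val_rev]
    constructor <;> split_ifs <;> first | rfl | omega
  · intro i _
    split_ifs
    · exact hne1
    · exact div_ne_zero (hne _) (hne _)
  · intro i _
    rcases i with _ | _ | _ | i
    · simp
    · rw [Finset.sum_eq_zero]
      · simp
      · intro j hj
        simp only [Finset.mem_filter, Finset.mem_range] at hj
        obtain rfl : j = 0 := by omega
        simp at hj
    · rw [show (Finset.range (0 + 1 + 1)).filter (fun j => (if j = 0 then 2 else j + 1) =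
        0 + 1 + 1) = {0, 1} by decide]
      rw [Finset.sum_pair (by omega)]
      simp
      field_simp
      ring
    · rw [show (Finset.range (i + 1 + 1 + 1)).filter (fun j => (if j = 0 then 2 else j + 1) =
        i + 1 + 1 + 1) = {i + 2} by
          ext j
          simp only [Finset.mem_filter, Finset.mem_range, Finset.mem_singleton]
          split_ifs <;> omega]
      rw [Finset.sum_singleton]
      simp only [if_neg (show ¬ i + 1 + 1 + 1 < 2 by omega), if_neg (show ¬ i + 2 < 2 by omega)]
      have h1 := hne (i + 2)
      have h2 := hne (i + 1)
      simp only [Nat.add_sub_cancel, show i + 2 - 1 = i + 1 by omega]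
      field_simp
      ring

/-- The pivots for the diagrams of type `E`: the first four nodes form a diagram `A 4`. -/
def pivotE : ℕ → RatFunc ℝ
  | 0 => x + 1
  | 1 => x + 1
  | 2 => (x ^ 2 + x + 1) / (x + 1)
  | 3 => (x ^ 4 + x ^ 3 + x ^ 2 + x + 1) / ((x + 1) * (x ^ 2 + x + 1))
  | 4 => (x + 1) * (x ^ 4 + 1) / (x ^ 4 + x ^ 3 + x ^ 2 + x + 1)
  | 5 => (x ^ 4 - x ^ 2 + 1) * (x ^ 2 + x + 1) / ((x + 1) * (x ^ 4 + 1))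
  | 6 => (x ^ 6 - x ^ 3 + 1) * (x + 1) / ((x ^ 4 - x ^ 2 + 1) * (x ^ 2 + x + 1))
  | _ => (x ^ 8 + x ^ 7 - x ^ 5 - x ^ 4 - x ^ 3 + x + 1) / ((x ^ 6 - x ^ 3 + 1) * (x + 1))

/-- The larger neighbour of a node of the diagrams of type `E`. -/
def parentE (i : ℕ) : ℕ := if i < 2 then i + 2 else i + 1

lemma pivotE_spec : ∀ i < 8, pivotE i ≠ 0 ∧ pivotE i =
    x + 1 - ∑ j ∈ Finset.range i with parentE j = i, x / pivotE j := by
  have h1 : x + 1 ≠ 0 := by simpa using ratFunc_X_pow_add_one_ne_zero 1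
  have h2 : x ^ 2 + x + 1 ≠ 0 :=
    ratFunc_ne_zero_of_eval (.X ^ 2 + .X + 1) (by simp) (by norm_num)
  have h3 : x ^ 4 + x ^ 3 + x ^ 2 + x + 1 ≠ 0 :=
    ratFunc_ne_zero_of_eval (.X ^ 4 + .X ^ 3 + .X ^ 2 + .X + 1) (by simp) (by norm_num)
  have h4 : x ^ 4 + 1 ≠ 0 := ratFunc_X_pow_add_one_ne_zero 4
  have h5 : x ^ 4 - x ^ 2 + 1 ≠ 0 :=
    ratFunc_ne_zero_of_eval (.X ^ 4 - .X ^ 2 + 1) (by simp) (by norm_num)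
  have h6 : x ^ 6 - x ^ 3 + 1 ≠ 0 :=
    ratFunc_ne_zero_of_eval (.X ^ 6 - .X ^ 3 + 1) (by simp) (by norm_num)
  have h7 : x ^ 8 + x ^ 7 - x ^ 5 - x ^ 4 - x ^ 3 + x + 1 ≠ 0 :=
    ratFunc_ne_zero_of_eval (.X ^ 8 + .X ^ 7 - .X ^ 5 - .X ^ 4 - .X ^ 3 + .X + 1) (by simp)
      (by norm_num)
  -- New names for the denominators keep `field_simp` from taking them apart.
  obtain ⟨a2, ha2⟩ : ∃ a, a = x ^ 2 + x + 1 := ⟨_, rfl⟩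
  obtain ⟨a3, ha3⟩ : ∃ a, a = x ^ 4 + x ^ 3 + x ^ 2 + x + 1 := ⟨_, rfl⟩
  obtain ⟨a5, ha5⟩ : ∃ a, a = x ^ 4 - x ^ 2 + 1 := ⟨_, rfl⟩
  obtain ⟨a6, ha6⟩ : ∃ a, a = x ^ 6 - x ^ 3 + 1 := ⟨_, rfl⟩
  intro i hi
  interval_cases i
  · exact ⟨h1, by simp [pivotE]⟩
  · refine ⟨h1, ?_⟩
    rw [show (Finset.range 1).filter (fun j => parentE j = 1) = ∅ by decide]
    simp [pivotE]
  · refine ⟨div_ne_zero h2 h1, ?_⟩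
    rw [show (Finset.range 2).filter (fun j => parentE j = 2) = {0} by decide, Finset.sum_singleton]
    simp only [pivotE]
    simp only [← ha2, ← ha3, ← ha5, ← ha6] at h2 h3 h5 h6 ⊢
    field_simp
    subst ha2 ha3 ha5 ha6
    ring
  · refine ⟨div_ne_zero h3 (mul_ne_zero h1 h2), ?_⟩
    rw [show (Finset.range 3).filter (fun j => parentE j = 3) = {1, 2} by decide,
      Finset.sum_pair (by decide)]
    simp only [pivotE]
    simp only [← ha2, ← ha3, ← ha5, ← ha6] at h2 h3 h5 h6 ⊢
    field_simp
    subst ha2 ha3 ha5 ha6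
    ring
  · refine ⟨div_ne_zero (mul_ne_zero h1 h4) h3, ?_⟩
    rw [show (Finset.range 4).filter (fun j => parentE j = 4) = {3} by decide, Finset.sum_singleton]
    simp only [pivotE]
    simp only [← ha2, ← ha3, ← ha5, ← ha6] at h2 h3 h5 h6 ⊢
    field_simp
    subst ha2 ha3 ha5 ha6
    ring
  · refine ⟨div_ne_zero (mul_ne_zero h5 h2) (mul_ne_zero h1 h4), ?_⟩
    rw [show (Finset.range 5).filter (fun j => parentE j = 5) = {4} by decide, Finset.sum_singleton]
    simp only [pivotE]
    simp only [← ha2, ← ha3, ← ha5, ← ha6] at h2 h3 h5 h6 ⊢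
    field_simp
    subst ha2 ha3 ha5 ha6
    ring
  · refine ⟨div_ne_zero (mul_ne_zero h6 h1) (mul_ne_zero h5 h2), ?_⟩
    rw [show (Finset.range 6).filter (fun j => parentE j = 6) = {5} by decide, Finset.sum_singleton]
    simp only [pivotE]
    simp only [← ha2, ← ha3, ← ha5, ← ha6] at h2 h3 h5 h6 ⊢
    field_simp
    subst ha2 ha3 ha5 ha6
    ring
  · refine ⟨div_ne_zero h7 (mul_ne_zero h6 h1), ?_⟩
    rw [show (Finset.range 7).filter (fun j => parentE j = 7) = {6} by decide, Finset.sum_singleton]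
    simp only [pivotE]
    simp only [← ha2, ← ha3, ← ha5, ← ha6] at h2 h3 h5 h6 ⊢
    field_simp
    subst ha2 ha3 ha5 ha6
    ring

lemma prod_pivotE_six : ∏ i ∈ Finset.range 6, pivotE i = (x ^ 4 - x ^ 2 + 1) * (x ^ 2 + x + 1) := by
  have h0 : ∀ i < 8, pivotE i ≠ 0 := fun i hi => (pivotE_spec i hi).1
  have h2 := div_ne_zero_iff.mp (h0 2 (by decide))
  have h3 := div_ne_zero_iff.mp (h0 3 (by decide))
  have h4 := div_ne_zero_iff.mp (h0 4 (by decide))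
  simp only [Finset.prod_range_succ, Finset.prod_range_zero, pivotE, one_mul]
  obtain ⟨a2, ha2⟩ : ∃ a, a = x ^ 2 + x + 1 := ⟨_, rfl⟩
  obtain ⟨a3, ha3⟩ : ∃ a, a = x ^ 4 + x ^ 3 + x ^ 2 + x + 1 := ⟨_, rfl⟩
  simp only [← ha2, ← ha3] at h2 h3 h4 ⊢
  obtain ⟨-, h1⟩ := h2
  obtain ⟨h3, h2⟩ := h3
  have h2 := right_ne_zero_of_mul h2
  have h4 := right_ne_zero_of_mul h4.1
  field_simp

lemma prod_pivotE_seven : ∏ i ∈ Finset.range 7, pivotE i = (x ^ 6 - x ^ 3 + 1) * (x + 1) := by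
  rw [Finset.prod_range_succ, prod_pivotE_six]
  exact mul_div_cancel₀ _ (div_ne_zero_iff.mp (pivotE_spec 6 (by decide)).1).2

lemma prod_pivotE_eight : ∏ i ∈ Finset.range 8, pivotE i =
    x ^ 8 + x ^ 7 - x ^ 5 - x ^ 4 - x ^ 3 + x + 1 := by
  rw [Finset.prod_range_succ, prod_pivotE_seven]
  exact mul_div_cancel₀ _ (div_ne_zero_iff.mp (pivotE_spec 7 (by decide)).1).2

lemma IsCoxeterElement.charpoly_E (hw : IsCoxeterElement b w) {n : ℕ} (hn : n ≤ 8)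
    (A : Matrix (Fin n) (Fin n) ℤ) (e : b.support ≃ Fin n)
    (he : ∀ i j, b.cartanMatrix i j = A (e i) (e j))
    (hA : ∀ i j : Fin n, i < j → A i j = (if (j : ℕ) = parentE i then -1 else 0) ∧
      A j i = (if (j : ℕ) = parentE i then -1 else 0)) :
    algebraMap (Polynomial ℝ) (RatFunc ℝ) (w : M →ₗ[ℝ] M).charpoly =
      ∏ i ∈ Finset.range n, pivotE i :=
  hw.charpoly_eq_prod A e he parentE (fun i => by unfold parentE; split_ifs <;> omega) hA pivotE
    (fun i hi => (pivotE_spec i (by omega)).1) (fun i hi => (pivotE_spec i (by omega)).2)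

lemma isCoxeterFrameShape_frame {t : ADEType} (h : HasADEType b t) :
    IsCoxeterFrameShape b t.frame := by
  have hX : ∀ k : ℕ, k ≠ 0 → (x ^ k - 1) ≠ 0 := fun k hk => ratFunc_X_pow_sub_one_ne_zero hk
  have hX1 : x - 1 ≠ 0 := by simpa using hX 1 one_ne_zero
  intro w hw
  cases t with
  | A n hn =>
    rw [hw.charpoly_A hn h]
    simp only [frame, toRatFunc_add, toRatFunc_single, Nat.succPNat_coe, PNat.one_coe, zpow_one,
      zpow_neg, pow_one, Nat.succ_eq_add_one]
    rw [div_eq_mul_inv]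
  | D n hn =>
    rw [hw.charpoly_D hn h]
    simp only [frame, toRatFunc_add, toRatFunc_single, Nat.succPNat_coe, PNat.one_coe, zpow_one,
      zpow_neg, pow_one, Nat.succ_eq_add_one, show ((2 : ℕ+) : ℕ) = 2 from rfl]
    rw [show 2 * n - 3 + 1 = (n - 1) * 2 by omega, show n - 2 + 1 = n - 1 by omega, pow_mul]
    have := hX (n - 1) (by omega)
    field_simp
    ring
  | E6 =>
    obtain ⟨e, he⟩ := h
    rw [hw.charpoly_E (n := 6) (by decide) CartanMatrix.E₆ e he
      (by intro i j; fin_cases i <;> fin_cases j <;> decide), prod_pivotE_six]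
    simp only [frame, toRatFunc_add, toRatFunc_single, zpow_one, zpow_neg, pow_one,
      PNat.val_ofNat]
    rw [mul_inv_eq_iff_eq_mul₀ (hX 6 (by decide)), mul_inv_eq_iff_eq_mul₀ (hX 4 (by decide)),
      mul_inv_eq_iff_eq_mul₀ hX1]
    ring
  | E7 =>
    obtain ⟨e, he⟩ := h
    rw [hw.charpoly_E (n := 7) (by decide) CartanMatrix.E₇ e he
      (by intro i j; fin_cases i <;> fin_cases j <;> decide), prod_pivotE_seven]
    simp only [frame, toRatFunc_add, toRatFunc_single, zpow_one, zpow_neg, pow_one,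
      PNat.val_ofNat]
    rw [mul_inv_eq_iff_eq_mul₀ (hX 9 (by decide)), mul_inv_eq_iff_eq_mul₀ (hX 6 (by decide)),
      mul_inv_eq_iff_eq_mul₀ hX1]
    ring
  | E8 =>
    obtain ⟨e, he⟩ := h
    rw [hw.charpoly_E (n := 8) (by decide) CartanMatrix.E₈ e he
      (by intro i j; fin_cases i <;> fin_cases j <;> decide), prod_pivotE_eight]
    simp only [frame, toRatFunc_add, toRatFunc_single, zpow_one, zpow_neg, pow_one,
      PNat.val_ofNat]
    rw [mul_inv_eq_iff_eq_mul₀ (hX 15 (by decide)), mul_inv_eq_iff_eq_mul₀ (hX 10 (by decide)),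
      mul_inv_eq_iff_eq_mul₀ (hX 6 (by decide)), mul_inv_eq_iff_eq_mul₀ hX1]
    ring

/-- An irreducible simply-laced root system has exactly one Coxeter Frame shape. -/
lemma isCoxeterFrameShape_iff {t : ADEType} (h : HasADEType b t) (π : FrameShape) :
    IsCoxeterFrameShape b π ↔ π = t.frame := by
  refine ⟨fun hπ => ?_, fun hπ => hπ ▸ isCoxeterFrameShape_frame h⟩
  obtain ⟨w, hw⟩ := exists_isCoxeterElement b
  exact toRatFunc_injective ((hπ w hw).trans (isCoxeterFrameShape_frame h w hw).symm)

end CoxeterADE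

/-! ### The multiplier system of the Dedekind eta function -/

open Complex in
/-- The primitive 24th root of unity `exp (2 π i / 24)`. -/
def zeta24 : ℂ := exp (2 * Real.pi * I / 24)

section EtaMultiplier

open Complex hiding eta
open ModularForm UpperHalfPlane NumberTheorySymbols

lemma zeta24_ne_zero : zeta24 ≠ 0 := exp_ne_zero _

lemma zeta24_zpow (n : ℤ) : zeta24 ^ n = exp (n * (2 * Real.pi * Complex.I / 24)) :=
  (exp_int_mul _ n).symm

lemma zeta24_zpow_eq {m n : ℤ} (h : (24 : ℤ) ∣ m - n) : zeta24 ^ m = zeta24 ^ n := by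
  obtain ⟨k, hk⟩ := h
  rw [zeta24_zpow, zeta24_zpow, exp_eq_exp_iff_exists_int]
  refine ⟨k, ?_⟩
  have : (m : ℂ) = n + 24 * k := by exact_mod_cast (by omega : m = n + 24 * k)
  rw [this]
  ring

lemma zeta24_zpow_twelve : zeta24 ^ (12 : ℤ) = -1 := by
  rw [zeta24_zpow, ← exp_pi_mul_I]
  congr 1
  push_cast
  ring

lemma sqrt_I_eq : sqrt Complex.I = zeta24 ^ (3 : ℤ) := by
  rw [sqrt_eq_exp I_ne_zero, log_I, zeta24_zpow]
  congr 1
  push_cast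
  ring

lemma sqrt_neg_I_eq : sqrt (-Complex.I) = zeta24 ^ (-3 : ℤ) := by
  rw [sqrt_eq_exp (neg_ne_zero.mpr I_ne_zero), log_neg_I, zeta24_zpow]
  congr 1
  push_cast
  ring

lemma sqrt_mul_of_arg {z w : ℂ} (hz : z ≠ 0) (hw : w ≠ 0)
    (h : arg z + arg w ∈ Set.Ioc (-Real.pi) Real.pi) : sqrt (z * w) = sqrt z * sqrt w := by
  rw [sqrt_eq_exp (mul_ne_zero hz hw), sqrt_eq_exp hz, sqrt_eq_exp hw, log_mul hz hw h, ← exp_add]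
  congr 1
  ring

lemma sqrt_mul_of_re_pos {z w : ℂ} (hz : 0 < z.re) (hw : 0 < w.re) :
    sqrt (z * w) = sqrt z * sqrt w := by
  have h1 := abs_lt.mp (abs_arg_lt_pi_div_two_iff.mpr (Or.inl hz))
  have h2 := abs_lt.mp (abs_arg_lt_pi_div_two_iff.mpr (Or.inl hw))
  refine sqrt_mul_of_arg (by rintro rfl; simp at hz) (by rintro rfl; simp at hw) ⟨?_, ?_⟩ <;>
    linarith

lemma sqrt_I_mul {z : ℂ} (hz : 0 < z.re) : sqrt (Complex.I * z) = zeta24 ^ (3 : ℤ) * sqrt z := by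
  have h1 := abs_lt.mp (abs_arg_lt_pi_div_two_iff.mpr (Or.inl hz))
  rw [sqrt_mul_of_arg I_ne_zero (by rintro rfl; simp at hz), sqrt_I_eq]
  rw [arg_I]
  constructor <;> linarith

lemma sqrt_neg_I_mul {z : ℂ} (hz : 0 < z.re) :
    sqrt (-Complex.I * z) = zeta24 ^ (-3 : ℤ) * sqrt z := by
  have h1 := abs_lt.mp (abs_arg_lt_pi_div_two_iff.mpr (Or.inl hz))
  rw [sqrt_mul_of_arg (neg_ne_zero.mpr I_ne_zero) (by rintro rfl; simp at hz), sqrt_neg_I_eq]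
  rw [arg_neg_I]
  constructor <;> linarith

lemma eta_add_int (z : ℂ) (k : ℤ) : eta (z + k) = zeta24 ^ k * eta z := by
  have h1 : Function.Periodic.qParam 24 (z + k) = zeta24 ^ k * Function.Periodic.qParam 24 z := by
    rw [Function.Periodic.qParam, Function.Periodic.qParam, zeta24_zpow, ← exp_add]
    congr 1
    push_cast
    ring
  have h2 : ∀ n, eta_q n (z + k) = eta_q n z := by
    intro n
    rw [eta_q, eta_q]
    congr 1
    rw [Function.Periodic.qParam, Function.Periodic.qParam, exp_eq_exp_iff_exists_int]
    exact ⟨k, by push_cast; ring⟩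
  rw [eta, eta, h1]
  simp_rw [h2]
  ring

lemma eta_neg_inv {z : ℂ} (hz : 0 < z.im) :
    eta (-1 / z) = sqrt (-Complex.I * z) * eta z := by
  have h := eta_comp_eq_csqrt_I_inv hz
  simp only [Function.comp_apply, Pi.smul_apply, Pi.mul_apply, smul_eq_mul] at h
  have hs : sqrt z = zeta24 ^ (3 : ℤ) * sqrt (-Complex.I * z) := by
    rw [← sqrt_I_mul (by simpa using hz)]
    congr 1
    linear_combination z * I_sq
  rw [h, hs, sqrt_I_eq, mul_assoc, inv_mul_cancel_left₀ (zpow_ne_zero _ zeta24_ne_zero)]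

lemma jacobiSym_reciprocity_zeta24 {c d : ℕ} (hc : Odd c) (hd : Odd d) :
    ((J(d | c) : ℤ) : ℂ) = zeta24 ^ (3 * ((c : ℤ) - 1) * (d - 1)) * (J(c | d) : ℤ) := by
  rw [jacobiSym.quadratic_reciprocity hd hc]
  obtain ⟨m, rfl⟩ := hc
  obtain ⟨n, rfl⟩ := hd
  push_cast
  rw [show (2 * n + 1) / 2 = n by omega, show (2 * m + 1) / 2 = m by omega,
    ← zeta24_zpow_twelve, ← zpow_natCast, ← zpow_mul]
  congr 2
  push_cast
  ring

lemma jacobiSym_neg_zeta24 (a : ℤ) {d : ℕ} (hd : Odd d) :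
    ((J(-a | d) : ℤ) : ℂ) = zeta24 ^ (6 * ((d : ℤ) - 1)) * (J(a | d) : ℤ) := by
  rw [jacobiSym.neg a hd, ZMod.χ₄_eq_neg_one_pow (Nat.odd_iff.mp hd)]
  obtain ⟨n, rfl⟩ := hd
  push_cast
  rw [show (2 * n + 1) / 2 = n by omega, ← zeta24_zpow_twelve, ← zpow_natCast, ← zpow_mul]
  congr 2
  ring

lemma zeta24_mul_congr {A : ℂ} {u v w x y : ℤ} (h : (24 : ℤ) ∣ u + v + w - (x + y)) :
    zeta24 ^ u * A * zeta24 ^ v * zeta24 ^ w = zeta24 ^ x * A * zeta24 ^ y := by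
  have := zeta24_zpow_eq h
  rw [zpow_add₀ zeta24_ne_zero, zpow_add₀ zeta24_ne_zero, zpow_add₀ zeta24_ne_zero] at this
  linear_combination A * this

lemma moebius_neg_inv (a b c d : ℂ) {z : ℂ} (hz : z ≠ 0) :
    (b * (-1 / z) + -a) / (d * (-1 / z) + -c) = (a * z + b) / (c * z + d) := by
  rw [show b * (-1 / z) + -a = (a * z + b) * (-1 / z) by field_simp; ring,
    show d * (-1 / z) + -c = (c * z + d) * (-1 / z) by field_simp; ring,
    mul_div_mul_right _ _ (div_ne_zero (neg_ne_zero.mpr one_ne_zero) hz)]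

/-- The transformation law of `η` under a matrix with bottom row `(c, d)`, `c` odd and positive. -/
def EtaLaw (a b : ℤ) (c : ℕ) (d : ℤ) : Prop :=
  ∀ z : ℂ, 0 < z.im → eta ((a * z + b) / (c * z + d)) =
    (J(d | c) : ℤ) * zeta24 ^ ((a + d) * c - b * d * (c ^ 2 - 1) - 3 * c + 3) *
      sqrt (-Complex.I * (c * z + d)) * eta z

lemma EtaLaw.shift {a b : ℤ} {c : ℕ} {d : ℤ} (hc : Odd c) (hdet : a * d - b * c = 1)
    (h : EtaLaw a b c d) (k : ℤ) : EtaLaw a (b + a * k) c (d + c * k) := by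
  intro z hz
  have h1 := h (z + k) (by simpa using hz)
  rw [eta_add_int] at h1
  have e1 : (a * (z + k) + b) / (c * (z + k) + d) =
      (a * z + ((b + a * k : ℤ) : ℂ)) / (c * z + ((d + c * k : ℤ) : ℂ)) := by
    push_cast; ring
  have e2 : (c * (z + k) + d : ℂ) = c * z + ((d + c * k : ℤ) : ℂ) := by push_cast; ring
  rw [e1, e2] at h1
  rw [h1, jacobiSym.mod_left' (show (d + c * k) % (c : ℤ) = d % c by simp)]
  have e3 : zeta24 ^ ((a + (d + c * k)) * c - (b + a * k) * (d + c * k) * (c ^ 2 - 1) - 3 * c + 3) =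
      zeta24 ^ ((a + d) * c - b * d * (c ^ 2 - 1) - 3 * c + 3) * zeta24 ^ k := by
    rw [← zpow_add₀ zeta24_ne_zero]
    apply zeta24_zpow_eq
    have h24 : (24 : ℤ) ∣ c * (c ^ 2 - 1) := by
      obtain ⟨m, rfl⟩ := hc
      have h3 : (3 : ℤ) ∣ ((2 * m + 1 : ℕ) : ℤ) * (((2 * m + 1 : ℕ) : ℤ) ^ 2 - 1) := by
        push_cast
        have : (m : ℤ) % 3 = 0 ∨ (m : ℤ) % 3 = 1 ∨ (m : ℤ) % 3 = 2 := by omega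
        apply Int.dvd_of_emod_eq_zero
        rcases this with h | h | h <;> simp [Int.add_emod, Int.sub_emod, Int.mul_emod, pow_two, h]
      have h8 : (8 : ℤ) ∣ ((2 * m + 1 : ℕ) : ℤ) * (((2 * m + 1 : ℕ) : ℤ) ^ 2 - 1) := by
        obtain ⟨r, hr⟩ : (2 : ℤ) ∣ m * (m + 1) := (Int.even_mul_succ_self m).two_dvd
        refine ⟨(2 * m + 1) * r, ?_⟩
        push_cast
        linear_combination 4 * (2 * (m : ℤ) + 1) * hr
      omega
    obtain ⟨r, hr⟩ := h24
    refine ⟨-r * (k * (2 * b + a * k)), ?_⟩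
    linear_combination (-k * (2 * b + a * k)) * hr - k * (c ^ 2 - 1) * hdet
  rw [e3]
  ring

lemma etaLaw_one (a b d : ℤ) (hdet : a * d - b * (1 : ℕ) = 1) : EtaLaw a b 1 d := by
  intro z hz
  have hz' : 0 < (z + d).im := by simpa using hz
  have hne : z + d ≠ 0 := by intro h; rw [h] at hz'; simp at hz'
  have hb : (b : ℂ) = a * d - 1 := by exact_mod_cast (by push_cast at hdet; omega : b = a * d - 1)
  have e1 : (a * z + b) / ((1 : ℕ) * z + d) = -1 / (z + d) + a := by
    rw [hb]
    push_cast
    field_simp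
    ring
  rw [e1, eta_add_int, eta_neg_inv hz', eta_add_int]
  simp only [jacobiSym.one_right, Nat.cast_one, one_mul, Int.cast_one]
  rw [show (a + d) * 1 - b * d * (1 ^ 2 - 1) - 3 * 1 + 3 = a + d by ring,
    zpow_add₀ zeta24_ne_zero]
  ring

lemma neg_I_mul_re (c : ℝ) (d : ℤ) (z : ℂ) : (-Complex.I * (c * z + d)).re = c * z.im := by
  simp

/-- The transformation law of `η`; the induction is the Euclidean algorithm on the bottom row,
with odd remainders so that quadratic reciprocity applies to each inversion. -/
theorem etaLaw (c : ℕ) (hc : Odd c) : ∀ a b d : ℤ, a * d - b * c = 1 → EtaLaw a b c d := by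
  induction c using Nat.strong_induction_on with
  | _ c ih =>
    -- The case of an odd remainder `d` with `|d| < c`.
    have key : ∀ a b d : ℤ, a * d - b * c = 1 → Odd d → d.natAbs < c → EtaLaw a b c d := by
      intro a b d hdet hd hlt z hz
      have hz0 : z ≠ 0 := by rintro rfl; simp at hz
      have hw : 0 < (-1 / z).im := by
        rw [neg_div, one_div, neg_im, inv_im, neg_div, neg_neg]
        exact div_pos hz (normSq_pos.mpr hz0)
      have hc0 : (0 : ℝ) < c := by exact_mod_cast hc.pos
      have hv : 0 < (-Complex.I * (c * z + d)).re := by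
        have := neg_I_mul_re c d z
        push_cast at this
        rw [this]; positivity
      have hz' : 0 < (-Complex.I * z).re := by simpa using hz
      have hcd : (c * z + d : ℂ) ≠ 0 := by
        intro h; rw [h] at hv; simp at hv
      obtain ⟨e, rfl | rfl⟩ : ∃ e : ℕ, d = e ∨ d = -e := ⟨d.natAbs, by omega⟩
      · have he : Odd e := by exact_mod_cast hd
        have h1 := ih e (by omega) he b (-a) (-c) (by linear_combination hdet) (-1 / z) hw
        have e1 : (b * (-1 / z) + ((-a : ℤ) : ℂ)) / (e * (-1 / z) + ((-c : ℤ) : ℂ)) =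
            (a * z + b) / (c * z + ((e : ℤ) : ℂ)) := by
          push_cast
          exact moebius_neg_inv _ _ _ _ hz0
        have e2 : (-Complex.I * (e * (-1 / z) + ((-c : ℤ) : ℂ))) * (-Complex.I * z) =
            Complex.I * (-Complex.I * (c * z + ((e : ℤ) : ℂ))) := by
          push_cast
          field_simp
          ring
        have hw' : 0 < (-Complex.I * (e * (-1 / z) + ((-c : ℤ) : ℂ))).re := by
          have := neg_I_mul_re e (-c) (-1 / z)
          push_cast at this ⊢
          rw [this]
          have : (0 : ℝ) < e := by exact_mod_cast he.pos
          positivity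
        have e3 := sqrt_mul_of_re_pos hw' hz'
        rw [e2, sqrt_I_mul hv] at e3
        rw [e1, eta_neg_inv hz] at h1
        rw [h1]
        have e4 : ∀ A B C D E F : ℂ, D * C = E * F → A * B * C * (D * eta z) =
            A * B * E * F * eta z := by
          intro A B C D E F h; linear_combination A * B * eta z * h
        rw [e4 _ _ _ _ _ _ ((mul_comm _ _).trans e3.symm)]
        congr 2
        rw [jacobiSym_neg_zeta24 _ he]
        rw [show (J((e : ℤ) | c) : ℤ) = J(((e : ℕ) : ℤ) | c) from rfl,
          jacobiSym_reciprocity_zeta24 hc he]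
        apply zeta24_mul_congr
        obtain ⟨m, hm⟩ := hc
        obtain ⟨n, hn⟩ := he
        have hm' : (c : ℤ) = 2 * m + 1 := by exact_mod_cast hm
        have hn' : (e : ℤ) = 2 * n + 1 := by exact_mod_cast hn
        refine ⟨-(m * n), ?_⟩
        linear_combination (-(c : ℤ) * e) * hdet - 6 * ((e : ℤ) - 1) * hm' - 12 * m * hn'
      · have he : Odd e := by
          have := hd.neg; rw [neg_neg] at this; exact_mod_cast this
        have h1 := ih e (by omega) he (-b) a c (by linear_combination hdet) (-1 / z) hw
        have e1 : (((-b : ℤ) : ℂ) * (-1 / z) + a) / (e * (-1 / z) + ((c : ℤ) : ℂ)) =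
            (a * z + b) / (c * z + ((-e : ℤ) : ℂ)) := by
          have := moebius_neg_inv (-a) (-b) (-c) e hz0
          push_cast
          rw [neg_neg, neg_neg] at this
          rw [this, ← neg_div_neg_eq]
          congr 1 <;> ring
        have e2 : (-Complex.I * (e * (-1 / z) + ((c : ℤ) : ℂ))) * (-Complex.I * z) =
            -Complex.I * (-Complex.I * (c * z + ((-e : ℤ) : ℂ))) := by
          push_cast
          field_simp
          ring
        have hw' : 0 < (-Complex.I * (e * (-1 / z) + ((c : ℤ) : ℂ))).re := by
          have := neg_I_mul_re e c (-1 / z)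
          push_cast at this ⊢
          rw [this]
          have : (0 : ℝ) < e := by exact_mod_cast he.pos
          positivity
        have e3 := sqrt_mul_of_re_pos hw' hz'
        rw [e2, sqrt_neg_I_mul hv] at e3
        rw [e1, eta_neg_inv hz] at h1
        rw [h1]
        have e4 : ∀ A B C D E F : ℂ, D * C = E * F → A * B * C * (D * eta z) =
            A * B * E * F * eta z := by
          intro A B C D E F h; linear_combination A * B * eta z * h
        rw [e4 _ _ _ _ _ _ ((mul_comm _ _).trans e3.symm)]
        congr 2
        rw [jacobiSym_neg_zeta24 _ hc]
        rw [show (J((e : ℤ) | c) : ℤ) = J(((e : ℕ) : ℤ) | c) from rfl,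
          jacobiSym_reciprocity_zeta24 hc he]
        have e5 := zeta24_mul_congr (A := (J((c : ℤ) | e) : ℤ)) (u := 0)
          (v := (-b + c) * e - a * c * (e ^ 2 - 1) - 3 * e + 3) (w := -3)
          (x := 6 * ((c : ℤ) - 1) + 3 * ((c : ℤ) - 1) * (e - 1))
          (y := (a + -e) * c - b * -e * (c ^ 2 - 1) - 3 * c + 3)
          ⟨0, by linear_combination ((c : ℤ) * e) * hdet⟩
        rw [zpow_zero, one_mul, zpow_add₀ zeta24_ne_zero (6 * ((c : ℤ) - 1))] at e5
        rw [e5]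
        ring
    intro a b d hdet
    rcases Nat.lt_or_ge 1 c with h1 | h1
    · obtain ⟨k, hk1, hk2⟩ : ∃ k : ℤ, Odd (d + c * k) ∧ (d + c * k).natAbs < c := by
        have hc0 : (0 : ℤ) < c := by omega
        have hr0 := Int.emod_nonneg d hc0.ne'
        have hr1 := Int.emod_lt_of_pos d hc0
        have hr2 := Int.emod_add_mul_ediv d c
        rcases Int.even_or_odd (d % c) with he | ho
        · refine ⟨-(d / c) - 1, ?_, ?_⟩
          · rw [show d + c * (-(d / c) - 1) = d % c - c by linear_combination -hr2]
            exact he.sub_odd (by exact_mod_cast hc)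
          · rw [show d + c * (-(d / c) - 1) = d % c - c by linear_combination -hr2]
            have : d % c ≠ 0 := by
              intro h0
              have hdvd : (c : ℤ) ∣ 1 := by
                rw [← hdet]
                exact (Dvd.dvd.mul_left (Int.dvd_of_emod_eq_zero h0) _).sub (Dvd.intro_left _ rfl)
              have := Int.le_of_dvd one_pos hdvd
              omega
            omega
        · refine ⟨-(d / c), ?_, ?_⟩
          · rw [show d + c * (-(d / c)) = d % c by linear_combination -hr2]
            exact ho
          · rw [show d + c * (-(d / c)) = d % c by linear_combination -hr2]
            omega
      have hdet' : a * (d + c * k) - (b + a * k) * c = 1 := by linear_combination hdet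
      have := (key a (b + a * k) (d + c * k) hdet' hk1 hk2).shift hc hdet' (-k)
      convert this using 1 <;> ring
    · obtain rfl : c = 1 := by have := hc.pos; omega
      exact etaLaw_one a b d hdet

/-- The transformation law of `η` under a matrix with bottom row `(c, d)`, `d` odd and positive. -/
theorem eta_smul_of_odd {a b c : ℤ} {d : ℕ} (hd : Odd d) (hdet : a * d - b * c = 1) {z : ℂ}
    (hz : 0 < z.im) : eta ((a * z + b) / (c * z + d)) =
      (J(-c | d) : ℤ) * zeta24 ^ ((b - c) * d - a * c * (d ^ 2 - 1) - 3 * d + 3) *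
        sqrt (c * z + d) * eta z := by
  have hz0 : z ≠ 0 := by rintro rfl; simp at hz
  have hw : 0 < (-1 / z).im := by
    rw [neg_div, one_div, neg_im, inv_im, neg_div, neg_neg]
    exact div_pos hz (normSq_pos.mpr hz0)
  have hcd : (c * z + d : ℂ) ≠ 0 := by
    intro h
    have h1 : (c : ℝ) * z.im = 0 := by simpa using congrArg Complex.im h
    have h2 := congrArg Complex.re h
    rcases mul_eq_zero.mp h1 with h3 | h3
    · have h4 : c = 0 := by exact_mod_cast h3
      subst h4
      have := hd.pos.ne'
      simp at h2
      exact this h2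
    · exact hz.ne' h3
  have h1 := etaLaw d hd b (-a) (-c) (by linear_combination hdet) (-1 / z) hw
  have e1 : (b * (-1 / z) + ((-a : ℤ) : ℂ)) / (d * (-1 / z) + ((-c : ℤ) : ℂ)) =
      (a * z + b) / (c * z + d) := by
    push_cast
    exact moebius_neg_inv _ _ _ _ hz0
  have e2 : (-Complex.I * (d * (-1 / z) + ((-c : ℤ) : ℂ))) * (-Complex.I * z) = c * z + d := by
    push_cast
    field_simp
    linear_combination (-(d : ℂ) - c * z) * I_sq
  have hw' : 0 < (-Complex.I * (d * (-1 / z) + ((-c : ℤ) : ℂ))).re := by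
    have := neg_I_mul_re d (-c) (-1 / z)
    push_cast at this ⊢
    rw [this]
    have : (0 : ℝ) < d := by exact_mod_cast hd.pos
    positivity
  have e3 := sqrt_mul_of_re_pos hw' (show 0 < (-Complex.I * z).re by simpa using hz)
  rw [e2] at e3
  rw [e1, eta_neg_inv hz] at h1
  rw [h1, e3]
  rw [show (b + -c) * (d : ℤ) - -a * -c * (d ^ 2 - 1) - 3 * d + 3 =
    (b - c) * d - a * c * (d ^ 2 - 1) - 3 * d + 3 by ring]
  ring

end EtaMultiplier

/-! ### Eta quotients and their invariance under `Γ₀(N)` -/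

section EtaQuotient

open Complex hiding eta
open ModularForm UpperHalfPlane NumberTheorySymbols

/-- The eta quotient `∏ η(n z) ^ k n`, over the divisors `n` of `N`. -/
def etaQuot (N : ℕ) (k : ℕ → ℤ) (z : ℂ) : ℂ := ∏ n ∈ N.divisors, eta (n * z) ^ k n

variable {N : ℕ} {k : ℕ → ℤ}

lemma natCast_mul_im_pos {n : ℕ} (hn : n ∈ N.divisors) {z : ℂ} (hz : 0 < z.im) :
    0 < ((n : ℂ) * z).im := by
  have : (0 : ℝ) < n := by exact_mod_cast Nat.pos_of_mem_divisors hn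
  simpa using mul_pos this hz

lemma eta_natCast_mul_ne_zero {n : ℕ} (hn : n ∈ N.divisors) {z : ℂ} (hz : 0 < z.im) :
    eta (n * z) ≠ 0 := eta_ne_zero (natCast_mul_im_pos hn hz)

lemma etaQuot_ne_zero {z : ℂ} (hz : 0 < z.im) : etaQuot N k z ≠ 0 :=
  Finset.prod_ne_zero_iff.mpr fun _ hn => zpow_ne_zero _ (eta_natCast_mul_ne_zero hn hz)

lemma prod_zpow_eq_zpow_sum₀ {ι K : Type*} [Field K] (s : Finset ι) {x : K} (hx : x ≠ 0)
    (f : ι → ℤ) : ∏ i ∈ s, x ^ f i = x ^ ∑ i ∈ s, f i := by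
  classical
  induction s using Finset.induction_on with
  | empty => simp
  | insert a s ha ih => rw [Finset.prod_insert ha, Finset.sum_insert ha, ih, zpow_add₀ hx]

lemma intCast_mul_add_ne_zero {c d : ℤ} (h : c ≠ 0 ∨ d ≠ 0) {z : ℂ} (hz : 0 < z.im) :
    (c * z + d : ℂ) ≠ 0 := by
  intro h0
  have h1 : (c : ℝ) * z.im = 0 := by simpa using congrArg Complex.im h0
  have hc : c = 0 := by exact_mod_cast (mul_eq_zero.mp h1).resolve_right hz.ne'
  subst hc
  simp at h0 h
  exact h h0

/-- Invariance of an eta quotient, for matrices with odd positive `d`: the roots of unity cancel by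
the two divisibility conditions, and the Jacobi symbols by the square condition. -/
lemma etaQuot_moebius_of_odd (h0 : ∑ n ∈ N.divisors, k n = 0)
    (h1 : (24 : ℤ) ∣ ∑ n ∈ N.divisors, n * k n)
    (h2 : (24 : ℤ) ∣ ∑ n ∈ N.divisors, (N / n : ℕ) * k n)
    (h3 : IsSquare (∏ n ∈ N.divisors, n ^ (k n).natAbs))
    {a b c : ℤ} {d : ℕ} (hd : Odd d) (hdet : a * d - b * (c * N) = 1) {z : ℂ} (hz : 0 < z.im) :
    etaQuot N k ((a * z + b) / (c * N * z + d)) = etaQuot N k z := by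
  have hcd : (c * N * z + d : ℂ) ≠ 0 := by
    have := intCast_mul_add_ne_zero (c := c * N) (d := d)
      (Or.inr (by exact_mod_cast hd.pos.ne')) hz
    exact_mod_cast this
  have hs : sqrt (c * N * z + d) ≠ 0 := by
    rw [sqrt_eq_exp hcd]; exact exp_ne_zero _
  have hNn : ∀ n ∈ N.divisors, (N / n) * n = N := fun n hn =>
    Nat.div_mul_cancel (Nat.dvd_of_mem_divisors hn)
  -- The Jacobi symbols and the exponents of `ζ`, up to factors that do not depend on `n`.
  have hcopd : IsCoprime ((c * N : ℤ)) d := ⟨-b, a, by linear_combination hdet⟩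
  have hJN : J(-(c * N) | d) ≠ 0 :=
    jacobiSym.ne_zero (Int.isCoprime_iff_gcd_eq_one.mp hcopd.neg_left)
  have hJn : ∀ n ∈ N.divisors, J((n : ℤ) | d) ^ 2 = 1 := by
    intro n hn
    apply jacobiSym.sq_one
    apply Int.isCoprime_iff_gcd_eq_one.mp
    refine hcopd.of_isCoprime_of_dvd_left (Dvd.dvd.mul_left ?_ _)
    exact_mod_cast Nat.dvd_of_mem_divisors hn
  have hfac : ∀ n ∈ N.divisors, eta (n * ((a * z + b) / (c * N * z + d))) ^ k n =
      ((J(-(c * N) | d) : ℤ) : ℂ) ^ k n * (J((n : ℤ) | d) : ℤ) ^ k n *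
        zeta24 ^ (((n * b - c * (N / n : ℕ)) * d - a * (c * (N / n : ℕ)) * (d ^ 2 - 1) - 3 * d + 3)
          * k n) * sqrt (c * N * z + d) ^ k n * eta (n * z) ^ k n := by
    intro n hn
    have hcn : ((N / n : ℕ) : ℤ) * n = N := by exact_mod_cast hNn n hn
    have hcnC : ((N / n : ℕ) : ℂ) * n = N := by exact_mod_cast hNn n hn
    have h := eta_smul_of_odd (a := a) (b := n * b) (c := c * (N / n : ℕ)) hd
      (by rw [← hdet, ← hcn]; ring) (natCast_mul_im_pos hn hz)
    have e1 : (a * (n * z) + ((n * b : ℤ) : ℂ)) / (((c * (N / n : ℕ) : ℤ) : ℂ) * (n * z) + d) =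
        n * ((a * z + b) / (c * N * z + d)) := by
      rw [← mul_div_assoc, ← hcnC]
      simp only [Int.cast_mul, Int.cast_natCast]
      congr 1 <;> ring
    have e2 : (((c * (N / n : ℕ) : ℤ) : ℂ) * (n * z) + d) = c * N * z + d := by
      rw [← hcnC]; simp only [Int.cast_mul, Int.cast_natCast]; ring
    rw [e1, e2] at h
    have hJ : J(-(c * (N / n : ℕ)) | d) = J(-(c * N) | d) * J((n : ℤ) | d) := by
      rw [← hcn, show -(c * (((N / n : ℕ) : ℤ) * n)) = -(c * (N / n : ℕ)) * n by ring,
        jacobiSym.mul_left, mul_assoc, ← pow_two, hJn n hn, mul_one]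
    rw [h, hJ, mul_zpow, mul_zpow, mul_zpow, ← zpow_mul, Int.cast_mul, mul_zpow]
  have hJprod : ∏ n ∈ N.divisors, ((J((n : ℤ) | d) : ℤ) : ℂ) ^ k n = 1 := by
    have hz2 : ∀ n ∈ N.divisors, ((J((n : ℤ) | d) : ℤ) : ℂ) ^ k n =
        ((J(((n ^ (k n).natAbs : ℕ) : ℤ) | d) : ℤ) : ℂ) := by
      intro n hn
      push_cast
      rw [jacobiSym.pow_left, Int.cast_pow]
      rcases mul_self_eq_one_iff.mp ((pow_two _).symm.trans (hJn n hn)) with h | h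
      · simp [h]
      · rcases Int.natAbs_eq (k n) with h' | h'
        · rw [h, ← zpow_natCast, ← h']
        · rw [h, ← zpow_natCast]
          nth_rewrite 1 [h']
          rw [zpow_neg]
          simp [← inv_zpow]
    rw [Finset.prod_congr rfl hz2, ← Int.cast_prod]
    have hprod : ∏ n ∈ N.divisors, J(((n ^ (k n).natAbs : ℕ) : ℤ) | d) =
        J(((∏ n ∈ N.divisors, n ^ (k n).natAbs : ℕ) : ℤ) | d) := by
      rw [Nat.cast_prod]
      induction N.divisors using Finset.induction_on with
      | empty => simp
      | insert x s hx ih =>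
        rw [Finset.prod_insert hx, Finset.prod_insert hx, ih, jacobiSym.mul_left]
    have hne : ∏ n ∈ N.divisors, J(((n ^ (k n).natAbs : ℕ) : ℤ) | d) ≠ 0 := by
      refine Finset.prod_ne_zero_iff.mpr fun n hn => ?_
      push_cast
      rw [jacobiSym.pow_left]
      refine pow_ne_zero _ fun h => ?_
      have := hJn n hn
      rw [h] at this
      norm_num at this
    obtain ⟨s, hs⟩ := h3
    rw [hprod, hs] at hne ⊢
    push_cast at hne ⊢
    rw [jacobiSym.mul_left] at hne ⊢
    rcases jacobiSym.trichotomy s d with h | h | h <;> simp [h] at hne ⊢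
  have hzeta : ∏ n ∈ N.divisors, zeta24 ^ (((n * b - c * (N / n : ℕ)) * d -
      a * (c * (N / n : ℕ)) * (d ^ 2 - 1) - 3 * d + 3) * k n) = 1 := by
    rw [prod_zpow_eq_zpow_sum₀ _ zeta24_ne_zero, ← zpow_zero zeta24]
    apply zeta24_zpow_eq
    obtain ⟨u, hu⟩ := h1
    obtain ⟨v, hv⟩ := h2
    have : ∑ n ∈ N.divisors, ((n * b - c * (N / n : ℕ)) * (d : ℤ) -
        a * (c * (N / n : ℕ)) * (d ^ 2 - 1) - 3 * d + 3) * k n =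
        b * d * ∑ n ∈ N.divisors, n * k n -
        (c * d + a * c * (d ^ 2 - 1)) * ∑ n ∈ N.divisors, (N / n : ℕ) * k n +
        (-3 * d + 3) * ∑ n ∈ N.divisors, k n := by
      rw [Finset.mul_sum, Finset.mul_sum, Finset.mul_sum, ← Finset.sum_sub_distrib,
        ← Finset.sum_add_distrib]
      exact Finset.sum_congr rfl fun n _ => by ring
    rw [this, h0, hu, hv]
    exact ⟨b * d * u - (c * d + a * c * (d ^ 2 - 1)) * v, by ring⟩
  rw [etaQuot, Finset.prod_congr rfl hfac]
  simp only [Finset.prod_mul_distrib]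
  rw [hJprod, hzeta, prod_zpow_eq_zpow_sum₀ _ (by exact_mod_cast hJN),
    prod_zpow_eq_zpow_sum₀ _ hs, h0]
  simp [etaQuot]

/-- An eta quotient of weight zero satisfying the usual congruences is invariant under `Γ₀(N)`. -/
theorem etaQuot_moebius (h0 : ∑ n ∈ N.divisors, k n = 0)
    (h1 : (24 : ℤ) ∣ ∑ n ∈ N.divisors, n * k n)
    (h2 : (24 : ℤ) ∣ ∑ n ∈ N.divisors, (N / n : ℕ) * k n)
    (h3 : IsSquare (∏ n ∈ N.divisors, n ^ (k n).natAbs))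
    {a b c d : ℤ} (hdet : a * d - b * (c * N) = 1) {z : ℂ} (hz : 0 < z.im) :
    etaQuot N k ((a * z + b) / (c * N * z + d)) = etaQuot N k z := by
  -- A matrix and its negative act in the same way, so the sign of `d` is immaterial.
  have hodd : ∀ a b c d : ℤ, a * d - b * (c * N) = 1 → Odd d → ∀ z : ℂ, 0 < z.im →
      etaQuot N k ((a * z + b) / (c * N * z + d)) = etaQuot N k z := by
    intro a b c d hdet hd z hz
    obtain ⟨e, rfl | rfl⟩ : ∃ e : ℕ, d = e ∨ d = -e := ⟨d.natAbs, by omega⟩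
    · exact etaQuot_moebius_of_odd h0 h1 h2 h3 (by exact_mod_cast hd) hdet hz
    · have h := etaQuot_moebius_of_odd h0 h1 h2 h3 (a := -a) (b := -b) (c := -c) (d := e)
        (by have := hd.neg; rw [neg_neg] at this; exact_mod_cast this)
        (by linear_combination hdet) hz
      rw [← h, ← neg_div_neg_eq]
      push_cast
      congr 2 <;> ring
  rcases Int.even_or_odd d with hd | hd
  · have hshift : etaQuot N k ((z - 1) : ℂ) = etaQuot N k z := by
      have := hodd 1 (-1) 0 1 (by ring) odd_one z hz
      rw [← this]
      congr 1
      push_cast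
      ring
    have hcN : Odd (c * N) := by
      by_contra h
      rw [Int.not_odd_iff_even] at h
      have : Even (1 : ℤ) := hdet ▸ (hd.mul_left a).sub (h.mul_left b)
      exact absurd this (by decide)
    have := hodd a (b + a) c (d + c * N) (by linear_combination hdet) (hd.add_odd hcN) (z - 1)
      (by simpa using hz)
    rw [hshift] at this
    rw [← this]
    congr 1
    push_cast
    congr 1 <;> ring
  · exact hodd a b c d hdet hd z hz

end EtaQuotient

/-! ### Functions with a single simple pole at the cusp `i∞` -/

section PrincipalModulus

open UpperHalfPlane MatrixGroups Matrix.SpecialLinearGroup Filter Asymptotics Topology Manifold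
open Polynomial

/-- A function that is holomorphic and invariant under a finite index subgroup of `SL₂(ℤ)` and
bounded at all cusps is constant. -/
lemma exists_eq_const_of_isBoundedAtImInfty {G : Subgroup SL(2, ℤ)} [G.FiniteIndex] {h : ℍ → ℂ}
    (hol : MDiff h) (inv : ∀ γ ∈ G, ∀ τ : ℍ, h (γ • τ) = h τ)
    (bdd : ∀ g : SL(2, ℤ), IsBoundedAtImInfty fun τ => h (g • τ)) : ∃ c, ∀ τ, h τ = c := by
  let F : ModularForm (G.map (mapGL ℝ)) 0 :=
    { toFun := h
      slash_action_eq' := by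
        rintro _ ⟨γ, hγ, rfl⟩
        ext τ
        have := inv γ hγ τ
        rw [← this]
        exact (ModularForm.SL_slash_apply (k := 0) h γ τ).trans (by simp)
      holo' := hol
      bdd_at_cusps' := by
        intro c hc
        rw [OnePoint.isBoundedAt_iff_forall_SL2Z
          (Subgroup.IsArithmetic.isCusp_iff_isCusp_SL2Z _ |>.mp hc)]
        intro γ _
        convert bdd γ using 1
        ext τ
        simp [ModularForm.SL_slash_apply] }
  obtain ⟨c, hc⟩ := ModularForm.eq_const_of_weight_zero F
  exact ⟨c, fun τ => congrFun hc τ⟩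

lemma mdifferentiable_specialLinearGroup_smul (g : SL(2, ℤ)) : MDiff (fun τ : ℍ => g • τ) :=
  mdifferentiable_smul (g := mapGL ℝ g) (by simp)

lemma periodic_comp_ofComplex_of_T_pow {h : ℍ → ℂ} {n : ℕ}
    (hper : ∀ τ : ℍ, h (ModularGroup.T ^ n • τ) = h τ) :
    Function.Periodic (h ∘ ofComplex) ((n : ℝ) : ℂ) := by
  intro z
  simp only [Function.comp_apply]
  by_cases hz : 0 < z.im
  · have hz' : 0 < (z + ((n : ℝ) : ℂ)).im := by simpa using hz
    rw [ofComplex_apply_of_im_pos hz', ofComplex_apply_of_im_pos hz, ← hper ⟨z, hz⟩]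
    congr 1
    ext
    have := ModularGroup.coe_T_zpow_smul_eq ⟨z, hz⟩ (n := n)
    rw [zpow_natCast] at this
    rw [this]
    simp
  · have hz' : ¬ 0 < (z + ((n : ℝ) : ℂ)).im := by simpa using hz
    rw [ofComplex_apply_of_im_nonpos (not_lt.mp hz'), ofComplex_apply_of_im_nonpos (not_lt.mp hz)]

/-- An invariant holomorphic function that is bounded at the cusp `g ∞` converges there, with
exponential speed. -/
lemma exists_isBigO_sub_exp {G : Subgroup SL(2, ℤ)} [hG : G.FiniteIndex] {h : ℍ → ℂ}
    (hol : MDiff h) (inv : ∀ γ ∈ G, ∀ τ : ℍ, h (γ • τ) = h τ) (g : SL(2, ℤ))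
    (bdd : IsBoundedAtImInfty fun τ => h (g • τ)) :
    ∃ v : ℂ, ∃ ε : ℝ, 0 < ε ∧
      (fun τ : ℍ => h (g • τ) - v) =O[atImInfty] fun τ => Real.exp (-ε * τ.im) := by
  obtain ⟨n, hn, -, hmem⟩ := Subgroup.exists_pow_mem_of_index_ne_zero hG.index_ne_zero
    (g * ModularGroup.T * g⁻¹)
  rw [conj_pow] at hmem
  have hper : ∀ τ : ℍ, h (g • (ModularGroup.T ^ n • τ)) = h (g • τ) := fun τ => by
    rw [← inv _ hmem (g • τ), mul_smul, mul_smul, inv_smul_smul]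
  have hn' : (0 : ℝ) < n := by exact_mod_cast hn
  refine ⟨valueAtInfty fun τ => h (g • τ), 2 * Real.pi / n, by positivity, ?_⟩
  have := exp_decay_sub_atImInfty (h := n) (f := fun τ => h (g • τ)) hn'
    (periodic_comp_ofComplex_of_T_pow hper)
    (hol.comp (mdifferentiable_specialLinearGroup_smul g)) bdd
  refine this.trans (isBigO_of_le _ fun τ => le_of_eq ?_)
  congr 2
  ring

/-- The situation in which `T` will be shown to be a principal modulus for `Γ`: the function `T` is
holomorphic and `Γ`-invariant, it has a simple pole at `i∞`, and it is bounded at all cusps that are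
not `Γ`-equivalent to `i∞`. The finite index subgroup `G` of `SL₂(ℤ)` witnesses that `Γ` is large,
and contains the translation `τ ↦ τ + 1`. -/
structure HasSimplePoleAtInfty (Γ : Subgroup SL(2, ℝ)) (G : Subgroup SL(2, ℤ)) (T : ℍ → ℂ) :
    Prop where
  le : ∀ γ ∈ G, (γ : SL(2, ℝ)) ∈ Γ
  translation_mem : ModularGroup.T ∈ G
  holomorphic : MDiff T
  invariant : ∀ γ ∈ Γ, ∀ τ : ℍ, T (γ • τ) = T τ
  expansion : (fun τ : ℍ => T τ - (Function.Periodic.qParam 1 (τ : ℂ))⁻¹) =O[atImInfty]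
    fun _ => (1 : ℝ)
  cusps : ∀ g : SL(2, ℤ), (∃ γ ∈ Γ, ∃ r : ℝ, 0 < r ∧ ∃ t : ℝ, ∀ τ : ℍ,
    ((γ • (g • τ) : ℍ) : ℂ) = r * τ + t) ∨ IsBoundedAtImInfty fun τ => T (g • τ)

lemma tendsto_atImInfty_of_eq_mul_add {φ : ℍ → ℍ} {r t : ℝ} (hr : 0 < r)
    (h : ∀ τ : ℍ, (φ τ : ℂ) = r * τ + t) : Tendsto φ atImInfty atImInfty := by
  refine tendsto_comap_iff.mpr ?_
  have : im ∘ φ = fun τ : ℍ => r * τ.im := by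
    ext τ
    have := congrArg Complex.im (h τ)
    simpa using this
  rw [this]
  exact (tendsto_comap (f := UpperHalfPlane.im)).const_mul_atTop hr

lemma isBigO_one_iff_isBoundedAtImInfty {f : ℍ → ℂ} :
    IsBoundedAtImInfty f ↔ f =O[atImInfty] fun _ => (1 : ℝ) := by
  rfl

namespace HasSimplePoleAtInfty

variable {Γ : Subgroup SL(2, ℝ)} {G : Subgroup SL(2, ℤ)} {T : ℍ → ℂ}

lemma invariant_of_mem (hT : HasSimplePoleAtInfty Γ G T) {h : ℍ → ℂ}
    (inv : ∀ γ ∈ Γ, ∀ τ : ℍ, h (γ • τ) = h τ) : ∀ γ ∈ G, ∀ τ : ℍ, h (γ • τ) = h τ :=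
  fun γ hγ τ => inv _ (hT.le γ hγ) τ

/-- A `Γ`-invariant function that is bounded at `i∞` and at the cusps where `T` is bounded is
constant. -/
lemma exists_eq_const (hT : HasSimplePoleAtInfty Γ G T) [G.FiniteIndex] {H : ℍ → ℂ} (hol : MDiff H)
    (inv : ∀ γ ∈ Γ, ∀ τ : ℍ, H (γ • τ) = H τ)
    (bdd : ∀ g : SL(2, ℤ), (IsBoundedAtImInfty fun τ => T (g • τ)) →
      IsBoundedAtImInfty fun τ => H (g • τ))
    (hinf : IsBoundedAtImInfty H) : ∃ c, ∀ τ, H τ = c := by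
  refine exists_eq_const_of_isBoundedAtImInfty hol (hT.invariant_of_mem inv) fun g => ?_
  rcases hT.cusps g with ⟨γ, hγ, r, hr, t, h⟩ | h
  · have := IsBigO.comp_tendsto hinf (tendsto_atImInfty_of_eq_mul_add hr h)
    refine this.congr_left fun τ => inv γ hγ _
  · exact bdd g h

lemma norm_qParam_one (τ : ℍ) :
    ‖Function.Periodic.qParam 1 (τ : ℂ)‖ = Real.exp (-(2 * Real.pi * τ.im)) := by
  rw [Function.Periodic.norm_qParam]
  congr 1
  simp

lemma qParam_ne_zero (τ : ℍ) : Function.Periodic.qParam 1 (τ : ℂ) ≠ 0 := Complex.exp_ne_zero _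

/-- `T q - 1` is `O(q)` at `i∞`. -/
lemma mul_qParam_sub_one (hT : HasSimplePoleAtInfty Γ G T) :
    (fun τ : ℍ => T τ * Function.Periodic.qParam 1 (τ : ℂ) - 1) =O[atImInfty]
      fun τ => Function.Periodic.qParam 1 (τ : ℂ) := by
  have := hT.expansion.mul
    (isBigO_refl (fun τ : ℍ => Function.Periodic.qParam 1 (τ : ℂ)) atImInfty).norm_right
  refine (this.congr_left fun τ => ?_).trans (isBigO_of_le _ fun τ => by simp)
  rw [sub_mul, inv_mul_cancel₀ (qParam_ne_zero τ)]

lemma tendsto_qParam : Tendsto (fun τ : ℍ => Function.Periodic.qParam 1 (τ : ℂ)) atImInfty (𝓝 0) :=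
  ((Function.Periodic.qParam_tendsto one_pos).mono_right nhdsWithin_le_nhds).comp
    tendsto_coe_atImInfty

lemma tendsto_mul_qParam (hT : HasSimplePoleAtInfty Γ G T) :
    Tendsto (fun τ : ℍ => T τ * Function.Periodic.qParam 1 (τ : ℂ)) atImInfty (𝓝 1) := by
  have := hT.mul_qParam_sub_one.trans_tendsto tendsto_qParam
  simpa using this.add_const 1

lemma mul_qParam_pow_sub_one (hT : HasSimplePoleAtInfty Γ G T) (n : ℕ) :
    (fun τ : ℍ => (T τ * Function.Periodic.qParam 1 (τ : ℂ)) ^ n - 1) =O[atImInfty]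
      fun τ => Function.Periodic.qParam 1 (τ : ℂ) := by
  have hsum : (fun τ : ℍ => ∑ i ∈ Finset.range n, (T τ * Function.Periodic.qParam 1 (τ : ℂ)) ^ i)
      =O[atImInfty] fun _ => (1 : ℝ) :=
    (tendsto_finsetSum _ fun i _ => hT.tendsto_mul_qParam.pow i).isBigO_one ℝ
  have := hsum.mul hT.mul_qParam_sub_one.norm_right
  refine (this.congr_left fun τ => ?_).trans (isBigO_of_le _ fun τ => by simp)
  exact geom_sum_mul _ _

/-- A holomorphic `Γ`-invariant function that is bounded at the cusps where `T` is bounded, and of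
exponential growth at `i∞`, is a polynomial in `T`: subtract a multiple of a power of `T` to
lower the order of the pole. -/
lemma exists_polynomial (hT : HasSimplePoleAtInfty Γ G T) [G.FiniteIndex] (n : ℕ) {H : ℍ → ℂ}
    (hol : MDiff H) (inv : ∀ γ ∈ Γ, ∀ τ : ℍ, H (γ • τ) = H τ)
    (bdd : ∀ g : SL(2, ℤ), (IsBoundedAtImInfty fun τ => T (g • τ)) →
      IsBoundedAtImInfty fun τ => H (g • τ))
    (hinf : H =O[atImInfty] fun τ => Real.exp (2 * Real.pi * n * τ.im)) :
    ∃ P : ℂ[X], ∀ τ, H τ = P.eval (T τ) := by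
  induction n generalizing H with
  | zero =>
    obtain ⟨c, hc⟩ := hT.exists_eq_const hol inv bdd
      (isBigO_one_iff_isBoundedAtImInfty.mpr (hinf.congr_right fun τ => by simp))
    exact ⟨C c, by simpa using hc⟩
  | succ n ih =>
    set q : ℍ → ℂ := fun τ => Function.Periodic.qParam 1 (τ : ℂ) with hq
    have hqn : ∀ τ, ‖q τ‖ = Real.exp (-(2 * Real.pi * τ.im)) := norm_qParam_one
    have hq0 : ∀ τ, q τ ≠ 0 := qParam_ne_zero
    have hqhol : MDiff q := by
      rw [UpperHalfPlane.mdifferentiable_iff]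
      have h1 : Differentiable ℂ (fun z : ℂ => Function.Periodic.qParam 1 z) := by
        unfold Function.Periodic.qParam
        fun_prop
      refine h1.differentiableOn.congr fun z hz => ?_
      simp [hq, ofComplex_apply_of_im_pos hz]
    -- `H q ^ (n + 1)` is bounded, hence has a limit at `i∞`.
    have hper : Function.Periodic ((fun τ => H τ * q τ ^ (n + 1)) ∘ ofComplex) ((1 : ℝ) : ℂ) := by
      have := periodic_comp_ofComplex_of_T_pow (n := 1) (h := fun τ => H τ * q τ ^ (n + 1))
        fun τ => by
          rw [pow_one, hT.invariant_of_mem inv _ hT.translation_mem]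
          congr 2
          have := ModularGroup.coe_T_zpow_smul_eq τ (n := 1)
          rw [zpow_one] at this
          simp only [hq, this, Function.Periodic.qParam]
          rw [Complex.exp_eq_exp_iff_exists_int]
          exact ⟨1, by push_cast; ring⟩
      simpa using this
    have hbd : IsBoundedAtImInfty fun τ => H τ * q τ ^ (n + 1) := by
      have := hinf.mul (isBigO_refl (fun τ => q τ ^ (n + 1)) atImInfty).norm_right
      refine this.trans (isBigO_of_le _ fun τ => le_of_eq ?_)
      rw [norm_pow, hqn, ← Real.exp_nat_mul, ← Real.exp_add]
      simp only [Pi.one_apply, norm_one, Real.norm_eq_abs, Real.abs_exp]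
      rw [Real.exp_eq_one_iff]
      push_cast
      ring
    have hdec := exp_decay_sub_atImInfty one_pos hper
      (hol.mul (hqhol.pow (n + 1))) hbd
    set v := valueAtInfty fun τ => H τ * q τ ^ (n + 1) with hv
    obtain ⟨P, hP⟩ := ih (H := fun τ => H τ - v * T τ ^ (n + 1))
      (hol.sub (mdifferentiable_const.mul (hT.holomorphic.pow (n + 1))))
      (fun γ hγ τ => by rw [inv γ hγ, hT.invariant γ hγ])
      (fun g hg => by
        have h1 : (fun τ : ℍ => v * T (g • τ) ^ (n + 1)) =O[atImInfty] fun _ => (1 : ℝ) := by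
          simpa using (IsBigO.pow hg (n + 1)).const_mul_left v
        exact IsBigO.sub (bdd g hg) h1)
      (by
        have h1 : (fun τ : ℍ => (H τ * q τ ^ (n + 1) - v) - v * ((T τ * q τ) ^ (n + 1) - 1))
            =O[atImInfty] q := by
          refine IsBigO.sub (hdec.trans (isBigO_of_le _ fun τ => le_of_eq ?_))
            ((hT.mul_qParam_pow_sub_one (n + 1)).const_mul_left v)
          rw [hqn, Real.norm_eq_abs, Real.abs_exp]
          congr 1
          ring
        have h2 := h1.mul (isBigO_refl (fun τ => (q τ ^ (n + 1))⁻¹) atImInfty)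
        refine (h2.congr_left fun τ => ?_).trans (isBigO_of_le _ fun τ => le_of_eq ?_)
        · have := pow_ne_zero (n + 1) (hq0 τ)
          field_simp
          ring
        · rw [norm_mul, norm_inv, norm_pow, hqn, ← Real.exp_nat_mul, ← Real.exp_neg,
            ← Real.exp_add, Real.norm_eq_abs, Real.abs_exp]
          congr 1
          push_cast
          ring)
    refine ⟨P + C v * X ^ (n + 1), fun τ => ?_⟩
    have := hP τ
    simp only [eval_add, eval_mul, eval_C, eval_pow, eval_X, ← this]
    ring

end HasSimplePoleAtInfty

end PrincipalModulus

/-! ### Removing the poles of a modular function -/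

section Poles

open UpperHalfPlane MatrixGroups Matrix.SpecialLinearGroup Filter Asymptotics Topology Manifold
open Polynomial

lemma tendsto_coe_nhdsNE (τ : ℍ) : Tendsto UpperHalfPlane.coe (𝓝[≠] τ) (𝓝[≠] (τ : ℂ)) :=
  tendsto_nhdsWithin_of_tendsto_nhds_of_eventually_within _
    ((UpperHalfPlane.continuous_coe.tendsto τ).mono_left nhdsWithin_le_nhds)
    (eventually_mem_nhdsWithin.mono fun _ hz h => hz (UpperHalfPlane.ext h))

lemma tendsto_ofComplex_nhdsNE (τ : ℍ) :
    Tendsto (fun z => (ofComplex z : ℍ)) (𝓝[≠] (τ : ℂ)) (𝓝[≠] τ) := by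
  refine tendsto_nhdsWithin_of_tendsto_nhds_of_eventually_within _ ?_ ?_
  · have := (contMDiffAt_ofComplex (n := 1) τ.im_pos).continuousAt.tendsto
    rw [ofComplex_apply] at this
    exact this.mono_left nhdsWithin_le_nhds
  · have : ∀ᶠ z : ℂ in 𝓝[≠] (τ : ℂ), 0 < z.im :=
      nhdsWithin_le_nhds (isOpen_upperHalfPlaneSet.mem_nhds τ.im_pos)
    filter_upwards [this, eventually_mem_nhdsWithin] with z hz hne h
    apply hne
    rw [Set.mem_singleton_iff, ← h, ofComplex_apply_of_im_pos hz]

lemma tendsto_smul_nhdsNE (g : SL(2, ℝ)) (τ : ℍ) :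
    Tendsto (fun z : ℍ => g • z) (𝓝[≠] τ) (𝓝[≠] (g • τ)) :=
  tendsto_nhdsWithin_of_tendsto_nhds_of_eventually_within _
    (((continuous_const_smul g).tendsto τ).mono_left nhdsWithin_le_nhds)
    (eventually_mem_nhdsWithin.mono fun _ hz h => hz (MulAction.injective g h))

/-- `f` is bounded in a punctured neighbourhood of `τ`. -/
def LocallyBoundedNear (f : ℍ → ℂ) (τ : ℍ) : Prop := f =O[𝓝[≠] τ] fun _ => (1 : ℝ)

lemma LocallyBoundedNear.of_continuousAt {f : ℍ → ℂ} {τ : ℍ} (h : ContinuousAt f τ) :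
    LocallyBoundedNear f τ := (h.isBigO_one ℝ).mono nhdsWithin_le_nhds

lemma LocallyBoundedNear.mul {f g : ℍ → ℂ} {τ : ℍ} (hf : LocallyBoundedNear f τ)
    (hg : LocallyBoundedNear g τ) : LocallyBoundedNear (fun z => f z * g z) τ := by
  simpa [LocallyBoundedNear] using IsBigO.mul hf hg

lemma LocallyBoundedNear.comp_smul {f : ℍ → ℂ} {τ : ℍ} (g : SL(2, ℝ))
    (hf : LocallyBoundedNear f (g • τ)) : LocallyBoundedNear (fun z => f (g • z)) τ :=
  IsBigO.comp_tendsto hf (tendsto_smul_nhdsNE g τ)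

lemma LocallyBoundedNear.of_comp_smul {f : ℍ → ℂ} {τ : ℍ} (g : SL(2, ℝ))
    (hf : LocallyBoundedNear (fun z => f (g • z)) τ) : LocallyBoundedNear f (g • τ) := by
  have := LocallyBoundedNear.comp_smul (f := fun z => f (g • z)) (τ := g • τ) g⁻¹ (by
    rwa [inv_smul_smul])
  simpa using this

lemma MDifferentiable.analyticAt_comp_ofComplex {f : ℍ → ℂ} (hf : MDiff f) (τ : ℍ) :
    AnalyticAt ℂ (f ∘ ofComplex) τ :=
  (UpperHalfPlane.mdifferentiable_iff.mp hf).analyticAt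
    (isOpen_upperHalfPlaneSet.mem_nhds τ.im_pos)

lemma continuousAt_of_continuousAt_comp_ofComplex {f : ℍ → ℂ} {τ : ℍ}
    (h : ContinuousAt (f ∘ ofComplex) τ) : ContinuousAt f τ := by
  have := ContinuousAt.comp (f := UpperHalfPlane.coe) (x := τ) h
    UpperHalfPlane.continuous_coe.continuousAt
  simpa [Function.comp_def] using this

/-- Riemann's removable singularity theorem: a meromorphic function that is locally bounded near
every point extends to a holomorphic function. -/
lemma exists_holomorphic_extension {h : ℍ → ℂ} (mer : ∀ τ : ℍ, MeromorphicAt (h ∘ ofComplex) τ)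
    (bdd : ∀ τ, LocallyBoundedNear h τ) :
    ∃ h' : ℍ → ℂ, MDiff h' ∧ (∀ τ, Tendsto h (𝓝[≠] τ) (𝓝 (h' τ))) := by
  have hlim : ∀ τ : ℍ, ∃ c, Tendsto (h ∘ ofComplex) (𝓝[≠] (τ : ℂ)) (𝓝 c) := by
    intro τ
    rw [tendsto_nhds_iff_meromorphicOrderAt_nonneg (mer τ)]
    by_contra hneg
    have h1 := tendsto_norm_cobounded_atTop.comp
      (tendsto_cobounded_of_meromorphicOrderAt_neg (not_le.mp hneg))
    have h2 : (h ∘ ofComplex) =O[𝓝[≠] (τ : ℂ)] fun _ => (1 : ℝ) :=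
      IsBigO.comp_tendsto (bdd τ) (tendsto_ofComplex_nhdsNE τ)
    obtain ⟨C, hC⟩ := isBigO_iff.mp h2
    obtain ⟨z, hz1, hz2⟩ := (hC.and (h1.eventually_gt_atTop C)).exists
    simp at hz1 hz2
    linarith
  choose h' hh' using hlim
  have hcoe : ∀ τ, Tendsto h (𝓝[≠] τ) (𝓝 (h' τ)) := fun τ => by
    simpa [Function.comp_def] using (hh' τ).comp (tendsto_coe_nhdsNE τ)
  refine ⟨h', fun τ => ?_, hcoe⟩
  rw [UpperHalfPlane.mdifferentiableAt_iff]
  -- Near `τ`, and away from `τ`, the function `h` is continuous and hence agrees with `h'`.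
  have heq : (h' ∘ ofComplex) =ᶠ[𝓝[≠] (τ : ℂ)] (h ∘ ofComplex) := by
    have him : ∀ᶠ z : ℂ in 𝓝[≠] (τ : ℂ), 0 < z.im :=
      nhdsWithin_le_nhds (isOpen_upperHalfPlaneSet.mem_nhds τ.im_pos)
    filter_upwards [(mer τ).eventually_analyticAt, him] with z hz hz'
    have h1 := hh' ⟨z, hz'⟩
    have h2 : Tendsto (h ∘ ofComplex) (𝓝[≠] z) (𝓝 ((h ∘ ofComplex) z)) :=
      hz.continuousAt.tendsto.mono_left nhdsWithin_le_nhds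
    rw [Function.comp_apply, ofComplex_apply_of_im_pos hz']
    exact tendsto_nhds_unique h1 h2
  refine AnalyticAt.differentiableAt (MeromorphicAt.analyticAt ?_ ?_)
  · exact (mer τ).congr heq.symm
  · rw [continuousAt_iff_punctured_nhds]
    simp only [Function.comp_apply, ofComplex_apply]
    exact (hh' τ).congr' heq.symm

/-- The limit function of an invariant function is invariant. -/
lemma smul_eq_of_tendsto {h h' : ℍ → ℂ} (hlim : ∀ τ, Tendsto h (𝓝[≠] τ) (𝓝 (h' τ)))
    {g : SL(2, ℝ)} (inv : ∀ τ : ℍ, h (g • τ) = h τ) (τ : ℍ) : h' (g • τ) = h' τ := by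
  have := (hlim (g • τ)).comp (tendsto_smul_nhdsNE g τ)
  exact tendsto_nhds_unique (this.congr fun z => inv z) (hlim τ)

lemma isBigO_exp_of_tendsto {h h' : ℍ → ℂ} (hlim : ∀ τ, Tendsto h (𝓝[≠] τ) (𝓝 (h' τ)))
    {g : SL(2, ℝ)} {C : ℝ}
    (hO : (fun τ : ℍ => h (g • τ)) =O[atImInfty] fun τ : ℍ => Real.exp (C * τ.im)) :
    (fun τ : ℍ => h' (g • τ)) =O[atImInfty] fun τ : ℍ => Real.exp (C * τ.im) := by
  obtain ⟨K, hK⟩ := isBigO_iff.mp hO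
  obtain ⟨A, hA⟩ := (atImInfty_mem _).mp hK
  refine isBigO_iff.mpr ⟨K, (atImInfty_mem _).mpr ⟨A + 1, fun τ hτ => ?_⟩⟩
  have h1 := ((hlim (g • τ)).comp (tendsto_smul_nhdsNE g τ)).norm
  have h2 : Tendsto (fun τ : ℍ => K * ‖Real.exp (C * τ.im)‖) (𝓝[≠] τ)
      (𝓝 (K * ‖Real.exp (C * τ.im)‖)) := by
    have : Continuous fun τ : ℍ => K * ‖Real.exp (C * τ.im)‖ := by fun_prop
    exact (this.tendsto τ).mono_left nhdsWithin_le_nhds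
  refine le_of_tendsto_of_tendsto h1 h2 ?_
  have : ∀ᶠ z : ℍ in 𝓝[≠] τ, A < z.im :=
    nhdsWithin_le_nhds ((isOpen_Ioi.preimage UpperHalfPlane.continuous_im).mem_nhds
      (show A < τ.im by linarith))
  exact this.mono fun z hz => hA z hz.le

lemma exists_finset_coset_representatives {α : Type*} [Group α] (G : Subgroup α) [G.FiniteIndex] :
    ∃ R : Finset α, ∀ g, ∃ r ∈ R, ∃ γ ∈ G, g = γ * r := by
  classical
  have : Fintype (α ⧸ G) := Fintype.ofFinite _
  refine ⟨Finset.univ.image fun x : α ⧸ G => x.out⁻¹, fun g => ?_⟩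
  obtain ⟨h, hh⟩ := QuotientGroup.mk_out_eq_mul G g⁻¹
  refine ⟨((g⁻¹ : α) : α ⧸ G).out⁻¹, by simp, h, h.2, ?_⟩
  rw [hh]
  group

/-- The points of a compact set near which a meromorphic function is unbounded are finite in
number. -/
lemma finite_not_locallyBoundedNear {f : ℍ → ℂ} (mer : ∀ τ : ℍ, MeromorphicAt (f ∘ ofComplex) τ)
    {K : Set ℍ} (hK : IsCompact K) : {τ ∈ K | ¬ LocallyBoundedNear f τ}.Finite := by
  by_contra hinf
  obtain ⟨x, -, hx⟩ := Set.Infinite.exists_accPt_of_subset_isCompact hinf hK (Set.sep_subset _ _)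
  have h1 : ∀ᶠ τ in 𝓝[≠] x, LocallyBoundedNear f τ := by
    refine ((tendsto_coe_nhdsNE x).eventually (mer x).eventually_analyticAt).mono fun τ hτ => ?_
    exact .of_continuousAt (continuousAt_of_continuousAt_comp_ofComplex hτ.continuousAt)
  rw [accPt_iff_frequently_nhdsNE] at hx
  obtain ⟨τ, h2, h3⟩ := (hx.and_eventually h1).exists
  exact h2.2 h3

/-- The poles of a modular function lie in finitely many orbits: the cusp conditions exclude poles
with large imaginary part in each of the finitely many translates of the fundamental domain. -/
lemma exists_finset_poles {Γ : Subgroup SL(2, ℝ)} {G : Subgroup SL(2, ℤ)} [G.FiniteIndex]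
    (hG : ∀ γ ∈ G, (γ : SL(2, ℝ)) ∈ Γ) {f : ℍ → ℂ} (hf : IsModularFunction Γ f) :
    ∃ S : Finset ℍ, ∀ τ, ¬ LocallyBoundedNear f τ → ∃ γ ∈ G, ∃ p ∈ S, τ = γ • p := by
  obtain ⟨R, hR⟩ := exists_finset_coset_representatives G
  have hA : ∀ r : SL(2, ℤ), ∃ A : ℝ, ∀ τ : ℍ, A < τ.im → LocallyBoundedNear f (r • τ) := by
    intro r
    obtain ⟨C, hC⟩ := hf.cusps r
    obtain ⟨K, hK⟩ := isBigO_iff.mp hC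
    obtain ⟨A, hA⟩ := (atImInfty_mem _).mp hK
    refine ⟨A, fun τ hτ => LocallyBoundedNear.of_comp_smul (r : SL(2, ℝ)) ?_⟩
    have h1 : (fun z : ℍ => f (r • z)) =O[𝓝[≠] τ] fun z : ℍ => Real.exp (C * z.im) := by
      refine isBigO_iff.mpr ⟨K, nhdsWithin_le_nhds ?_⟩
      filter_upwards [(isOpen_Ioi.preimage UpperHalfPlane.continuous_im).mem_nhds hτ] with z hz
      exact hA z (le_of_lt hz)
    have h2 : Continuous fun z : ℍ => Real.exp (C * z.im) := by fun_prop
    exact h1.trans ((h2.continuousAt.isBigO_one ℝ).mono nhdsWithin_le_nhds)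
  choose A hA using hA
  obtain ⟨B, hB⟩ := (R.finite_toSet.image A).bddAbove
  set K : Set ℍ := ⋃ r ∈ R,
    (fun τ : ℍ => r • τ) '' ModularGroup.truncatedFundamentalDomain B with hK
  have hKc : IsCompact K := R.isCompact_biUnion fun r _ =>
    (ModularGroup.isCompact_truncatedFundamentalDomain B).image
      (mdifferentiable_specialLinearGroup_smul r).continuous
  refine ⟨(finite_not_locallyBoundedNear hf.meromorphic hKc).toFinset, fun τ hτ => ?_⟩
  obtain ⟨g, hg⟩ := ModularGroup.exists_smul_mem_fd τ
  obtain ⟨r, hr, γ, hγ, hgr⟩ := hR g⁻¹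
  have hτ' : τ = γ • (r • (g • τ)) := by rw [← mul_smul, ← hgr, inv_smul_smul]
  have hbad : ¬ LocallyBoundedNear f (r • (g • τ)) := by
    intro h
    apply hτ
    rw [hτ']
    refine LocallyBoundedNear.of_comp_smul (γ : SL(2, ℝ)) ?_
    rwa [show (fun z => f ((γ : SL(2, ℝ)) • z)) = f from funext (hf.invariant _ (hG γ hγ))]
  refine ⟨γ, hγ, r • (g • τ), ?_, hτ'⟩
  rw [Set.Finite.mem_toFinset]
  refine ⟨Set.mem_biUnion hr ⟨g • τ, ⟨hg, ?_⟩, rfl⟩, hbad⟩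
  by_contra h
  exact hbad (hA r _ ((hB ⟨r, hr, rfl⟩).trans_lt (not_le.mp h)))

/-- A pole of `f` at `p` is cancelled by a power of `T - T p`. -/
lemma exists_pow_sub_mul_locallyBoundedNear {f T : ℍ → ℂ} {p : ℍ} (hT : MDiff T)
    (mer : MeromorphicAt (f ∘ ofComplex) p) :
    ∃ n : ℕ, LocallyBoundedNear (fun z => (T z - T p) ^ n * f z) p := by
  obtain ⟨n, hn⟩ := mer
  refine ⟨n, ?_⟩
  have h1 : (fun z => (T ∘ ofComplex) z - (T ∘ ofComplex) p) =O[𝓝 (p : ℂ)] fun z => z - p :=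
    (UpperHalfPlane.mdifferentiableAt_iff.mp (hT p)).isBigO_sub
  have h2 := (h1.pow n).mul (isBigO_refl (f ∘ ofComplex) _)
  have h3 := (h2.trans (hn.continuousAt.isBigO_one ℝ)).mono
    (nhdsWithin_le_nhds (s := {(p : ℂ)}ᶜ))
  have h4 := h3.comp_tendsto (tendsto_coe_nhdsNE p)
  simpa [Function.comp_def, LocallyBoundedNear] using h4

variable {Γ : Subgroup SL(2, ℝ)} {G : Subgroup SL(2, ℤ)} {T : ℍ → ℂ}

namespace HasSimplePoleAtInfty

/-- All poles of a modular function in the upper half-plane are cancelled by a polynomial in `T`. -/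
lemma exists_polynomial_mul_holomorphic (hT : HasSimplePoleAtInfty Γ G T) [G.FiniteIndex]
    {f : ℍ → ℂ} (hf : IsModularFunction Γ f) :
    ∃ Q : ℂ[X], Q ≠ 0 ∧ ∃ h : ℍ → ℂ, MDiff h ∧
      ∀ τ, Tendsto (fun z => Q.eval (T z) * f z) (𝓝[≠] τ) (𝓝 (h τ)) := by
  classical
  obtain ⟨S, hS⟩ := exists_finset_poles hT.le hf
  choose n hn using fun p : ℍ => exists_pow_sub_mul_locallyBoundedNear hT.holomorphic
    (hf.meromorphic p)
  have hQc : ∀ Q : ℂ[X], Continuous fun z => Q.eval (T z) := fun Q =>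
    Q.continuous.comp hT.holomorphic.continuous
  refine ⟨∏ p ∈ S, (X - C (T p)) ^ n p,
    Finset.prod_ne_zero_iff.mpr fun p _ => pow_ne_zero _ (X_sub_C_ne_zero _),
    exists_holomorphic_extension (fun τ => ?_) fun τ => ?_⟩
  · refine MeromorphicAt.mul (f := fun z => (∏ p ∈ S, (X - C (T p)) ^ n p).eval (T (ofComplex z)))
      (AnalyticAt.meromorphicAt ?_) (hf.meromorphic τ)
    exact ((∏ p ∈ S, (X - C (T p)) ^ n p).differentiable.analyticAt _).comp
      (MDifferentiable.analyticAt_comp_ofComplex hT.holomorphic τ)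
  · by_cases hτ : LocallyBoundedNear f τ
    · exact (LocallyBoundedNear.of_continuousAt (hQc _).continuousAt).mul hτ
    · obtain ⟨γ, hγ, p, hp, rfl⟩ := hS τ hτ
      refine LocallyBoundedNear.of_comp_smul (γ : SL(2, ℝ)) ?_
      simp only [hf.invariant _ (hT.le γ hγ), hT.invariant _ (hT.le γ hγ)]
      have := (LocallyBoundedNear.of_continuousAt
        (hQc (∏ p ∈ S.erase p, (X - C (T p)) ^ n p)).continuousAt).mul (hn p)
      refine this.congr_left fun z => ?_
      rw [← Finset.mul_prod_erase _ _ hp]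
      simp only [eval_mul, eval_pow, eval_sub, eval_X, eval_C]
      ring

lemma isBigO_exp (hT : HasSimplePoleAtInfty Γ G T) :
    T =O[atImInfty] fun τ => Real.exp (2 * Real.pi * τ.im) := by
  have h1 := (hT.tendsto_mul_qParam.isBigO_one ℝ).mul
    (isBigO_refl (fun τ : ℍ => (Function.Periodic.qParam 1 (τ : ℂ))⁻¹) atImInfty).norm_right
  refine (h1.congr_left fun τ => ?_).trans (isBigO_of_le _ fun τ => le_of_eq ?_)
  · rw [mul_assoc, mul_inv_cancel₀ (qParam_ne_zero τ), mul_one]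
  · rw [norm_mul, norm_inv, norm_qParam_one, ← Real.exp_neg]
    simp

lemma tendsto_norm (hT : HasSimplePoleAtInfty Γ G T) :
    Tendsto (fun τ => ‖T τ‖) atImInfty atTop := by
  have h1 : Tendsto (fun τ : ℍ => ‖(Function.Periodic.qParam 1 (τ : ℂ))⁻¹‖) atImInfty atTop := by
    simp only [norm_inv]
    refine tendsto_inv_nhdsGT_zero.comp (tendsto_nhdsWithin_iff.mpr ⟨?_, ?_⟩)
    · simpa using tendsto_qParam.norm
    · exact Eventually.of_forall fun τ => norm_pos_iff.mpr (qParam_ne_zero τ)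
  refine (hT.tendsto_mul_qParam.norm.pos_mul_atTop (by simp) h1).congr fun τ => ?_
  rw [← norm_mul, mul_assoc, mul_inv_cancel₀ (qParam_ne_zero τ), mul_one]

lemma exists_eval_ne_zero (hT : HasSimplePoleAtInfty Γ G T) {Q : ℂ[X]} (hQ : Q ≠ 0) :
    ∃ τ, Q.eval (T τ) ≠ 0 := by
  obtain ⟨B, hB⟩ := (Q.roots.toFinset.finite_toSet.image norm).bddAbove
  obtain ⟨τ, hτ⟩ := (hT.tendsto_norm.eventually_gt_atTop B).exists
  refine ⟨τ, fun h => ?_⟩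
  have := hB ⟨T τ, by simpa [hQ] using h, rfl⟩
  linarith

lemma exists_isBigO_exp_comp (hT : HasSimplePoleAtInfty Γ G T) (g : SL(2, ℤ)) :
    ∃ C : ℝ, (fun τ : ℍ => T (g • τ)) =O[atImInfty] fun τ : ℍ => Real.exp (C * τ.im) := by
  rcases hT.cusps g with ⟨γ, hγ, r, hr, t, h⟩ | h
  · refine ⟨2 * Real.pi * r, ?_⟩
    have := IsBigO.comp_tendsto hT.isBigO_exp (tendsto_atImInfty_of_eq_mul_add hr h)
    refine (this.congr_left fun τ => hT.invariant γ hγ _).congr_right fun τ => ?_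
    have := congrArg Complex.im (h τ)
    simp only [coe_im, Complex.add_im, Complex.mul_im, Complex.ofReal_re, Complex.ofReal_im,
      zero_mul, add_zero] at this
    simp only [Function.comp_apply, this]
    ring_nf
  · exact ⟨0, by simpa using isBigO_one_iff_isBoundedAtImInfty.mp h⟩

lemma exists_isBigO_exp_eval (hT : HasSimplePoleAtInfty Γ G T) (g : SL(2, ℤ)) (Q : ℂ[X]) :
    ∃ C : ℝ, (fun τ : ℍ => Q.eval (T (g • τ))) =O[atImInfty]
      fun τ : ℍ => Real.exp (C * τ.im) := by
  obtain ⟨C, hC⟩ := hT.exists_isBigO_exp_comp g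
  refine ⟨Q.natDegree * max C 0, ?_⟩
  simp only [eval_eq_sum_range]
  refine IsBigO.fun_sum fun i hi => IsBigO.const_mul_left ?_ _
  refine (hC.pow i).trans (IsBigO.of_bound 1 ?_)
  filter_upwards with τ
  rw [one_mul, ← Real.exp_nat_mul, Real.norm_eq_abs, Real.abs_exp, Real.norm_eq_abs, Real.abs_exp,
    Real.exp_le_exp, ← mul_assoc]
  refine mul_le_mul_of_nonneg_right ?_ τ.im_pos.le
  have hi' : (i : ℝ) ≤ Q.natDegree := by exact_mod_cast Finset.mem_range_succ_iff.mp hi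
  calc (i : ℝ) * C ≤ i * max C 0 := by gcongr; exact le_max_left _ _
    _ ≤ Q.natDegree * max C 0 := by gcongr

/-- A holomorphic invariant function of exponential growth at all cusps becomes bounded, at the
cusps where `T` is bounded, after multiplication by a polynomial in `T` that vanishes at the
values of `T` at these cusps. -/
lemma exists_polynomial_mul_bounded (hT : HasSimplePoleAtInfty Γ G T) [G.FiniteIndex]
    {h : ℍ → ℂ} (inv : ∀ γ ∈ Γ, ∀ τ : ℍ, h (γ • τ) = h τ)
    (growth : ∀ g : SL(2, ℤ), ∃ C : ℝ,
      (fun τ : ℍ => h (g • τ)) =O[atImInfty] fun τ : ℍ => Real.exp (C * τ.im)) :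
    ∃ Q : ℂ[X], Q ≠ 0 ∧ ∀ g : SL(2, ℤ), (IsBoundedAtImInfty fun τ => T (g • τ)) →
      IsBoundedAtImInfty fun τ => Q.eval (T (g • τ)) * h (g • τ) := by
  classical
  obtain ⟨R, hR⟩ := exists_finset_coset_representatives G
  have hbd : ∀ Q : ℂ[X], ∀ g : SL(2, ℤ), (IsBoundedAtImInfty fun τ => T (g • τ)) →
      IsBoundedAtImInfty fun τ => Q.eval (T (g • τ)) := by
    intro Q g hg
    simp only [eval_eq_sum_range]
    refine IsBigO.fun_sum fun i _ => IsBigO.const_mul_left ?_ _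
    exact (IsBigO.pow hg i).congr_right fun _ => one_pow i
  have key : ∀ r : SL(2, ℤ), ∃ Q : ℂ[X], Q ≠ 0 ∧ ((IsBoundedAtImInfty fun τ => T (r • τ)) →
      IsBoundedAtImInfty fun τ => Q.eval (T (r • τ)) * h (r • τ)) := by
    intro r
    by_cases hr : IsBoundedAtImInfty fun τ => T (r • τ)
    · obtain ⟨v, ε, hε, hv⟩ := exists_isBigO_sub_exp hT.holomorphic
        (hT.invariant_of_mem hT.invariant) r hr
      obtain ⟨C, hC⟩ := growth r
      obtain ⟨n, hn⟩ := exists_nat_ge (C / ε)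
      refine ⟨(X - Polynomial.C v) ^ n, pow_ne_zero _ (X_sub_C_ne_zero _), fun _ => ?_⟩
      refine ((hv.pow n).mul hC |>.congr_left fun τ => by simp).trans (IsBigO.of_bound 1 ?_)
      filter_upwards with τ
      rw [← Real.exp_nat_mul, ← Real.exp_add]
      simp only [Real.norm_eq_abs, Real.abs_exp, Pi.one_apply, norm_one, mul_one,
        Real.exp_le_one_iff]
      rw [div_le_iff₀ hε] at hn
      nlinarith [τ.im_pos]
    · exact ⟨1, one_ne_zero, fun h => absurd h hr⟩
  choose Q hQ0 hQ using key
  refine ⟨∏ r ∈ R, Q r, Finset.prod_ne_zero_iff.mpr fun r _ => hQ0 r, fun g hg => ?_⟩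
  obtain ⟨r, hr, γ, hγ, rfl⟩ := hR g
  have eT : ∀ τ : ℍ, T ((γ * r) • τ) = T (r • τ) := fun τ => by
    rw [mul_smul]; exact hT.invariant_of_mem hT.invariant γ hγ _
  have eh : ∀ τ : ℍ, h ((γ * r) • τ) = h (r • τ) := fun τ => by
    rw [mul_smul]; exact hT.invariant_of_mem inv γ hγ _
  simp only [eT, eh] at hg ⊢
  have := (hbd (∏ r ∈ R.erase r, Q r) r hg).mul (hQ r hg)
  refine this.congr_left fun z => ?_
  rw [← Finset.mul_prod_erase _ _ hr, eval_mul]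
  simp only [Pi.mul_apply]
  ring

lemma isModularFunction (hT : HasSimplePoleAtInfty Γ G T) : IsModularFunction Γ T where
  meromorphic τ := (MDifferentiable.analyticAt_comp_ofComplex hT.holomorphic τ).meromorphicAt
  invariant := hT.invariant
  cusps := hT.exists_isBigO_exp_comp

/-- A function with a single simple pole on the compactified quotient generates the field of modular
functions. -/
theorem isPrincipalModulus (hT : HasSimplePoleAtInfty Γ G T) [G.FiniteIndex] :
    IsPrincipalModulus Γ T where
  isModularFunction := hT.isModularFunction
  holomorphic := MDifferentiable.analyticAt_comp_ofComplex hT.holomorphic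
  generates f hf := by
    obtain ⟨Q₁, hQ₁, h, hol, hlim⟩ := hT.exists_polynomial_mul_holomorphic hf
    have inv : ∀ γ ∈ Γ, ∀ τ : ℍ, h (γ • τ) = h τ := fun γ hγ τ =>
      smul_eq_of_tendsto hlim (fun z => by rw [hT.invariant γ hγ, hf.invariant γ hγ]) τ
    have growth : ∀ g : SL(2, ℤ), ∃ C : ℝ,
        (fun τ : ℍ => h (g • τ)) =O[atImInfty] fun τ : ℍ => Real.exp (C * τ.im) := by
      intro g
      obtain ⟨C, hC⟩ := hT.exists_isBigO_exp_eval g Q₁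
      obtain ⟨D, hD⟩ := hf.cusps g
      refine ⟨C + D, isBigO_exp_of_tendsto (g := (g : SL(2, ℝ))) hlim ?_⟩
      refine (hC.mul hD).congr_right fun τ => ?_
      rw [← Real.exp_add, add_mul]
    obtain ⟨Q₂, hQ₂, hbd⟩ := hT.exists_polynomial_mul_bounded inv growth
    obtain ⟨C, hC⟩ := growth 1
    obtain ⟨D, hD⟩ := hT.exists_isBigO_exp_eval 1 Q₂
    obtain ⟨n, hn⟩ := exists_nat_ge ((D + C) / (2 * Real.pi))
    obtain ⟨P, hP⟩ := hT.exists_polynomial n (H := fun τ => Q₂.eval (T τ) * h τ)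
      ((Q₂.differentiable.mdifferentiable.comp hT.holomorphic).mul hol)
      (fun γ hγ τ => by rw [hT.invariant γ hγ, inv γ hγ]) hbd (by
        refine ((hD.mul hC).congr_left fun τ => by simp).trans (IsBigO.of_bound 1 ?_)
        filter_upwards with τ
        rw [← Real.exp_add]
        simp only [Real.norm_eq_abs, Real.abs_exp, one_mul, Real.exp_le_exp]
        rw [div_le_iff₀ (by positivity)] at hn
        nlinarith [τ.im_pos])
    refine ⟨P, Q₂ * Q₁, hT.exists_eval_ne_zero (mul_ne_zero hQ₂ hQ₁), fun τ hτ => ?_⟩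
    have hcont : ContinuousAt (fun z => Q₁.eval (T z) * f z) τ :=
      (Q₁.continuous.comp hT.holomorphic.continuous).continuousAt.mul
        (continuousAt_of_continuousAt_comp_ofComplex hτ.continuousAt)
    rw [← hP, eval_mul, mul_assoc]
    congr 1
    exact tendsto_nhds_unique (hcont.tendsto.mono_left nhdsWithin_le_nhds) (hlim τ)

end HasSimplePoleAtInfty

end Poles

/-! ### Uniqueness of principal moduli -/

section Uniqueness

open UpperHalfPlane MatrixGroups Matrix.SpecialLinearGroup Filter Asymptotics Topology Manifold
open Polynomial

variable {Γ : Subgroup SL(2, ℝ)} {G : Subgroup SL(2, ℤ)} {T : ℍ → ℂ}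

lemma Polynomial.eventually_cobounded_eval_ne_zero {Q : ℂ[X]} (hQ : Q ≠ 0) :
    ∀ᶠ w in Bornology.cobounded ℂ, Q.eval w ≠ 0 := by
  have : ((Q.roots.toFinset : Set ℂ))ᶜ ∈ Bornology.cobounded ℂ :=
    Bornology.isBounded_def.mp Q.roots.toFinset.finite_toSet.isBounded
  filter_upwards [this] with w hw h
  exact hw (by simpa [hQ] using h)

/-- Let `T'` be another principal modulus that is close to `T` at `i∞`. Then `T = r(T') / s(T')`,
where `deg s < deg r` as both functions have a pole at `i∞`. So `T` is unbounded wherever `T'` is,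
and the difference `T' - T` has no poles. -/
theorem HasSimplePoleAtInfty.eq_of_isPrincipalModulus (hT : HasSimplePoleAtInfty Γ G T)
    [G.FiniteIndex] {T' : ℍ → ℂ} (hT' : IsPrincipalModulus Γ T')
    (hlim : Tendsto (fun τ => T' τ - T τ) atImInfty (𝓝 0)) : T' = T := by
  have hol' : MDiff T' := fun τ =>
    UpperHalfPlane.mdifferentiableAt_iff.mpr (hT'.holomorphic τ).differentiableAt
  obtain ⟨r, s, ⟨τ₀, hτ₀⟩, hrs⟩ := hT'.generates T hT.isModularFunction
  replace hrs : ∀ τ, s.eval (T' τ) * T τ = r.eval (T' τ) := fun τ =>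
    hrs τ (MDifferentiable.analyticAt_comp_ofComplex hT.holomorphic τ)
  have hs : s ≠ 0 := by rintro rfl; simp at hτ₀
  have hT'inf : Tendsto T' atImInfty (Bornology.cobounded ℂ) := by
    rw [← tendsto_norm_atTop_iff_cobounded]
    have h1 := hlim.norm
    rw [norm_zero] at h1
    have h2 := hT.tendsto_norm.atTop_add h1.neg
    refine tendsto_atTop_mono (fun τ => ?_) h2
    have := norm_sub_norm_le (T τ) (T τ - T' τ)
    rw [norm_sub_rev, sub_sub_cancel] at this
    linarith
  have hdeg : s.degree < r.degree := by
    by_contra! h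
    obtain ⟨K, hK⟩ := isBigO_iff.mp (isBigO_cobounded_of_degree_le h)
    obtain ⟨τ, h1, h2, h3⟩ := ((hT'inf.eventually hK).and ((hT'inf.eventually
      (Polynomial.eventually_cobounded_eval_ne_zero hs)).and
      (hT.tendsto_norm.eventually_gt_atTop K))).exists
    rw [← hrs, norm_mul, mul_comm] at h1
    exact absurd (le_of_mul_le_mul_right h1 (norm_pos_iff.mpr h2)) (not_le.mpr h3)
  have hr : r ≠ 0 := ne_zero_of_degree_gt hdeg
  obtain ⟨c, hc⟩ := hT.exists_eq_const (H := fun τ => T' τ - T τ) (hol'.sub hT.holomorphic)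
    (fun γ hγ τ => by rw [hT'.isModularFunction.invariant γ hγ, hT.invariant γ hγ])
    (fun g hg => by
      refine IsBigO.sub ?_ hg
      obtain ⟨M, A, hM⟩ := isBoundedAtImInfty_iff.mp hg
      have hpos : 0 < 1 / (|M| + 1) := by positivity
      have hev := ((isLittleO_cobounded_of_degree_lt hdeg).def hpos).and
        (Polynomial.eventually_cobounded_eval_ne_zero hr)
      obtain ⟨B, -, hB⟩ := hasBasis_cobounded_norm.eventually_iff.mp hev
      refine isBoundedAtImInfty_iff.mpr ⟨B, A, fun τ hτ => ?_⟩
      by_contra! hlt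
      obtain ⟨h1, h2⟩ := hB (show B ≤ ‖T' (g • τ)‖ from hlt.le)
      have h3 := norm_pos_iff.mpr h2
      have h4 : ‖r.eval (T' (g • τ))‖ ≤ ‖s.eval (T' (g • τ))‖ * |M| := by
        rw [← hrs, norm_mul]
        exact mul_le_mul_of_nonneg_left ((hM τ hτ).trans (le_abs_self M)) (norm_nonneg _)
      rw [div_mul_eq_mul_div, one_mul, le_div_iff₀ (by positivity)] at h1
      have h5 : 0 < ‖s.eval (T' (g • τ))‖ := by
        by_contra! h
        nlinarith [abs_nonneg M]
      nlinarith)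
    (hlim.isBigO_one ℝ)
  have hc0 : c = 0 := tendsto_nhds_unique (tendsto_const_nhds.congr fun τ => (hc τ).symm) hlim
  ext τ
  exact sub_eq_zero.mp ((hc τ).trans hc0)

end Uniqueness

/-! ### Eta quotients and Atkin--Lehner involutions -/

section AtkinLehner

open Complex hiding eta
open ModularForm UpperHalfPlane MatrixGroups

variable {N : ℕ} {k : ℕ → ℤ}

lemma eta_pow_moebius {a b c d : ℤ} (hdet : a * d - b * c = 1) {z : ℂ} (hz : 0 < z.im) :
    eta ((a * z + b) / (c * z + d)) ^ 24 = (c * z + d) ^ 12 * eta z ^ 24 := by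
  let γ : SL(2, ℤ) := ⟨!![a, b; c, d], by rw [Matrix.det_fin_two_of]; exact hdet⟩
  have h := SlashInvariantForm.slash_action_eqn' CuspForm.discriminant
    (γ := Matrix.SpecialLinearGroup.mapGL ℝ γ) (MonoidHom.mem_range.mpr ⟨γ, rfl⟩) ⟨z, hz⟩
  have hc : ((Matrix.SpecialLinearGroup.mapGL ℝ γ • (⟨z, hz⟩ : ℍ) : ℍ) : ℂ) =
      (a * z + b) / (c * z + d) := by
    refine (UpperHalfPlane.coe_specialLinearGroup_apply γ ⟨z, hz⟩).trans ?_
    simp [γ]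
  simp only [CuspForm.coe_discriminant, ModularForm.discriminant] at h
  rw [hc] at h
  have h10 : (Matrix.SpecialLinearGroup.mapGL ℝ γ : Matrix (Fin 2) (Fin 2) ℝ) 1 0 = c := rfl
  have h11 : (Matrix.SpecialLinearGroup.mapGL ℝ γ : Matrix (Fin 2) (Fin 2) ℝ) 1 1 = d := rfl
  rw [h10, h11] at h
  exact_mod_cast h

/-- The action of the Atkin--Lehner involution for `e` on the divisors of `N`. -/
def atkinLehnerStar (e n : ℕ) : ℕ := n * e / Nat.gcd n e ^ 2

/-- The exponents `k` are symmetric under the Atkin--Lehner involution for `e` of the divisors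
of `N`. -/
def IsAtkinLehnerInvariant (N : ℕ) (k : ℕ → ℤ) (e : ℕ) : Prop :=
  ∀ n ∈ N.divisors, atkinLehnerStar e n ∈ N.divisors ∧
    atkinLehnerStar e (atkinLehnerStar e n) = n ∧ k (atkinLehnerStar e n) = k n

instance (e : ℕ) : Decidable (IsAtkinLehnerInvariant N k e) :=
  inferInstanceAs (Decidable (∀ n ∈ N.divisors, _))

/-- For `W = (a e, b; c N, d e)` and `g = (n, e)`, the matrix `(n, 0; 0, 1) W` is the product of
`(a g, n b / g; c N / (n e / g), d e / g)`, which has determinant `1`, and `(n e / g, 0; 0, g)`. -/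
lemma exists_moebius_factorization {e : ℕ} (hN : N ≠ 0) (he : e ∣ N) {a b c d : ℤ}
    (hdet : a * d * e - b * c * (N / e : ℕ) = 1) {n : ℕ} (hn : n ∈ N.divisors) (z : ℂ) :
    ∃ A B C D : ℤ, A * D - B * C = 1 ∧
      (C * (atkinLehnerStar e n * z) + D : ℂ) = (c * N * z + d * e) / n.gcd e ∧
      (n * ((a * e * z + b) / (c * N * z + d * e)) : ℂ) =
        (A * (atkinLehnerStar e n * z) + B) / (C * (atkinLehnerStar e n * z) + D) := by
  have hn' := Nat.dvd_of_mem_divisors hn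
  have he0 : 0 < e := Nat.pos_of_dvd_of_pos he (Nat.pos_of_ne_zero hN)
  have hg : 0 < n.gcd e := Nat.gcd_pos_of_pos_right _ he0
  obtain ⟨n1, e1, hco, hn1, he1⟩ := Nat.exists_coprime n e
  set g := n.gcd e with hgdef
  have hl : n1 * e1 * g ∣ N := by
    have := Nat.lcm_dvd hn' he
    rwa [hn1, he1, Nat.lcm_mul_right, hco.lcm_eq_mul] at this
  obtain ⟨M, hM⟩ := hl
  have hstar : atkinLehnerStar e n = n1 * e1 := by
    rw [atkinLehnerStar, ← hgdef, hn1, he1]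
    exact Nat.div_eq_of_eq_mul_left (by positivity) (by ring)
  have hNe : N / e = n1 * M := Nat.div_eq_of_eq_mul_left he0 (by rw [hM, he1]; ring)
  have hgC : (g : ℂ) ≠ 0 := by exact_mod_cast hg.ne'
  have hnC : (n : ℂ) = n1 * g := by exact_mod_cast hn1
  have heC : (e : ℂ) = e1 * g := by exact_mod_cast he1
  have hMC : (N : ℂ) = n1 * e1 * g * M := by exact_mod_cast hM
  have hden : ((c * M : ℤ) * (((n1 * e1 : ℕ) : ℂ) * z) + (d * e1 : ℤ) : ℂ) =
      (c * N * z + d * e) / g := by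
    rw [heC, hMC, eq_div_iff hgC]
    push_cast
    ring
  rw [hNe] at hdet
  push_cast at hdet
  rw [he1] at hdet
  push_cast at hdet
  refine ⟨a * g, n1 * b, c * M, d * e1, by linear_combination hdet, ?_, ?_⟩
  · rw [hstar]; exact hden
  · rw [hstar, hden, hnC, div_div_eq_mul_div, ← mul_div_assoc]
    congr 1
    rw [heC]
    push_cast
    ring

lemma denominator_ne_zero {e : ℕ} (hN : N ≠ 0) (he : e ∣ N) {a b c d : ℤ}
    (hdet : a * d * e - b * c * (N / e : ℕ) = 1) {z : ℂ} (hz : 0 < z.im) :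
    (c * N * z + d * e : ℂ) ≠ 0 := by
  have he0 : e ≠ 0 := fun h => hN (zero_dvd_iff.mp (h ▸ he))
  have := intCast_mul_add_ne_zero (c := c * N) (d := d * e) (by
    by_contra! h
    have h1 : c = 0 := by
      simpa [hN] using h.1
    have h2 : d = 0 := by simpa [he0] using h.2
    simp [h1, h2] at hdet) hz
  exact_mod_cast this

lemma atkinLehner_im_pos {e : ℕ} (hN : N ≠ 0) (he : e ∣ N) {a b c d : ℤ}
    (hdet : a * d * e - b * c * (N / e : ℕ) = 1) {z : ℂ} (hz : 0 < z.im) :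
    0 < ((a * e * z + b) / (c * N * z + d * e) : ℂ).im := by
  have he0 : 0 < e := Nat.pos_of_dvd_of_pos he (Nat.pos_of_ne_zero hN)
  have hden := denominator_ne_zero hN he hdet hz
  have hns : 0 < Complex.normSq (c * N * z + d * e : ℂ) := Complex.normSq_pos.mpr hden
  have hdetR : (a * d * e - b * c * (N / e : ℕ) : ℝ) = 1 := by
    simpa only [Int.cast_sub, Int.cast_mul, Int.cast_natCast, Int.cast_one] using
      congrArg (Int.cast : ℤ → ℝ) hdet
  have hNe : ((N / e : ℕ) : ℝ) * e = N := by exact_mod_cast Nat.div_mul_cancel he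
  rw [Complex.div_im, ← sub_div]
  refine div_pos ?_ hns
  simp only [Complex.add_im, Complex.mul_im, Complex.intCast_re, Complex.intCast_im,
    Complex.natCast_re, Complex.natCast_im, Complex.add_re, Complex.mul_re]
  have : (0 : ℝ) < e * z.im := mul_pos (by exact_mod_cast he0) hz
  rw [← hNe]
  refine lt_of_lt_of_eq this ?_
  linear_combination (-(e : ℝ) * z.im) * hdetR

lemma zpow_pow_comm {K : Type*} [Field K] (x : K) (m : ℤ) (n : ℕ) : (x ^ m) ^ n = (x ^ n) ^ m := by
  rw [← zpow_natCast, ← zpow_natCast, ← zpow_mul, ← zpow_mul, mul_comm]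

lemma zpow_pow_eq_of_pow_eq {K : Type*} [Field K] {x y u g : K} {m n : ℕ}
    (h : x ^ n = (u / g) ^ m * y ^ n) (j : ℤ) :
    (x ^ j) ^ n = (u ^ m) ^ j * (g ^ m) ^ (-j) * (y ^ j) ^ n := by
  rw [zpow_pow_comm, h, zpow_pow_comm, mul_zpow, div_pow, div_zpow, zpow_neg, div_eq_mul_inv]

/-- The law of `η ^ 24` shows that an Atkin--Lehner element multiplies the 24th power of the eta
quotient by a constant. -/
lemma etaQuot_atkinLehner_pow {e : ℕ} (hN : N ≠ 0) (he : e ∣ N)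
    (h0 : ∑ n ∈ N.divisors, k n = 0) (hk : IsAtkinLehnerInvariant N k e) {a b c d : ℤ}
    (hdet : a * d * e - b * c * (N / e : ℕ) = 1) {z : ℂ} (hz : 0 < z.im) :
    etaQuot N k ((a * e * z + b) / (c * N * z + d * e)) ^ 24 =
      (∏ n ∈ N.divisors, ((n.gcd e : ℂ) ^ 12) ^ (-k n)) * etaQuot N k z ^ 24 := by
  have hX := denominator_ne_zero hN he hdet hz
  have hfac : ∀ n ∈ N.divisors,
      (eta (n * ((a * e * z + b) / (c * N * z + d * e))) ^ k n) ^ 24 =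
      ((c * N * z + d * e : ℂ) ^ 12) ^ k n * ((n.gcd e : ℂ) ^ 12) ^ (-k n) *
        (eta (atkinLehnerStar e n * z) ^ k (atkinLehnerStar e n)) ^ 24 := by
    intro n hn
    obtain ⟨A, B, C, D, h1, h2, h3⟩ := exists_moebius_factorization hN he hdet hn z
    have h4 := eta_pow_moebius h1 (natCast_mul_im_pos (hk n hn).1 hz)
    rw [← h3, h2] at h4
    rw [(hk n hn).2.2]
    exact zpow_pow_eq_of_pow_eq h4 _
  have hstar : ∏ n ∈ N.divisors, (eta (atkinLehnerStar e n * z) ^ k (atkinLehnerStar e n)) ^ 24 =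
      ∏ n ∈ N.divisors, (eta (n * z) ^ k n) ^ 24 :=
    Finset.prod_nbij' (atkinLehnerStar e) (atkinLehnerStar e) (fun n hn => (hk n hn).1)
      (fun n hn => (hk n hn).1) (fun n hn => (hk n hn).2.1) (fun n hn => (hk n hn).2.1)
      (fun _ _ => rfl)
  have hL := Finset.prod_pow N.divisors 24
    fun n : ℕ => eta (n * ((a * e * z + b) / (c * N * z + d * e))) ^ k n
  have hR := Finset.prod_pow N.divisors 24 fun n : ℕ => eta (n * z) ^ k n
  rw [Finset.prod_congr rfl hfac, Finset.prod_mul_distrib, Finset.prod_mul_distrib,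
    prod_zpow_eq_zpow_sum₀ _ (pow_ne_zero _ hX), h0, zpow_zero, one_mul, hstar, hR] at hL
  exact hL.symm

lemma differentiableOn_etaQuot : DifferentiableOn ℂ (etaQuot N k) {z | 0 < z.im} := by
  intro z hz
  refine DifferentiableAt.differentiableWithinAt ?_
  unfold etaQuot
  refine DifferentiableAt.fun_finsetProd fun n hn => ?_
  have h1 : DifferentiableAt ℂ (fun z : ℂ => eta (n * z)) z :=
    (differentiableAt_eta_of_mem_upperHalfPlaneSet (natCast_mul_im_pos hn hz)).comp z (by fun_prop)
  exact h1.zpow (Or.inl (eta_natCast_mul_ne_zero hn hz))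

/-- An Atkin--Lehner element multiplies the eta quotient by a constant, by continuity as the upper
half-plane is connected. -/
lemma exists_etaQuot_atkinLehner_eq {e : ℕ} (hN : N ≠ 0) (he : e ∣ N)
    (h0 : ∑ n ∈ N.divisors, k n = 0) (hk : IsAtkinLehnerInvariant N k e) {a b c d : ℤ}
    (hdet : a * d * e - b * c * (N / e : ℕ) = 1) :
    ∃ w : ℂ, ∀ z : ℂ, 0 < z.im →
      etaQuot N k ((a * e * z + b) / (c * N * z + d * e)) = w * etaQuot N k z := by
  set K : ℂ := ∏ n ∈ N.divisors, ((n.gcd e : ℂ) ^ 12) ^ (-k n)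
  set φ : ℂ → ℂ := fun z => etaQuot N k ((a * e * z + b) / (c * N * z + d * e)) / etaQuot N k z
  have hconn : IsPreconnected {z : ℂ | 0 < z.im} :=
    (convex_halfSpace_im_gt 0).isPreconnected
  have hcont : ContinuousOn φ {z : ℂ | 0 < z.im} := by
    refine ContinuousOn.div ?_ differentiableOn_etaQuot.continuousOn fun z hz => etaQuot_ne_zero hz
    refine differentiableOn_etaQuot.continuousOn.comp ?_ fun z hz =>
      atkinLehner_im_pos hN he hdet hz
    exact ContinuousOn.div (by fun_prop) (by fun_prop) fun z hz => denominator_ne_zero hN he hdet hz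
  have hfin : {w : ℂ | w ^ 24 = K}.Finite := by
    refine (Polynomial.nthRoots 24 K).toFinset.finite_toSet.subset fun w hw => ?_
    simpa [Polynomial.mem_nthRoots] using hw
  have hmaps : Set.MapsTo φ {z : ℂ | 0 < z.im} {w : ℂ | w ^ 24 = K} := by
    intro z hz
    simp only [φ, Set.mem_ofPred_eq, div_pow]
    rw [etaQuot_atkinLehner_pow hN he h0 hk hdet hz,
      mul_div_cancel_right₀ _ (pow_ne_zero _ (etaQuot_ne_zero hz))]
  have hI : (Complex.I : ℂ) ∈ {z : ℂ | 0 < z.im} := by simp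
  refine ⟨φ Complex.I, fun z hz => ?_⟩
  rw [← hconn.constant_of_mapsTo hfin.isDiscrete hcont hmaps hz hI,
    div_mul_cancel₀ _ (etaQuot_ne_zero hz)]

/-- If there is an Atkin--Lehner matrix of trace zero, the constant is `1`, as one sees at its fixed
point. -/
lemma etaQuot_atkinLehner_eq_of_elliptic {e : ℕ} (hN : N ≠ 0) (he : e ∣ N)
    (h0 : ∑ n ∈ N.divisors, k n = 0) (hk : IsAtkinLehnerInvariant N k e) {a b c : ℤ} (hc : 0 < c)
    (hdet : a * (-a) * e - b * c * (N / e : ℕ) = 1) {z : ℂ} (hz : 0 < z.im) :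
    etaQuot N k ((a * e * z + b) / (c * N * z + (-a : ℤ) * e)) = etaQuot N k z := by
  obtain ⟨w, hw⟩ := exists_etaQuot_atkinLehner_eq hN he h0 hk (d := -a) hdet
  have he0 : 0 < e := Nat.pos_of_dvd_of_pos he (Nat.pos_of_ne_zero hN)
  have hcN : (0 : ℝ) < c * N := by
    have : (0 : ℝ) < N := by exact_mod_cast Nat.pos_of_ne_zero hN
    have : (0 : ℝ) < c := by exact_mod_cast hc
    positivity
  set p : ℂ := (a * e + Real.sqrt e * Complex.I) / ((c * N : ℝ) : ℂ) with hp
  have hpim : 0 < p.im := by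
    rw [hp, Complex.div_ofReal_im]
    refine div_pos ?_ hcN
    have : (0 : ℝ) < Real.sqrt e := Real.sqrt_pos.mpr (by exact_mod_cast he0)
    simpa using this
  have hcNC : ((c * N : ℝ) : ℂ) ≠ 0 := by exact_mod_cast hcN.ne'
  have hpc : (c * N : ℂ) * p = a * e + Real.sqrt e * Complex.I := by
    rw [show (c * N : ℂ) = ((c * N : ℝ) : ℂ) by push_cast; rfl, hp, mul_div_cancel₀ _ hcNC]
  have hsq : ((Real.sqrt e : ℝ) : ℂ) * Real.sqrt e = e := by
    exact_mod_cast Real.mul_self_sqrt (Nat.cast_nonneg e)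
  have hfix : (a * e * p + b) / (c * N * p + (-a : ℤ) * e) = p := by
    rw [div_eq_iff (denominator_ne_zero hN he hdet hpim)]
    have hNe : ((N / e : ℕ) : ℂ) * e = N := by exact_mod_cast Nat.div_mul_cancel he
    have hdetC : (a * (-a) * e - b * c * (N / e : ℕ) : ℂ) = 1 := by
      simpa only [Int.cast_sub, Int.cast_mul, Int.cast_neg, Int.cast_natCast, Int.cast_one] using
        congrArg (Int.cast : ℤ → ℂ) hdet
    have hbc : (b * c * N : ℂ) = -(a * a * e * e) - e := by
      rw [← hNe]; linear_combination (-(e : ℂ)) * hdetC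
    refine mul_left_cancel₀ (show (c * N : ℂ) ≠ 0 by exact_mod_cast hcNC) ?_
    push_cast
    have hII : Complex.I * Complex.I = -1 := Complex.I_mul_I
    have : (c * N : ℂ) * (p * (c * N * p + -a * e)) =
        (c * N * p) * (c * N * p) - a * e * (c * N * p) := by
      ring
    rw [this, hpc]
    have : (c * N : ℂ) * (a * e * p + b) = a * e * (c * N * p) + b * c * N := by ring
    rw [this, hpc, hbc]
    linear_combination (-Complex.I * Complex.I) * hsq - e * hII
  have := hw p hpim
  rw [hfix] at this
  have hw1 : w = 1 := by
    have h := etaQuot_ne_zero (N := N) (k := k) hpim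
    exact mul_right_cancel₀ h (by rw [← this, one_mul])
  rw [hw z hz, hw1, one_mul]

end AtkinLehner

/-! ### Invariance under `Γ₀(N) + S` -/

section Gamma0Plus

open Complex hiding eta
open ModularForm UpperHalfPlane MatrixGroups NumberTheorySymbols

variable {N : ℕ} {k : ℕ → ℤ}

lemma coe_smul_of_eq_smul {e : ℕ} (he : e ≠ 0) {g : SL(2, ℝ)} {a b c d : ℝ}
    (hg : (g : Matrix (Fin 2) (Fin 2) ℝ) = (1 / Real.sqrt e) • !![a, b; c, d]) (τ : ℍ) :
    ((g • τ : ℍ) : ℂ) = (a * τ + b) / (c * τ + d) := by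
  have hs : ((Real.sqrt e : ℝ) : ℂ) ≠ 0 := by
    exact_mod_cast (Real.sqrt_pos.mpr (by exact_mod_cast Nat.pos_of_ne_zero he)).ne'
  rw [UpperHalfPlane.coe_specialLinearGroup_apply, hg]
  simp only [Matrix.smul_apply, Matrix.of_apply, Matrix.cons_val', Matrix.cons_val_zero,
    Matrix.cons_val_one, Matrix.cons_val_fin_one, smul_eq_mul, Algebra.algebraMap_self,
    RingHom.id_apply]
  rw [← mul_div_mul_left (a * τ + b : ℂ) (c * τ + d) (inv_ne_zero hs)]
  push_cast
  congr 1 <;> ring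

lemma exists_coe_smul_of_mem_atkinLehnerCoset {e : ℕ} (he : e ≠ 0) {g : SL(2, ℝ)}
    (hg : g ∈ atkinLehnerCoset N e) :
    ∃ a b c d : ℤ, a * d * e - b * c * (N / e : ℕ) = 1 ∧
      ∀ τ : ℍ, ((g • τ : ℍ) : ℂ) = (a * e * τ + b) / (c * N * τ + d * e) := by
  obtain ⟨a, b, c, d, hdet, hg⟩ := hg
  refine ⟨a, b, c, d, hdet, fun τ => ?_⟩
  rw [coe_smul_of_eq_smul he hg]
  push_cast
  rfl

lemma exists_mem_atkinLehnerCoset {e : ℕ} (he : e ≠ 0) (heN : e ∣ N) {a b c d : ℤ}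
    (hdet : a * d * e - b * c * (N / e : ℕ) = 1) :
    ∃ g ∈ atkinLehnerCoset N e, ∀ τ : ℍ,
      ((g • τ : ℍ) : ℂ) = (a * e * τ + b) / (c * N * τ + d * e) := by
  have he' : (0 : ℝ) < e := by exact_mod_cast Nat.pos_of_ne_zero he
  have hdetR : (a * d * e - b * c * (N / e : ℕ) : ℝ) = 1 := by
    simpa only [Int.cast_sub, Int.cast_mul, Int.cast_natCast, Int.cast_one] using
      congrArg (Int.cast : ℤ → ℝ) hdet
  have hNe : ((N / e : ℕ) : ℝ) * e = N := by exact_mod_cast Nat.div_mul_cancel heN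
  let g : SL(2, ℝ) := ⟨(1 / Real.sqrt e) • !![(a * e : ℝ), (b : ℝ); (c * N : ℝ), (d * e : ℝ)], by
    rw [Matrix.det_smul, Matrix.det_fin_two_of, Fintype.card_fin, div_pow, Real.sq_sqrt he'.le,
      ← hNe, one_pow, one_div, inv_mul_eq_div, div_eq_one_iff_eq he'.ne']
    linear_combination (e : ℝ) * hdetR⟩
  refine ⟨g, ⟨a, b, c, d, hdet, rfl⟩, fun τ => ?_⟩
  rw [coe_smul_of_eq_smul he (g := g) rfl]
  push_cast
  rfl

/-- The elements of `SL₂(ℝ)` that leave the eta quotient invariant. -/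
def etaQuotStabilizer (N : ℕ) (k : ℕ → ℤ) : Subgroup SL(2, ℝ) where
  carrier := {g | ∀ τ : ℍ, etaQuot N k (g • τ : ℍ) = etaQuot N k τ}
  one_mem' τ := by rw [one_smul]
  mul_mem' {x y} hx hy τ := by rw [mul_smul, hx, hy]
  inv_mem' {x} hx τ := by rw [← hx, smul_inv_smul]

lemma mem_etaQuotStabilizer_of_mem_atkinLehnerCoset_one (h0 : ∑ n ∈ N.divisors, k n = 0)
    (h1 : (24 : ℤ) ∣ ∑ n ∈ N.divisors, n * k n)
    (h2 : (24 : ℤ) ∣ ∑ n ∈ N.divisors, (N / n : ℕ) * k n)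
    (h3 : IsSquare (∏ n ∈ N.divisors, n ^ (k n).natAbs)) {g : SL(2, ℝ)}
    (hg : g ∈ atkinLehnerCoset N 1) : g ∈ etaQuotStabilizer N k := by
  obtain ⟨a, b, c, d, hdet, hg⟩ := exists_coe_smul_of_mem_atkinLehnerCoset one_ne_zero hg
  intro τ
  rw [hg]
  have hdet' : a * d - b * (c * N) = 1 := by simpa [mul_assoc] using hdet
  simpa using etaQuot_moebius h0 h1 h2 h3 hdet' τ.im_pos

/-- Invariance under one element of each Atkin--Lehner coset suffices, since two elements of the
same coset differ by an element of `Γ₀(N)`. -/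
lemma gamma0Plus_le_etaQuotStabilizer [NeZero N] (S : ExactDivisorGroup N)
    (hone : ∀ g ∈ atkinLehnerCoset N 1, g ∈ etaQuotStabilizer N k)
    (hS : ∀ e ∈ S.carrier, ∃ w ∈ atkinLehnerCoset N e, w ∈ etaQuotStabilizer N k) :
    Gamma0Plus N S ≤ etaQuotStabilizer N k := by
  rintro x ⟨e, he, hx⟩
  obtain ⟨w, hw, hwk⟩ := hS e he
  have he' := (S.exact_dvd e he).1
  have h := atkinLehnerCoset_mul (NeZero.ne N) he' he' (atkinLehnerCoset_inv hw) hx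
  have he0 : 0 < e := Nat.pos_of_dvd_of_pos he' (Nat.pos_of_ne_zero (NeZero.ne N))
  rw [Nat.gcd_self, ← pow_two, Nat.div_self (by positivity)] at h
  have := (etaQuotStabilizer N k).mul_mem hwk (hone _ h)
  rwa [mul_inv_cancel_left] at this

lemma exists_mem_atkinLehnerCoset_of_elliptic [NeZero N] {e : ℕ} (he : e ∣ N)
    (h0 : ∑ n ∈ N.divisors, k n = 0) (hk : IsAtkinLehnerInvariant N k e) {a b c : ℤ} (hc : 0 < c)
    (hdet : a * (-a) * e - b * c * (N / e : ℕ) = 1) :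
    ∃ w ∈ atkinLehnerCoset N e, w ∈ etaQuotStabilizer N k := by
  have hN := NeZero.ne N
  have he0 : e ≠ 0 := fun h => hN (zero_dvd_iff.mp (h ▸ he))
  obtain ⟨w, hw, hw'⟩ := exists_mem_atkinLehnerCoset he0 he hdet
  refine ⟨w, hw, fun τ => ?_⟩
  rw [hw']
  exact etaQuot_atkinLehner_eq_of_elliptic hN he h0 hk hc hdet τ.im_pos

lemma exists_mem_atkinLehnerCoset_mul [NeZero N] {e f : ℕ} (he : e ∣ N) (hf : f ∣ N)
    (hwe : ∃ w ∈ atkinLehnerCoset N e, w ∈ etaQuotStabilizer N k)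
    (hwf : ∃ w ∈ atkinLehnerCoset N f, w ∈ etaQuotStabilizer N k) :
    ∃ w ∈ atkinLehnerCoset N (e * f / Nat.gcd e f ^ 2), w ∈ etaQuotStabilizer N k := by
  obtain ⟨x, hx, hx'⟩ := hwe
  obtain ⟨y, hy, hy'⟩ := hwf
  exact ⟨x * y, atkinLehnerCoset_mul (NeZero.ne N) he hf hx hy, Subgroup.mul_mem _ hx' hy'⟩

lemma eta_pow_four_moebius {a b : ℤ} {c : ℕ} {d : ℤ} (hc : Odd c) (hdet : a * d - b * c = 1)
    {z : ℂ} (hz : 0 < z.im) :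
    eta ((a * z + b) / (c * z + d)) ^ 4 =
      zeta24 ^ (4 * ((a + d) * c - b * d * (c ^ 2 - 1) - 3 * c + 3)) * -(c * z + d) ^ 2 *
        eta z ^ 4 := by
  have hw : (c * z + d : ℂ) ≠ 0 := by
    have := intCast_mul_add_ne_zero (c := c) (d := d)
      (Or.inl (by exact_mod_cast hc.pos.ne')) hz
    exact_mod_cast this
  have hJ : (J(d | c) : ℤ) ^ 4 = 1 := by
    have hcop : Int.gcd d c = 1 :=
      Int.isCoprime_iff_gcd_eq_one.mp ⟨a, -b, by linear_combination hdet⟩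
    rw [show 4 = 2 * 2 from rfl, pow_mul, jacobiSym.sq_one hcop, one_pow]
  have hIw : -Complex.I * (c * z + d) ≠ 0 := mul_ne_zero (neg_ne_zero.mpr Complex.I_ne_zero) hw
  have hsq : sqrt (-Complex.I * (c * z + d)) ^ 4 = -(c * z + d) ^ 2 := by
    rw [sqrt_eq_exp hIw, ← exp_nat_mul,
      show ((4 : ℕ) : ℂ) * (log (-Complex.I * (c * z + d)) / 2) =
        (2 : ℕ) * log (-Complex.I * (c * z + d)) by push_cast; ring, exp_nat_mul, exp_log hIw,
      mul_pow, neg_sq, Complex.I_sq]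
    ring
  rw [etaLaw c hc a b d hdet z hz, mul_pow, mul_pow, mul_pow, hsq, mul_comm (4 : ℤ), zpow_mul]
  have : ((J(d | c) : ℤ) : ℂ) ^ 4 = 1 := by exact_mod_cast hJ
  rw [this, one_mul]
  norm_cast

lemma eta_pow_four_eq {a b : ℤ} {c : ℕ} {d : ℤ} (hc : Odd c) (hdet : a * d - b * c = 1)
    {z u x : ℂ} (hz : 0 < z.im) (hx : c * z + d = x) (hu : u * x = a * z + b) {E : ℤ}
    (hE : 4 * ((a + d) * c - b * d * (c ^ 2 - 1) - 3 * c + 3) = E) :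
    eta u ^ 4 = zeta24 ^ E * -x ^ 2 * eta z ^ 4 := by
  have hw : x ≠ 0 := by
    have := intCast_mul_add_ne_zero (c := c) (d := d)
      (Or.inl (by exact_mod_cast hc.pos.ne')) hz
    rw [← hx]
    exact_mod_cast this
  have h := eta_pow_four_moebius hc hdet hz
  rwa [hx, hE, ← hu, mul_div_cancel_right₀ _ hw] at h

/-- The group `Γ₀(12) + 4` has no elliptic element in the coset of `4`; here the invariance under
`(4, 1; 12, 4)` follows from the transformation law of `η ^ 4`. -/
lemma exists_mem_atkinLehnerCoset_twelve (hk1 : k 1 = -4) (hk2 : k 2 = 4) (hk3 : k 3 = 4)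
    (hk4 : k 4 = -4) (hk6 : k 6 = -4) (hk12 : k 12 = 4) :
    ∃ w ∈ atkinLehnerCoset 12 4, w ∈ etaQuotStabilizer 12 k := by
  obtain ⟨w, hw, hw'⟩ := exists_mem_atkinLehnerCoset (N := 12) (e := 4) (by norm_num) (by norm_num)
    (a := 1) (b := 1) (c := 1) (d := 1) (by norm_num)
  refine ⟨w, hw, fun τ => ?_⟩
  rw [hw']
  have hX : (12 * τ + 4 : ℂ) ≠ 0 := by
    have := intCast_mul_add_ne_zero (c := 12) (d := 4) (Or.inl (by norm_num)) τ.im_pos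
    exact_mod_cast this
  have hdiv : Nat.divisors 12 = {1, 2, 3, 4, 6, 12} := by decide
  set w : ℂ := (4 * τ + 1) / (12 * τ + 4) with hwdef
  have hw0 : w * (12 * τ + 4) = 4 * τ + 1 := div_mul_cancel₀ _ hX
  have h1 : eta w ^ 4 = zeta24 ^ (-92 : ℤ) * -(12 * τ + 4) ^ 2 * eta (4 * τ) ^ 4 :=
    eta_pow_four_eq (a := 1) (b := 1) (c := 3) (d := 4) (by decide) (by norm_num)
      (by simp [τ.im_pos]) (by push_cast; ring)
      (by push_cast; linear_combination hw0) (by norm_num)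
  have h2 : eta (2 * w) ^ 4 = zeta24 ^ (-40 : ℤ) * -((12 * τ + 4) / 2) ^ 2 * eta (2 * τ) ^ 4 :=
    eta_pow_four_eq (a := 2) (b := 1) (c := 3) (d := 2) (by decide) (by norm_num)
      (by simp [τ.im_pos]) (by push_cast; ring)
      (by push_cast; linear_combination hw0) (by norm_num)
  have h3 : eta (3 * w) ^ 4 = zeta24 ^ (20 : ℤ) * -(12 * τ + 4) ^ 2 * eta (12 * τ) ^ 4 :=
    eta_pow_four_eq (a := 1) (b := 3) (c := 1) (d := 4) (by decide) (by norm_num)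
      (by simp [τ.im_pos]) (by push_cast; ring)
      (by push_cast; linear_combination (3 : ℂ) * hw0) (by norm_num)
  have h4 : eta (4 * w) ^ 4 = zeta24 ^ (4 : ℤ) * -((12 * τ + 4) / 4) ^ 2 * eta τ ^ 4 :=
    eta_pow_four_eq (a := 4) (b := 1) (c := 3) (d := 1) (by decide) (by norm_num)
      (by simp [τ.im_pos]) (by push_cast; ring)
      (by push_cast; linear_combination hw0) (by norm_num)
  have h6 : eta (6 * w) ^ 4 = zeta24 ^ (16 : ℤ) * -((12 * τ + 4) / 2) ^ 2 * eta (6 * τ) ^ 4 :=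
    eta_pow_four_eq (a := 2) (b := 3) (c := 1) (d := 2) (by decide) (by norm_num)
      (by simp [τ.im_pos]) (by push_cast; ring)
      (by push_cast; linear_combination (3 : ℂ) * hw0) (by norm_num)
  have h12 : eta (12 * w) ^ 4 = zeta24 ^ (20 : ℤ) * -((12 * τ + 4) / 4) ^ 2 * eta (3 * τ) ^ 4 :=
    eta_pow_four_eq (a := 4) (b := 3) (c := 1) (d := 1) (by decide) (by norm_num)
      (by simp [τ.im_pos]) (by push_cast; ring)
      (by push_cast; linear_combination (3 : ℂ) * hw0) (by norm_num)
  have z1 : zeta24 ^ (-40 : ℤ) * zeta24 ^ (20 : ℤ) * zeta24 ^ (20 : ℤ) = 1 := by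
    rw [← zpow_add₀ zeta24_ne_zero, ← zpow_add₀ zeta24_ne_zero]
    norm_num
  have z2 : zeta24 ^ (-92 : ℤ) * zeta24 ^ (4 : ℤ) * zeta24 ^ (16 : ℤ) = 1 := by
    rw [← zpow_add₀ zeta24_ne_zero, ← zpow_add₀ zeta24_ne_zero, ← zpow_zero zeta24]
    exact zeta24_zpow_eq (by norm_num)
  have hnum : eta (2 * w) ^ 4 * eta (3 * w) ^ 4 * eta (12 * w) ^ 4 = -(12 * τ + 4) ^ 6 / 64 *
      (eta (2 * τ) ^ 4 * eta (3 * τ) ^ 4 * eta (12 * τ) ^ 4) := by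
    rw [h2, h3, h12]
    linear_combination (-(12 * τ + 4) ^ 6 / 64 *
      (eta (2 * τ) ^ 4 * eta (3 * τ) ^ 4 * eta (12 * τ) ^ 4)) * z1
  have hden : eta w ^ 4 * eta (4 * w) ^ 4 * eta (6 * w) ^ 4 = -(12 * τ + 4) ^ 6 / 64 *
      (eta τ ^ 4 * eta (4 * τ) ^ 4 * eta (6 * τ) ^ 4) := by
    rw [h1, h4, h6]
    linear_combination (-(12 * τ + 4) ^ 6 / 64 *
      (eta τ ^ 4 * eta (4 * τ) ^ 4 * eta (6 * τ) ^ 4)) * z2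
  have hquot : ∀ z : ℂ, etaQuot 12 k z = (eta (2 * z) ^ 4 * eta (3 * z) ^ 4 * eta (12 * z) ^ 4) /
      (eta z ^ 4 * eta (4 * z) ^ 4 * eta (6 * z) ^ 4) := by
    intro z
    rw [etaQuot, hdiv]
    repeat rw [Finset.prod_insert (by decide)]
    rw [Finset.prod_singleton, hk1, hk2, hk3, hk4, hk6, hk12]
    simp only [zpow_neg, zpow_ofNat, Nat.cast_one, one_mul, Nat.cast_ofNat, div_eq_mul_inv, mul_inv]
    ring
  have hw'' : (((1 : ℤ) : ℂ) * ((4 : ℕ) : ℂ) * τ + ((1 : ℤ) : ℂ)) /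
      (((1 : ℤ) : ℂ) * ((12 : ℕ) : ℂ) * τ + ((1 : ℤ) : ℂ) * ((4 : ℕ) : ℂ)) = w := by
    rw [hwdef]
    norm_num
  rw [hw'', hquot, hquot, hnum, hden]
  exact mul_div_mul_left _ _ (div_ne_zero (neg_ne_zero.mpr (pow_ne_zero _ hX)) (by norm_num))

end Gamma0Plus

/-! ### Eta quotients at the cusps -/

section Cusps

open Complex hiding eta
open ModularForm UpperHalfPlane MatrixGroups Filter Asymptotics Topology

variable {N : ℕ} {k : ℕ → ℤ}

lemma discriminant_isTheta :
    discriminant =Θ[atImInfty] fun τ : ℍ => Real.exp (-2 * Real.pi * τ.im) := by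
  refine ⟨?_, exp_isBigO_discriminant⟩
  have h := (isBigO_refl (fun τ : ℍ => Function.Periodic.qParam 1 (τ : ℂ)) atImInfty).mul
    (tendsto_atImInfty_tprod_one_sub_eta_q_pow.isBigO_one ℂ)
  refine (h.congr_left fun τ => (discriminant_eq_q_prod τ).symm).trans
    (isBigO_of_le _ fun τ => le_of_eq ?_)
  rw [mul_one, Function.Periodic.norm_qParam, Real.norm_eq_abs, Real.abs_exp, div_one]
  rfl

lemma exists_smul_eq_mul_add (r t : ℝ) (hr : 0 < r) :
    ∃ φ : ℍ → ℍ, ∀ τ : ℍ, (φ τ : ℂ) = r * τ + t :=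
  ⟨fun τ => ⟨r * τ + t, by simpa using mul_pos hr τ.im_pos⟩, fun _ => rfl⟩

/-- The behaviour of `η (n τ)` at the cusp `a / c`: up to the automorphy factor, its 24th power
decays like `exp (-2 π (n, c) ^ 2 / n · im τ)`. This follows from the factorization of
`(n, 0; 0, 1) g` into an element of `SL₂(ℤ)` and an upper triangular matrix with diagonal `(n, c)`,
`n / (n, c)`. -/
lemma exists_eta_natCast_mul_smul (g : SL(2, ℤ)) {n : ℕ} (hn : 0 < n) :
    ∃ u : ℍ → ℂ, (u =Θ[atImInfty] fun τ : ℍ =>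
        Real.exp (-2 * Real.pi * ((Int.gcd n (g 1 0) : ℝ) ^ 2 / n * τ.im))) ∧
      ∀ τ : ℍ, eta (n * (g • τ : ℍ)) ^ 24 = (g 1 0 * τ + g 1 1) ^ 12 * u τ := by
  set a := g 0 0 with ha
  set b := g 0 1 with hb
  set c := g 1 0 with hc
  set d := g 1 1 with hd
  have hdet : a * d - b * c = 1 := by
    have := g.det_coe
    rwa [Matrix.det_fin_two] at this
  set α := Int.gcd n c with hα
  have hα0 : 0 < α := Int.gcd_pos_of_ne_zero_left _ (by exact_mod_cast hn.ne')
  obtain ⟨δ, hδ⟩ : α ∣ n := by exact_mod_cast Int.gcd_dvd_left (n : ℤ) c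
  obtain ⟨C, hC⟩ : (α : ℤ) ∣ c := Int.gcd_dvd_right (n : ℤ) c
  have hδ0 : 0 < δ := Nat.pos_of_mul_pos_left (hδ ▸ hn)
  have hαZ : (α : ℤ) ≠ 0 := by exact_mod_cast hα0.ne'
  have hcop : IsCoprime ((δ : ℤ) * a) C := by
    refine IsCoprime.mul_left ?_ ?_
    · have h1 := Int.gcd_eq_gcd_ab n c
      rw [← hα] at h1
      refine ⟨Int.gcdA n c, Int.gcdB n c, mul_left_cancel₀ hαZ ?_⟩
      rw [mul_one]
      conv_rhs => rw [h1]
      have h2 : (n : ℤ) = α * δ := by exact_mod_cast hδ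
      linear_combination (-Int.gcdA n c) * h2 - Int.gcdB n c * hC
    · exact ⟨d, -b * α, by rw [← hdet, hC]; ring⟩
  obtain ⟨D, B, hDB⟩ := hcop
  -- `(n a, n b; c, d) = (δ a, -B; C, D) (α, β; 0, δ)`
  set β : ℤ := D * n * b + B * d with hβ
  have hr : (0 : ℝ) < α / δ := by positivity
  obtain ⟨φ, hφ⟩ := exists_smul_eq_mul_add (α / δ) (β / δ) hr
  have hδC : (δ : ℂ) ≠ 0 := by exact_mod_cast hδ0.ne'
  have hnC : (n : ℂ) = α * δ := by exact_mod_cast hδ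
  have hcC : (c : ℂ) = α * C := by exact_mod_cast hC
  have hDBC : (D * (δ * a) + B * C : ℂ) = 1 := by exact_mod_cast hDB
  have hdetC : (a * d - b * c : ℂ) = 1 := by exact_mod_cast hdet
  have hden : ∀ τ : ℍ, (C * (φ τ : ℂ) + D : ℂ) = (c * τ + d) / δ := by
    intro τ
    rw [hφ, hβ, eq_div_iff hδC]
    push_cast
    rw [hcC] at hdetC ⊢
    rw [hnC]
    field_simp
    linear_combination (d : ℂ) * hDBC - D * δ * hdetC
  have hmoeb : ∀ τ : ℍ, (((δ * a : ℤ) : ℂ) * (φ τ : ℂ) + ((-B : ℤ) : ℂ)) / (C * (φ τ : ℂ) + D) =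
      n * (g • τ : ℍ) := by
    intro τ
    have hg : ((g • τ : ℍ) : ℂ) = (a * τ + b) / (c * τ + d) := by
      simpa using UpperHalfPlane.coe_specialLinearGroup_apply g τ
    have hcd : (c * τ + d : ℂ) ≠ 0 := intCast_mul_add_ne_zero (by
      by_contra! h
      rw [h.1, h.2] at hdet
      simp at hdet) τ.im_pos
    rw [hden, hg, hφ, hβ, div_div_eq_mul_div, ← mul_div_assoc]
    congr 1
    push_cast
    rw [hcC] at hdetC
    rw [hnC]
    field_simp
    linear_combination (α * b : ℂ) * hDBC + B * hdetC
  refine ⟨fun τ => ((δ : ℂ) ^ 12)⁻¹ * discriminant (φ τ), ?_, fun τ => ?_⟩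
  · refine (isTheta_const_mul_left (inv_ne_zero (pow_ne_zero _ hδC))).mpr ?_
    have h := discriminant_isTheta
    have htend := tendsto_atImInfty_of_eq_mul_add hr hφ
    have h2 : (discriminant ∘ φ) =Θ[atImInfty]
        ((fun τ : ℍ => Real.exp (-2 * Real.pi * τ.im)) ∘ φ) :=
      ⟨h.1.comp_tendsto htend, h.2.comp_tendsto htend⟩
    refine h2.trans_eventuallyEq (Eventually.of_forall fun τ => ?_)
    have him : (φ τ).im = α / δ * τ.im := by
      have := congrArg Complex.im (hφ τ)
      simpa using this
    simp only [Function.comp_apply, him]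
    congr 3
    have hnR : (n : ℝ) = α * δ := by exact_mod_cast hδ
    have hαR : (α : ℝ) ≠ 0 := by positivity
    rw [hnR]
    field_simp
  · have h := eta_pow_moebius (a := δ * a) (b := -B) (c := C) (d := D)
      (by rw [← hDB]; ring) (φ τ).im_pos
    have h2 : eta (φ τ : ℂ) ^ 24 = discriminant (φ τ) := rfl
    rw [hmoeb, hden, h2, div_pow] at h
    rw [h]
    ring

lemma isTheta_inv_etaQuot_pow (h0 : ∑ n ∈ N.divisors, k n = 0) (g : SL(2, ℤ)) :
    (fun τ : ℍ => (1 / etaQuot N k (g • τ : ℍ)) ^ 24) =Θ[atImInfty] fun τ : ℍ => Real.exp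
      (2 * Real.pi * (∑ n ∈ N.divisors, k n * ((Int.gcd n (g 1 0) : ℝ) ^ 2 / n)) * τ.im) := by
  choose u hu1 hu2 using fun n : N.divisors =>
    exists_eta_natCast_mul_smul g (Nat.pos_of_mem_divisors n.2)
  have h1 : ∀ τ : ℍ, (1 / etaQuot N k (g • τ : ℍ)) ^ 24 = ∏ n : N.divisors, u n τ ^ (-k n) := by
    intro τ
    have hcd : (g 1 0 * τ + g 1 1 : ℂ) ≠ 0 := intCast_mul_add_ne_zero (by
      by_contra! h
      have := g.det_coe
      rw [Matrix.det_fin_two, h.1, h.2] at this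
      simp at this) τ.im_pos
    have h2 : etaQuot N k (g • τ : ℍ) ^ 24 = ∏ n : N.divisors, u n τ ^ k n := by
      have hP := Finset.prod_pow N.divisors 24 fun n : ℕ => eta (n * (g • τ : ℍ)) ^ k n
      rw [etaQuot, ← hP, ← Finset.prod_coe_sort]
      have h3 : ∀ n : N.divisors, (eta ((n : ℕ) * (g • τ : ℍ)) ^ k n) ^ 24 =
          ((g 1 0 * τ + g 1 1 : ℂ) ^ 12) ^ k n * u n τ ^ k n := fun n => by
        rw [zpow_pow_comm, hu2, mul_zpow]
      rw [Finset.prod_congr rfl fun n _ => h3 n, Finset.prod_mul_distrib,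
        prod_zpow_eq_zpow_sum₀ _ (pow_ne_zero _ hcd), Finset.sum_coe_sort N.divisors k, h0,
        zpow_zero, one_mul]
    rw [div_pow, one_pow, h2, one_div, ← Finset.prod_inv_distrib]
    exact Finset.prod_congr rfl fun n _ => (zpow_neg _ _).symm
  have h4 : (fun τ : ℍ => ∏ n : N.divisors, u n τ ^ (-k n)) =Θ[atImInfty] fun τ : ℍ =>
      ∏ n : N.divisors, Real.exp
        (-2 * Real.pi * ((Int.gcd (n : ℕ) (g 1 0) : ℝ) ^ 2 / (n : ℕ) * τ.im)) ^ (-k n) :=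
    IsTheta.finsetProd fun n _ => (hu1 n).zpow _
  simp only [h1]
  refine h4.trans_eventuallyEq (Eventually.of_forall fun τ => ?_)
  simp only [← Real.rpow_intCast, ← Real.exp_mul]
  rw [← Real.exp_sum, Finset.sum_coe_sort N.divisors fun n => -2 * Real.pi *
    ((Int.gcd (n : ℕ) (g 1 0) : ℝ) ^ 2 / (n : ℕ) * τ.im) * ((-k n : ℤ) : ℝ), Finset.mul_sum,
    Finset.sum_mul]
  congr 1
  refine Finset.sum_congr rfl fun n _ => ?_
  push_cast
  ring

/-- The order of vanishing of the eta quotient at the cusps whose denominator `c` has `(c, N) = m`,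
up to a positive factor. -/
def cuspOrder (N : ℕ) (k : ℕ → ℤ) (m : ℕ) : ℤ :=
  ∑ n ∈ N.divisors, k n * (N / n : ℕ) * (Nat.gcd n m) ^ 2

lemma isBoundedAtImInfty_inv_etaQuot [NeZero N] (h0 : ∑ n ∈ N.divisors, k n = 0) (g : SL(2, ℤ))
    (hS : cuspOrder N k (Int.gcd (g 1 0) N) ≤ 0) :
    IsBoundedAtImInfty fun τ : ℍ => 1 / etaQuot N k (g • τ : ℍ) := by
  have hN : (0 : ℝ) < N := by exact_mod_cast Nat.pos_of_ne_zero (NeZero.ne N)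
  have hS' : (N : ℝ) * ∑ n ∈ N.divisors, k n * ((Int.gcd n (g 1 0) : ℝ) ^ 2 / n) =
      (cuspOrder N k (Int.gcd (g 1 0) N) : ℝ) := by
    rw [cuspOrder, Finset.mul_sum, Int.cast_sum]
    refine Finset.sum_congr rfl fun n hn => ?_
    have hn' := Nat.dvd_of_mem_divisors hn
    have hn0 : (n : ℝ) ≠ 0 := by exact_mod_cast (Nat.pos_of_mem_divisors hn).ne'
    have hgcd : Nat.gcd n (Int.gcd (g 1 0) N) = Int.gcd n (g 1 0) := by
      rw [← Int.gcd_natCast_natCast, Int.gcd_comm (g 1 0), Int.gcd_eq_natAbs (a := (N : ℤ)),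
        Int.gcd_natCast_natCast, ← Nat.gcd_assoc, Int.natAbs_natCast, Nat.gcd_eq_left hn',
        Int.gcd_eq_natAbs, Int.natAbs_natCast]
    rw [hgcd]
    have hNn : ((N / n : ℕ) : ℝ) * n = N := by exact_mod_cast Nat.div_mul_cancel hn'
    simp only [Int.cast_mul, Int.cast_natCast, Int.cast_pow]
    rw [← hNn]
    field_simp
  have hle : ∑ n ∈ N.divisors, (k n : ℝ) * ((Int.gcd n (g 1 0) : ℝ) ^ 2 / n) ≤ 0 := by
    by_contra! h
    have h1 : (cuspOrder N k (Int.gcd (g 1 0) N) : ℝ) ≤ 0 := by exact_mod_cast hS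
    rw [← hS'] at h1
    exact absurd h1 (not_le.mpr (mul_pos hN h))
  have h1 := (isTheta_inv_etaQuot_pow h0 g).1
  have h2 : (fun τ : ℍ => (1 / etaQuot N k (g • τ : ℍ)) ^ 24) =O[atImInfty]
      fun _ : ℍ => (1 : ℝ) ^ 24 := by
    refine h1.trans (IsBigO.of_bound 1 ?_)
    filter_upwards with τ
    rw [Real.norm_eq_abs, Real.abs_exp, one_pow, norm_one, one_mul, Real.exp_le_one_iff]
    exact mul_nonpos_of_nonpos_of_nonneg (mul_nonpos_of_nonneg_of_nonpos (by positivity) hle)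
      τ.im_pos.le
  exact IsBigO.of_pow (by norm_num) h2

/-- If the greatest common divisor of `c` and `N` is `N / e`, an element of the Atkin--Lehner coset
of `e` maps the cusp `a / c` to `i∞`. -/
lemma exists_mem_atkinLehnerCoset_smul_smul [NeZero N] {e : ℕ} (heN : e ∣ N)
    (hco : Nat.Coprime e (N / e)) (g : SL(2, ℤ)) (hgcd : Int.gcd (g 1 0) N = N / e) :
    ∃ γ ∈ atkinLehnerCoset N e, ∃ r : ℝ, 0 < r ∧ ∃ t : ℝ, ∀ τ : ℍ,
      ((γ • (g • τ) : ℍ) : ℂ) = r * τ + t := by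
  have hN := NeZero.ne N
  have he0 : e ≠ 0 := fun h => hN (zero_dvd_iff.mp (h ▸ heN))
  set a := g 0 0 with ha
  set b := g 0 1 with hb
  set c := g 1 0 with hc
  set d := g 1 1 with hd
  have hdet : a * d - b * c = 1 := by
    have := g.det_coe
    rwa [Matrix.det_fin_two] at this
  have hNe : (N / e) * e = N := Nat.div_mul_cancel heN
  have hM0 : N / e ≠ 0 := fun h => hN (by rw [← hNe, h, zero_mul])
  obtain ⟨C, hC⟩ : ((N / e : ℕ) : ℤ) ∣ c := hgcd ▸ Int.gcd_dvd_left c N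
  have hCe : IsCoprime C (e : ℤ) := by
    have h1 := Int.gcd_eq_gcd_ab c N
    rw [hgcd] at h1
    refine ⟨Int.gcdA c N, Int.gcdB c N, mul_left_cancel₀ (by exact_mod_cast hM0 :
      ((N / e : ℕ) : ℤ) ≠ 0) ?_⟩
    have h2 : ((N / e : ℕ) : ℤ) * e = N := by exact_mod_cast hNe
    rw [mul_one]
    conv_rhs => rw [h1]
    linear_combination (Int.gcdB c N) * h2 - Int.gcdA c N * hC
  have hcop : IsCoprime (a * e) (C * (N / e : ℕ)) := by
    have hac : IsCoprime a (C * (N / e : ℕ)) := ⟨d, -b, by rw [← hdet, hC]; ring⟩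
    refine IsCoprime.mul_left hac (IsCoprime.mul_right hCe.symm ?_)
    exact Nat.isCoprime_iff_coprime.mpr hco
  obtain ⟨D, B, hDB⟩ := hcop
  obtain ⟨γ, hγ, hγ'⟩ := exists_mem_atkinLehnerCoset he0 heN (a := D) (b := B) (c := -C) (d := a)
    (by linear_combination hDB)
  have he' : (0 : ℝ) < e := by exact_mod_cast Nat.pos_of_ne_zero he0
  refine ⟨γ, hγ, 1 / e, by positivity, (D * e * b + B * d) / e, fun τ => ?_⟩
  have hg : ((g • τ : ℍ) : ℂ) = (a * τ + b) / (c * τ + d) := by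
    simpa using UpperHalfPlane.coe_specialLinearGroup_apply g τ
  have hcd : (c * τ + d : ℂ) ≠ 0 := intCast_mul_add_ne_zero (by
    by_contra! h
    rw [h.1, h.2] at hdet
    simp at hdet) τ.im_pos
  have heC : (e : ℂ) ≠ 0 := by exact_mod_cast he0
  have hdetC : (a * d - b * c : ℂ) = 1 := by exact_mod_cast hdet
  have hNeC : ((N / e : ℕ) : ℂ) * e = N := by exact_mod_cast hNe
  have hcC : (c : ℂ) = (N / e : ℕ) * C := by
    simpa only [Int.cast_mul, Int.cast_natCast] using congrArg (Int.cast : ℤ → ℂ) hC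
  have hDBC : (D * (a * e) + B * (C * (N / e : ℕ)) : ℂ) = 1 := by
    simpa only [Int.cast_add, Int.cast_mul, Int.cast_natCast, Int.cast_one] using
      congrArg (Int.cast : ℤ → ℂ) hDB
  have hnum : D * e * ((g • τ : ℍ) : ℂ) + B = (τ + (D * e * b + B * d)) / (c * τ + d) := by
    rw [hg, eq_div_iff hcd, add_mul, mul_assoc, div_mul_cancel₀ _ hcd, hcC]
    linear_combination (τ : ℂ) * hDBC
  have hden : ((-C : ℤ) : ℂ) * N * ((g • τ : ℍ) : ℂ) + a * e = e / (c * τ + d) := by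
    rw [hg, eq_div_iff hcd, add_mul, mul_assoc, div_mul_cancel₀ _ hcd, ← hNeC]
    rw [hcC] at hdetC ⊢
    push_cast
    linear_combination (e : ℂ) * hdetC
  rw [hγ', hnum, hden, div_div_div_cancel_right₀ hcd]
  push_cast
  ring

end Cusps

/-! ### The expansion of an eta quotient at `i∞` -/

section Expansion

open Complex hiding eta
open ModularForm UpperHalfPlane Filter Asymptotics Topology

variable {N : ℕ} {k : ℕ → ℤ}

/-- The Euler product `∏ (1 - q ^ n)`, over `n ≥ 1`. -/
def eulerProduct (q : ℂ) : ℂ := ∏' n : ℕ, (1 - q ^ (n + 1))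

lemma eta_eq_qParam_mul_eulerProduct (z : ℂ) :
    eta z = Function.Periodic.qParam 24 z * eulerProduct (Function.Periodic.qParam 1 z) := rfl

lemma eulerProduct_zero : eulerProduct 0 = 1 := by simp [eulerProduct]

lemma differentiableOn_eulerProduct : DifferentiableOn ℂ eulerProduct (Metric.ball 0 1) :=
  differentiableOn_tprod_one_sub_pow

lemma logDeriv_eulerProduct_zero : logDeriv eulerProduct 0 = -1 := by
  have hterm : ∀ i : ℕ, logDeriv (fun q : ℂ => 1 - q ^ (i + 1)) 0 = if i = 0 then -1 else 0 := by
    intro i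
    rw [logDeriv_apply, deriv_const_sub, deriv_pow_field]
    rcases i with _ | i <;> simp
  have h := logDeriv_tprod_eq_tsum (s := Metric.ball (0 : ℂ) 1) Metric.isOpen_ball
    (Metric.mem_ball_self one_pos) (f := fun (n : ℕ) (q : ℂ) => 1 - q ^ (n + 1)) (by simp)
    (fun i => by fun_prop)
    (by simp only [hterm]; exact (hasSum_ite_eq 0 (-1 : ℂ)).summable)
    multipliableLocallyUniformlyOn_one_sub_pow (by simp)
  simp only [hterm, tsum_ite_eq] at h
  exact h

lemma isBigO_sub_sub_deriv_mul {F : ℂ → ℂ} (hF : AnalyticAt ℂ F 0) :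
    (fun q => F q - F 0 - deriv F 0 * q) =O[𝓝 0] fun q => q ^ 2 := by
  obtain ⟨p, hp⟩ := hF
  have h1 : AnalyticAt ℂ (dslope F 0) 0 := ⟨_, hp.has_fpower_series_dslope_fslope⟩
  have h2 := h1.differentiableAt.isBigO_sub
  have h3 := (isBigO_refl (fun q : ℂ => q) (𝓝 0)).mul h2
  refine (h3.congr_left fun q => ?_).congr_right fun q => by ring
  have h4 := sub_smul_dslope F 0 q
  rw [dslope_same]
  simp only [sub_zero, smul_eq_mul] at h4
  rw [mul_sub, h4]
  ring

/-- The inverse of the eta quotient without its leading power of `q`, as a function of `q`. -/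
def eulerQuot (N : ℕ) (k : ℕ → ℤ) (q : ℂ) : ℂ := ∏ n ∈ N.divisors, eulerProduct (q ^ n) ^ (-k n)

lemma differentiableAt_eulerProduct_pow {n : ℕ} (hn : n ∈ N.divisors) {q : ℂ}
    (hq : q ∈ Metric.ball (0 : ℂ) 1) :
    DifferentiableAt ℂ (fun q : ℂ => eulerProduct (q ^ n)) q := by
  have hn0 := (Nat.pos_of_mem_divisors hn).ne'
  have hq' : q ^ n ∈ Metric.ball (0 : ℂ) 1 := by
    rw [mem_ball_zero_iff] at hq ⊢
    rw [norm_pow]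
    exact pow_lt_one₀ (norm_nonneg _) hq hn0
  exact (differentiableOn_eulerProduct.differentiableAt (Metric.isOpen_ball.mem_nhds hq')).comp q
    (differentiableAt_fun_id.fun_pow n)

lemma eulerProduct_zero_pow {n : ℕ} (hn : n ∈ N.divisors) : eulerProduct ((0 : ℂ) ^ n) = 1 := by
  rw [zero_pow (Nat.pos_of_mem_divisors hn).ne', eulerProduct_zero]

lemma eulerQuot_zero : eulerQuot N k 0 = 1 :=
  Finset.prod_eq_one fun n hn => by rw [eulerProduct_zero_pow hn, one_zpow]

lemma analyticAt_eulerQuot : AnalyticAt ℂ (eulerQuot N k) 0 := by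
  have hev : ∀ᶠ q in 𝓝 (0 : ℂ), DifferentiableAt ℂ (eulerQuot N k) q := by
    have hne : ∀ᶠ q in 𝓝 (0 : ℂ), ∀ n ∈ N.divisors, eulerProduct (q ^ n) ≠ 0 := by
      refine (Finset.eventually_all _).mpr fun n hn => ?_
      refine (differentiableAt_eulerProduct_pow hn
        (Metric.mem_ball_self one_pos)).continuousAt.eventually_ne ?_
      rw [eulerProduct_zero_pow hn]
      exact one_ne_zero
    filter_upwards [hne, Metric.ball_mem_nhds (0 : ℂ) one_pos] with q hq hq1
    unfold eulerQuot
    exact DifferentiableAt.fun_finsetProd fun n hn =>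
      (differentiableAt_eulerProduct_pow hn hq1).zpow (Or.inl (hq n hn))
  obtain ⟨s, hs, hs'⟩ := eventually_iff_exists_mem.mp hev
  exact DifferentiableOn.analyticAt (fun q hq => (hs' q hq).differentiableWithinAt) hs

/-- Only the factor for `n = 1` contributes to the coefficient of `q`. -/
lemma deriv_eulerQuot_zero (hN : N ≠ 0) : deriv (eulerQuot N k) 0 = k 1 := by
  have h0 : (0 : ℂ) ∈ Metric.ball (0 : ℂ) 1 := Metric.mem_ball_self one_pos
  have hlog : logDeriv (eulerQuot N k) 0 = k 1 := by
    have h1 := logDeriv_prod (𝕜 := ℂ) (s := N.divisors) (x := 0)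
      (f := fun n q => eulerProduct (q ^ n) ^ (-k n))
      (fun n hn => by rw [eulerProduct_zero_pow hn, one_zpow]; exact one_ne_zero)
      (fun n hn => (differentiableAt_eulerProduct_pow hn h0).zpow
        (Or.inl (by rw [eulerProduct_zero_pow hn]; exact one_ne_zero)))
    have h2 : ∀ n ∈ N.divisors, logDeriv (fun q : ℂ => eulerProduct (q ^ n) ^ (-k n)) 0 =
        if n = 1 then (k 1 : ℂ) else 0 := by
      intro n hn
      have hn0 := (Nat.pos_of_mem_divisors hn).ne'
      have h3 := logDeriv_comp (f := eulerProduct) (g := fun q : ℂ => q ^ n) (x := 0)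
        (by
          rw [zero_pow hn0]
          exact differentiableOn_eulerProduct.differentiableAt (Metric.isOpen_ball.mem_nhds h0))
        (by fun_prop)
      rw [logDeriv_fun_zpow (differentiableAt_eulerProduct_pow hn h0)]
      change _ * logDeriv (eulerProduct ∘ fun q : ℂ => q ^ n) 0 = _
      rw [h3, zero_pow hn0, logDeriv_eulerProduct_zero, deriv_pow_field]
      obtain ⟨m, rfl⟩ := Nat.exists_eq_succ_of_ne_zero hn0
      rcases m with _ | m <;> simp
    rw [show eulerQuot N k = fun q => ∏ n ∈ N.divisors, eulerProduct (q ^ n) ^ (-k n) from rfl, h1,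
      Finset.sum_congr rfl h2, Finset.sum_ite_eq', if_pos (by simpa using hN)]
  rwa [logDeriv_apply, eulerQuot_zero, div_one] at hlog

lemma inv_etaQuot_eq (hsum : ∑ n ∈ N.divisors, n * k n = 24) (z : ℂ) :
    1 / etaQuot N k z = (Function.Periodic.qParam 1 z)⁻¹ *
      eulerQuot N k (Function.Periodic.qParam 1 z) := by
  have hq : ∀ n : ℕ, Function.Periodic.qParam 1 (n * z) = Function.Periodic.qParam 1 z ^ n := by
    intro n
    rw [Function.Periodic.qParam, Function.Periodic.qParam, ← exp_nat_mul]
    congr 1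
    ring
  have hq24 : ∀ n : ℕ, Function.Periodic.qParam 24 (n * z) = Function.Periodic.qParam 24 z ^ n := by
    intro n
    rw [Function.Periodic.qParam, Function.Periodic.qParam, ← exp_nat_mul]
    congr 1
    ring
  have h24 : Function.Periodic.qParam 24 z ^ 24 = Function.Periodic.qParam 1 z := by
    rw [Function.Periodic.qParam, Function.Periodic.qParam, ← exp_nat_mul]
    congr 1
    push_cast
    ring
  have h1 : etaQuot N k z = Function.Periodic.qParam 1 z *
      ∏ n ∈ N.divisors, eulerProduct (Function.Periodic.qParam 1 z ^ n) ^ k n := by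
    have h2 : ∀ n ∈ N.divisors, eta (n * z) ^ k n = Function.Periodic.qParam 24 z ^ (n * k n) *
        eulerProduct (Function.Periodic.qParam 1 z ^ n) ^ k n := fun n _ => by
      rw [eta_eq_qParam_mul_eulerProduct, hq, hq24, mul_zpow, ← zpow_natCast, ← zpow_mul]
    rw [etaQuot, Finset.prod_congr rfl h2, Finset.prod_mul_distrib,
      prod_zpow_eq_zpow_sum₀ _ (Function.Periodic.qParam_ne_zero _), hsum, ← h24]
    norm_cast
  rw [h1, one_div, mul_inv, ← Finset.prod_inv_distrib, eulerQuot]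
  simp only [zpow_neg]

/-- The inverse of the eta quotient is `q⁻¹ + k₁ + O(q)`. -/
theorem hasLeadingExpansion_inv_etaQuot (hN : N ≠ 0) (hsum : ∑ n ∈ N.divisors, n * k n = 24) {d : ℕ}
    (hd : k 1 = -d) : HasLeadingExpansion (fun τ => 1 / etaQuot N k τ) d := by
  have h1 := (isBigO_sub_sub_deriv_mul (analyticAt_eulerQuot (N := N) (k := k))).comp_tendsto
    HasSimplePoleAtInfty.tendsto_qParam
  have h2 := (isBigO_refl (fun τ : ℍ => (Function.Periodic.qParam 1 (τ : ℂ))⁻¹) atImInfty).mul h1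
  refine (h2.congr_left fun τ => ?_).congr_right fun τ => ?_
  · have hq := Function.Periodic.qParam_ne_zero (h := 1) (τ : ℂ)
    simp only [Function.comp_apply]
    rw [inv_etaQuot_eq hsum, eulerQuot_zero, deriv_eulerQuot_zero hN, hd]
    field_simp
    push_cast
    ring
  · have hq := Function.Periodic.qParam_ne_zero (h := 1) (τ : ℂ)
    simp only [Function.comp_apply]
    field_simp

end Expansion

/-! ### Principal moduli from eta quotients -/

section EtaQuotient

open Complex hiding eta
open ModularForm UpperHalfPlane MatrixGroups Filter Asymptotics Topology

variable {N : ℕ} {k : ℕ → ℤ}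

lemma coe_mem_atkinLehnerCoset_one [NeZero N] {γ : SL(2, ℤ)}
    (hγ : γ ∈ CongruenceSubgroup.Gamma0 N) : (γ : SL(2, ℝ)) ∈ atkinLehnerCoset N 1 := by
  obtain ⟨c, hc⟩ := (ZMod.intCast_zmod_eq_zero_iff_dvd _ N).mp (CongruenceSubgroup.Gamma0_mem.mp hγ)
  have hdet := Matrix.det_fin_two (γ : Matrix (Fin 2) (Fin 2) ℤ)
  rw [γ.det_coe, hc] at hdet
  refine ⟨γ 0 0, γ 0 1, c, γ 1 1, ?_, ?_⟩
  · rw [Nat.div_one]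
    push_cast
    linear_combination -hdet
  · ext i j
    fin_cases i <;> fin_cases j <;> simp [hc, mul_comm]

/-- The inverse of an eta quotient of level `N` that is invariant under `Γ₀(N) + S` has a single
simple pole, at the cusp `i∞` of this group, if the eta quotient does not vanish at the cusps of
`Γ₀(N)` that are not equivalent to `i∞` under `Γ₀(N) + S`. The latter are the cusps `a / c` for
which `(c, N)` is not of the form `N / e` with `e ∈ S`. -/
theorem hasSimplePoleAtInfty_inv_etaQuot [NeZero N] {S : ExactDivisorGroup N} {d : ℕ}
    (h0 : ∑ n ∈ N.divisors, k n = 0) (hsum : ∑ n ∈ N.divisors, n * k n = 24) (hd : k 1 = -d)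
    (hinv : Gamma0Plus N S ≤ etaQuotStabilizer N k)
    (hcusp : ∀ m ∈ N.divisors, (∃ e ∈ S.carrier, m = N / e) ∨ cuspOrder N k m ≤ 0) :
    HasSimplePoleAtInfty (Gamma0Plus N S) (CongruenceSubgroup.Gamma0 N)
      fun τ => 1 / etaQuot N k τ where
  le γ hγ := ⟨1, S.one_mem, coe_mem_atkinLehnerCoset_one hγ⟩
  translation_mem := CongruenceSubgroup.Gamma0_mem.mpr (by simp [ModularGroup.T])
  holomorphic := by
    rw [UpperHalfPlane.mdifferentiable_iff]
    refine ((differentiableOn_const 1).div (differentiableOn_etaQuot (N := N) (k := k))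
      fun z hz => etaQuot_ne_zero hz).congr fun z hz => ?_
    simp [UpperHalfPlane.ofComplex_apply_of_im_pos hz]
  invariant γ hγ τ := by rw [hinv hγ τ]
  expansion := by
    have h := (hasLeadingExpansion_inv_etaQuot (NeZero.ne N) hsum hd).trans
      (HasSimplePoleAtInfty.tendsto_qParam.isBigO_one ℝ)
    refine (h.sub (isBigO_const_const (d : ℂ) (one_ne_zero (α := ℝ)) _)).congr_left fun τ => ?_
    ring
  cusps g := by
    have hm : Int.gcd (g 1 0) N ∈ N.divisors :=
      Nat.mem_divisors.mpr ⟨by simpa using Int.gcd_dvd_natAbs_right (g 1 0) N, NeZero.ne N⟩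
    rcases hcusp _ hm with ⟨e, he, hme⟩ | h
    · obtain ⟨heN, hco⟩ := S.exact_dvd e he
      obtain ⟨γ, hγ, r, hr, t, ht⟩ := exists_mem_atkinLehnerCoset_smul_smul heN hco g hme
      exact .inl ⟨γ, ⟨e, he, hγ⟩, r, hr, t, ht⟩
    · exact .inr (isBoundedAtImInfty_inv_etaQuot h0 g h)

/-- Two functions with the same leading expansion differ by a function that vanishes at `i∞`. -/
lemma HasLeadingExpansion.tendsto_sub {T T' : ℍ → ℂ} {d : ℕ} (hT : HasLeadingExpansion T d)
    (hT' : HasLeadingExpansion T' d) : Tendsto (fun τ => T' τ - T τ) atImInfty (𝓝 0) := by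
  refine (((hT'.sub hT).congr_left fun τ => ?_).trans_tendsto HasSimplePoleAtInfty.tendsto_qParam)
  ring

/-- The inverse of a suitable eta quotient is the unique principal modulus with its leading
expansion. The arithmetic conditions on the exponents say that the eta quotient has weight `0`,
that it is invariant under `Γ₀(N)` and under one element of each coset `W_N(e)` with `e ∈ S`, and
that its only zero is a simple one at the cusp `i∞`. -/
theorem isPrincipalModulus_inv_etaQuot [NeZero N] {S : ExactDivisorGroup N} {d : ℕ}
    (h0 : ∑ n ∈ N.divisors, k n = 0) (hsum : ∑ n ∈ N.divisors, n * k n = 24)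
    (hdual : (24 : ℤ) ∣ ∑ n ∈ N.divisors, (N / n : ℕ) * k n)
    (hsq : IsSquare (∏ n ∈ N.divisors, n ^ (k n).natAbs)) (hd : k 1 = -d)
    (hcusp : ∀ m ∈ N.divisors, (∃ e ∈ S.carrier, m = N / e) ∨ cuspOrder N k m ≤ 0)
    (hS : ∀ e ∈ S.carrier, e ≠ 1 → ∃ w ∈ atkinLehnerCoset N e, w ∈ etaQuotStabilizer N k) :
    (IsPrincipalModulus (Gamma0Plus N S) (fun τ => 1 / etaQuot N k τ) ∧
      HasLeadingExpansion (fun τ => 1 / etaQuot N k τ) d) ∧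
    ∀ T : ℍ → ℂ, IsPrincipalModulus (Gamma0Plus N S) T → HasLeadingExpansion T d →
      T = fun τ : ℍ => 1 / etaQuot N k τ := by
  have hone : ∀ g ∈ atkinLehnerCoset N 1, g ∈ etaQuotStabilizer N k := fun g hg =>
    mem_etaQuotStabilizer_of_mem_atkinLehnerCoset_one h0 (hsum ▸ dvd_rfl) hdual hsq hg
  have hinv : Gamma0Plus N S ≤ etaQuotStabilizer N k := by
    refine gamma0Plus_le_etaQuotStabilizer S hone fun e he => ?_
    rcases eq_or_ne e 1 with rfl | h1
    · refine ⟨1, ?_, one_mem _⟩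
      simpa using coe_mem_atkinLehnerCoset_one (N := N) (one_mem (CongruenceSubgroup.Gamma0 N))
    · exact hS e he h1
  have hpole := hasSimplePoleAtInfty_inv_etaQuot h0 hsum hd hinv hcusp
  have hexp := hasLeadingExpansion_inv_etaQuot (NeZero.ne N) hsum hd
  exact ⟨⟨hpole.isPrincipalModulus, hexp⟩, fun T hT hTexp =>
    hpole.eq_of_isPrincipalModulus hT (hexp.tendsto_sub hTexp)⟩

end EtaQuotient

/-! ### The Coxeter Frame shapes of the Niemeier root systems -/

section Niemeier

open Complex hiding eta
open ModularForm UpperHalfPlane MatrixGroups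

/-- The factors of the Coxeter Frame shape, as a list of pairs `(n, k)` that stand for `n ^ k`. -/
def ADEType.frameFactors : ADEType → List (ℕ × ℤ)
  | A n _ => [(n + 1, 1), (1, -1)]
  | D n _ => [(2 * n - 2, 1), (2, 1), (n - 1, -1), (1, -1)]
  | E6 => [(2, 1), (3, 1), (12, 1), (1, -1), (4, -1), (6, -1)]
  | E7 => [(2, 1), (3, 1), (18, 1), (1, -1), (6, -1), (9, -1)]
  | E8 => [(2, 1), (3, 1), (5, 1), (30, 1), (1, -1), (6, -1), (10, -1), (15, -1)]

/-- The exponent of `n` in the product of the Coxeter Frame shapes of the types in `l`, in a form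
that evaluates. -/
def frameExponent (l : List ADEType) (n : ℕ) : ℤ :=
  ((l.flatMap ADEType.frameFactors).map fun p => if p.1 = n then p.2 else 0).sum

lemma etaProduct_single (n : ℕ+) (j : ℤ) (τ : ℍ) :
    etaProduct (Finsupp.single n j) τ = eta ((n : ℕ) * τ) ^ j :=
  Finsupp.prod_single_index (zpow_zero _)

lemma etaProduct_add (π π' : FrameShape) (τ : ℍ) :
    etaProduct (π + π') τ = etaProduct π τ * etaProduct π' τ :=
  Finsupp.prod_add_index' (fun _ => zpow_zero _) fun n _ _ =>
    zpow_add₀ (eta_ne_zero (natCast_mul_im_pos (Nat.mem_divisors_self n n.ne_zero) τ.im_pos)) _ _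

lemma etaProduct_frame (t : ADEType) (τ : ℍ) :
    etaProduct t.frame τ = (t.frameFactors.map fun p => eta (p.1 * τ) ^ p.2).prod := by
  have hD : ∀ n, 4 ≤ n → ((2 * n - 3).succPNat : ℕ) = 2 * n - 2 ∧
      ((n - 2).succPNat : ℕ) = n - 1 :=
    fun n hn => ⟨by rw [Nat.succPNat_coe]; omega, by rw [Nat.succPNat_coe]; omega⟩
  cases t with
  | D n hn =>
    simp only [ADEType.frame, ADEType.frameFactors, etaProduct_add, etaProduct_single, hD n hn,
      List.map_cons, List.map_nil, List.prod_cons, List.prod_nil, mul_assoc, mul_one]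
    rfl
  | _ =>
    simp only [ADEType.frame, ADEType.frameFactors, etaProduct_add, etaProduct_single,
      List.map_cons, List.map_nil, List.prod_cons, List.prod_nil, mul_assoc, mul_one]
    rfl

lemma etaProduct_sum_frame (l : List ADEType) (τ : ℍ) :
    etaProduct (l.map ADEType.frame).sum τ =
      ((l.flatMap ADEType.frameFactors).map fun p => eta (p.1 * τ) ^ p.2).prod := by
  induction l with
  | nil => simp [etaProduct]
  | cons t l ih => simp [etaProduct_add, etaProduct_frame, ih]

/-- Collecting the powers with equal base in a product. -/
lemma prod_map_zpow_eq_prod {G : Type*} [CommGroupWithZero G] {f : ℕ → G} {s : Finset ℕ}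
    (hf : ∀ n ∈ s, f n ≠ 0) {L : List (ℕ × ℤ)} (hL : ∀ p ∈ L, p.1 ∈ s) :
    (L.map fun p => f p.1 ^ p.2).prod =
      ∏ n ∈ s, f n ^ (L.map fun p => if p.1 = n then p.2 else 0).sum := by
  induction L with
  | nil => simp
  | cons p L ih =>
    have hp : p.1 ∈ s := hL p (by simp)
    rw [List.map_cons, List.prod_cons, ih fun q hq => hL q (by simp [hq])]
    simp only [List.map_cons, List.sum_cons]
    rw [Finset.prod_congr rfl fun n hn => zpow_add₀ (hf n hn) _ _, Finset.prod_mul_distrib]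
    congr 1
    rw [Finset.prod_eq_single_of_mem p.1 hp fun n _ hn => by simp [Ne.symm hn]]
    simp

lemma etaProduct_sum_frame_eq_etaQuot {N : ℕ} {l : List ADEType}
    (hl : ∀ p ∈ l.flatMap ADEType.frameFactors, p.1 ∈ N.divisors) (τ : ℍ) :
    etaProduct (l.map ADEType.frame).sum τ = etaQuot N (frameExponent l) τ := by
  rw [etaProduct_sum_frame, etaQuot, prod_map_zpow_eq_prod (f := fun n => eta (n * τ))
    (fun n hn => eta_natCast_mul_ne_zero hn τ.im_pos) hl]
  rfl

/-- The criterion for inverses of eta quotients, for products of Coxeter Frame shapes. The numerical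
conditions on the exponents are collected into one decidable proposition. -/
theorem isPrincipalModulus_inv_etaProduct {N : ℕ} [NeZero N] {S : ExactDivisorGroup N}
    {l : List ADEType} (hl : ∀ p ∈ l.flatMap ADEType.frameFactors, p.1 ∈ N.divisors)
    (h : ∑ n ∈ N.divisors, frameExponent l n = 0 ∧ ∑ n ∈ N.divisors, n * frameExponent l n = 24 ∧
      (24 : ℤ) ∣ ∑ n ∈ N.divisors, (N / n : ℕ) * frameExponent l n ∧
      IsSquare (∏ n ∈ N.divisors, n ^ (frameExponent l n).natAbs) ∧
      frameExponent l 1 = -l.length ∧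
      ∀ m ∈ N.divisors, (∃ e ∈ S.carrier, m = N / e) ∨ cuspOrder N (frameExponent l) m ≤ 0)
    (hS : ∀ e ∈ S.carrier, e ≠ 1 →
      ∃ w ∈ atkinLehnerCoset N e, w ∈ etaQuotStabilizer N (frameExponent l)) :
    (IsPrincipalModulus (Gamma0Plus N S) (fun τ => 1 / etaProduct (l.map ADEType.frame).sum τ) ∧
      HasLeadingExpansion (fun τ => 1 / etaProduct (l.map ADEType.frame).sum τ) l.length) ∧
    ∀ T : ℍ → ℂ, IsPrincipalModulus (Gamma0Plus N S) T → HasLeadingExpansion T l.length →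
      T = fun τ => 1 / etaProduct (l.map ADEType.frame).sum τ := by
  obtain ⟨h0, hsum, hdual, hsq, hd, hcusp⟩ := h
  simp only [etaProduct_sum_frame_eq_etaQuot hl]
  exact isPrincipalModulus_inv_etaQuot h0 hsum hdual hsq hd hcusp hS

lemma exists_mem_atkinLehnerCoset_of_trivial {N : ℕ} {k : ℕ → ℤ} :
    ∀ e ∈ (ExactDivisorGroup.trivial N).carrier, e ≠ 1 →
      ∃ w ∈ atkinLehnerCoset N e, w ∈ etaQuotStabilizer N k :=
  fun _ he h1 => absurd (Finset.mem_singleton.mp he) h1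

/-- If `N = 2 e` with `e` odd, the coset `W_N(e)` contains the element
`(1/√e) (e, -(e + 1) / 2; N, -e)` of trace zero. -/
lemma exists_mem_atkinLehnerCoset_of_two_mul {N e : ℕ} [NeZero N] {k : ℕ → ℤ}
    (h : N = 2 * e ∧ e % 2 = 1 ∧ ∑ n ∈ N.divisors, k n = 0 ∧ IsAtkinLehnerInvariant N k e) :
    ∀ f ∈ ({1, e} : Finset ℕ), f ≠ 1 → ∃ w ∈ atkinLehnerCoset N f, w ∈ etaQuotStabilizer N k := by
  obtain ⟨hN, he, h0, hk⟩ := h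
  intro f hf h1
  obtain rfl : f = e := by simpa [h1] using hf
  have h2 : N / f = 2 := Nat.div_eq_of_eq_mul_left (by omega) hN
  refine exists_mem_atkinLehnerCoset_of_elliptic ⟨2, by omega⟩ h0 hk (a := 1)
    (b := -((f + 1) / 2 : ℕ)) (c := 1) one_pos ?_
  rw [h2]
  omega

theorem isPrincipalModulus_niemeier (X : NiemeierType) :
    (IsPrincipalModulus X.group
        (fun τ => 1 / etaProduct (X.components.map ADEType.frame).sum τ) ∧
      HasLeadingExpansion (fun τ => 1 / etaProduct (X.components.map ADEType.frame).sum τ)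
        X.numComponents) ∧
    ∀ T : ℍ → ℂ, IsPrincipalModulus X.group T → HasLeadingExpansion T X.numComponents →
      T = fun τ => 1 / etaProduct (X.components.map ADEType.frame).sum τ := by
  cases X with
  | D4_6 | D6_4 | D8_3 | D10_E7_2 | D12_2 | D16_E8 | D24 =>
    exact isPrincipalModulus_inv_etaProduct (by decide +kernel) (by decide +kernel)
      (exists_mem_atkinLehnerCoset_of_two_mul (by decide +kernel))
  | E6_4 =>
    refine isPrincipalModulus_inv_etaProduct (by decide +kernel) (by decide +kernel) ?_
    intro e he h1
    obtain rfl : e = 4 := by simpa [h1] using he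
    exact exists_mem_atkinLehnerCoset_twelve (by decide +kernel) (by decide +kernel)
      (by decide +kernel) (by decide +kernel) (by decide +kernel) (by decide +kernel)
  | E8_3 =>
    refine isPrincipalModulus_inv_etaProduct (by decide +kernel) (by decide +kernel) ?_
    -- The coset of `10` is the product of those of `6` and `15`, which contain trace zero elements.
    have h6 := exists_mem_atkinLehnerCoset_of_elliptic (N := 30) (e := 6)
      (k := frameExponent NiemeierType.E8_3.components) (by decide) (by decide +kernel)
      (by decide +kernel) (a := 2) (b := -5) (c := 1) (by decide) (by decide)
    have h15 := exists_mem_atkinLehnerCoset_of_elliptic (N := 30) (e := 15)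
      (k := frameExponent NiemeierType.E8_3.components) (by decide) (by decide +kernel)
      (by decide +kernel) (a := 1) (b := -8) (c := 1) (by decide) (by decide)
    intro e he h1
    simp only [Finset.mem_insert, Finset.mem_singleton] at he
    rcases he with rfl | rfl | rfl | rfl
    · exact absurd rfl h1
    · exact h6
    · exact exists_mem_atkinLehnerCoset_mul (e := 6) (f := 15) (by decide) (by decide) h6 h15
    · exact h15
  | _ =>
    exact isPrincipalModulus_inv_etaProduct (by decide +kernel) (by decide +kernel)
      exists_mem_atkinLehnerCoset_of_trivial

end Niemeier

end

/-- The Niemeier root system `X` is the orthogonal union of irreducible root systems `P k`, one for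
each entry of the list of components of `X`, with simple roots `b k`. Its Coxeter Frame shape is the
product `∑ k, π k` of the Coxeter Frame shapes of the components. -/
theorem proposition1p1 (X : NiemeierType)
    {ι M N : Fin X.numComponents → Type*}
    [∀ k, Finite (ι k)]
    [∀ k, AddCommGroup (M k)] [∀ k, Module ℝ (M k)] [∀ k, FiniteDimensional ℝ (M k)]
    [∀ k, AddCommGroup (N k)] [∀ k, Module ℝ (N k)]
    (P : ∀ k, RootPairing (ι k) ℝ (M k) (N k))
    [∀ k, (P k).IsRootSystem] [∀ k, (P k).IsCrystallographic] [∀ k, (P k).IsReduced]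
    (b : ∀ k, (P k).Base)
    (hX : ∀ k, HasADEType (b k) (X.components.get k)) :
    (∀ k, ∃! π : FrameShape, IsCoxeterFrameShape (b k) π) ∧
    ∀ π : Fin X.numComponents → FrameShape, (∀ k, IsCoxeterFrameShape (b k) (π k)) →
      (IsPrincipalModulus X.group (fun τ => 1 / etaProduct (∑ k, π k) τ) ∧
        HasLeadingExpansion (fun τ => 1 / etaProduct (∑ k, π k) τ) X.numComponents) ∧
      ∀ T : UpperHalfPlane → ℂ,
        IsPrincipalModulus X.group T → HasLeadingExpansion T X.numComponents →
          T = fun τ => 1 / etaProduct (∑ k, π k) τ := by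
  refine ⟨fun k => ⟨_, (isCoxeterFrameShape_iff (hX k) _).mpr rfl, fun π hπ =>
    (isCoxeterFrameShape_iff (hX k) π).mp hπ⟩, fun π hπ => ?_⟩
  have h : ∑ k, π k = (X.components.map ADEType.frame).sum := by
    rw [Fintype.sum_congr _ _ fun k => (isCoxeterFrameShape_iff (hX k) _).mp (hπ k)]
    exact Fin.sum_univ_fun_getElem X.components ADEType.frame
  rw [h]
  exact isPrincipalModulus_niemeier X
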